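/- Let $M$ be a smooth (finite-dimensional, Hausdorff, second countable) manifold, $E\to M$ a smooth real vector bundle of finite rank, and $j\colon TM\oplus E^*\to TM\oplus E^*$ a smooth vector bundle morphism over $\mathrm{id}_M$. *Linear generalised complex structures.* A generalised complex structure on the manifold $E$ is a smooth vector bundle morphism $\mathcal J\colon TE\oplus T^*E\to TE\oplus T^*E$ over $\mathrm{id}_E$ with $\mathcal J^2=-1$ that is orthogonal for the pairing $\langle(v,\theta),(w,\omega)\rangle=\theta(w)+\omega(v)$ and satisfies $$[\![ e_1,e_2]\!]-[\![ \mathcal Je_1,\mathcal Je_2]\!]+\mathcal J\bigl([\![ \mathcal Je_1,e_2]\!]+[\![ e_1,\mathcal Je_2]\!]\bigr)=0$$ for all sections $e_1,e_2$, where $[\![(X,\theta),(Y,\omega)]\!]=([X,Y],\mathcal L_X\omega-\iota_Y\mathbf d\theta)$. It is linear with side $j$ if it is a morphism of double vector bundles over $j$, i.e. also a vector bundle morphism over $j$ for the vector bundle structure $TE\oplus T^*E\to TM\oplus E^*$. *Dull brackets.* Let $Q\to M$ be a vector bundle with a vector bundle morphism $\rho\colon Q\to TM$. A dull bracket on $(Q,\rho)$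 is an $\mathbb R$-bilinear bracket $[\![\cdot,\cdot]\!]$ on $\Gamma(Q)$ with $\rho[\![ q_1,q_2]\!]=[\rho q_1,\rho q_2]$ and $$[\![ f_1q_1,f_2q_2]\!]=f_1f_2[\![ q_1,q_2]\!]+f_1\,\rho(q_1)(f_2)\,q_2-f_2\,\rho(q_2)(f_1)\,q_1 .$$ *Quasi-real complex Lie algebroids.* Let $j\colon Q\to Q$ be a vector bundle morphism. A complex Lie algebroid structure on $(Q,j)$ consists, provided that $j^2=-\mathrm{id}$, of a $\mathbb C$-bilinear Lie bracket $[\cdot,\cdot]$ on $\Gamma(Q)$ (with $j$ as multiplication by $i$) and a morphism of complex vector bundles $\lambda\colon Q\to T_{\mathbb C}M$ such that $[q_1,fq_2]=\lambda(q_1)(f)q_2+f[q_1,q_2]$ for $f\in C^\infty(M,\mathbb C)$; if $j^2\neq-\mathrm{id}$ there is none. A dull bracket $[\![\cdot,\cdot]\!]$ realises $[\cdot,\cdot]$ if its complexification restricts to the $i$-eigenbundle $Q^{1,0}$ of $j_{\mathbb C}$ and corresponds to $[\cdot,\cdot]$ under the isomorphism $Q\to Q^{1,0}$, $q\mapsto\frac12(q\otimes1-jq\otimes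 i)$. The complex Lie algebroid is quasi-real if there are a real vector bundle morphism $\rho\colon Q\to TM$ with $\lambda(q)=\frac12(\rho(q)\otimes 1-\rho(jq)\otimes i)$ and a dull bracket on $(Q,\rho)$ realising $[\cdot,\cdot]$. *Adapted dull brackets.* A dull bracket on $(TM\oplus E^*,\mathrm{pr}_{TM})$ is dual to a Dorfman connection $\Delta\colon\Gamma(TM\oplus E^*)\times\Gamma(E\oplus T^*M)\to\Gamma(E\oplus T^*M)$ through $$\mathrm{pr}_{TM}(\nu)\langle\nu',\tau\rangle=\langle[\![\nu,\nu']\!],\tau\rangle+\langle\nu',\Delta_\nu\tau\rangle .$$ This defines horizontal lifts $\sigma(X,\epsilon)(e(m))=(T_me\,X(m),\mathbf d\ell_\epsilon(e(m)))-\Delta_{(X,\epsilon)}(e,0)^\uparrow(e(m))$ for $e\in\Gamma(E)$, where $\ell_\epsilon\colon E\to\mathbb R$ is the fibrewise linear function defined by $\epsilon$ and $(e',\theta)^\uparrow$ is the pair of the vertical lift of $e'$ and the pullback of $\theta$ to $E$. The dull bracket is adapted to $\mathcal J$ if $\mathcal J(\sigma(\nu))=\sigma(j\nu)$ for all $\nu\in\Gamma(TM\oplus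 E^*)$. **Theorem.** There is a bijection between linear generalised complex structures $\mathcal J$ on $E$ with side $j$ and quasi-real complex Lie algebroid structures on $(TM\oplus E^*,j)$ with anchor $\mathrm{pr}_{TM,j}(\nu)=\frac12(\mathrm{pr}_{TM}\nu\otimes1-\mathrm{pr}_{TM}(j\nu)\otimes i)$, such that for corresponding structures a dull bracket on $(TM\oplus E^*,\mathrm{pr}_{TM})$ realises the complex Lie bracket if and only if it is adapted to $\mathcal J$. In particular every dull bracket realising the complex bracket is adapted to $\mathcal J$. -/

import Mathlib

open scoped Manifold ContDiff
open Bundle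

noncomputable section

namespace LinearGC

/-! ### Smooth sections and bundle morphisms -/

section Sections

variable {EM : Type*} [NormedAddCommGroup EM] [NormedSpace ℝ EM] {HM : Type*} [TopologicalSpace HM]
  (I : ModelWithCorners ℝ EM HM) {M : Type*} [TopologicalSpace M] [ChartedSpace HM M]
  (G₁ : Type*) [NormedAddCommGroup G₁] [NormedSpace ℝ G₁]
  (W₁ : M → Type*) [TopologicalSpace (TotalSpace G₁ W₁)] [∀ x, AddCommGroup (W₁ x)]
  [∀ x, Module ℝ (W₁ x)] [∀ x, TopologicalSpace (W₁ x)] [FiberBundle G₁ W₁] [VectorBundle ℝ G₁ W₁]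
  (G₂ : Type*) [NormedAddCommGroup G₂] [NormedSpace ℝ G₂]
  (W₂ : M → Type*) [TopologicalSpace (TotalSpace G₂ W₂)] [∀ x, AddCommGroup (W₂ x)]
  [∀ x, Module ℝ (W₂ x)] [∀ x, TopologicalSpace (W₂ x)] [FiberBundle G₂ W₂] [VectorBundle ℝ G₂ W₂]
  [∀ x, IsTopologicalAddGroup (W₂ x)] [∀ x, ContinuousSMul ℝ (W₂ x)]

/-- Smooth vector bundle morphisms `W₁ → W₂` over the identity of `M`, that is, smooth sections of
the vector bundle `Hom(W₁, W₂)`. -/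
abbrev BundleHom : Type _ :=
  Cₛ^∞⟮I; G₁ →L[ℝ] G₂, fun x : M => W₁ x →L[ℝ] W₂ x⟯

variable {I G₁ W₁ G₂ W₂}

/-- The action of a bundle morphism on sections. -/
def BundleHom.mapSection (φ : BundleHom I G₁ W₁ G₂ W₂) (s : Cₛ^∞⟮I; G₁, W₁⟯) :
    Cₛ^∞⟮I; G₂, W₂⟯ :=
  ⟨fun x => φ x (s x), ContMDiff.clm_bundle_apply φ.contMDiff s.contMDiff⟩

/-- The product `f · s` of a smooth function and a smooth section. -/
def smulSection (f : C^∞⟮I, M; ℝ⟯) (s : Cₛ^∞⟮I; G₁, W₁⟯) : Cₛ^∞⟮I; G₁, W₁⟯ :=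
  ⟨fun x => f x • s x, ContMDiff.smul_section f.contMDiff s.contMDiff⟩

/-- The projection `W₁ ⊕ W₂ → W₁`. -/
def fstHom [∀ x, IsTopologicalAddGroup (W₁ x)] [∀ x, ContinuousSMul ℝ (W₁ x)]
    [ContMDiffVectorBundle ∞ G₁ W₁ I] [ContMDiffVectorBundle ∞ G₂ W₂ I] :
    BundleHom I (G₁ × G₂) (W₁ ×ᵇ W₂) G₁ W₁ :=
  ⟨fun x => ContinuousLinearMap.fst ℝ (W₁ x) (W₂ x), by
    intro x₀
    rw [contMDiffAt_hom_bundle]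
    refine ⟨contMDiffAt_id, ?_⟩
    refine (contMDiffAt_const (c := ContinuousLinearMap.fst ℝ G₁ G₂)).congr_of_eventuallyEq ?_
    filter_upwards [(trivializationAt G₁ W₁ x₀).open_baseSet.mem_nhds
      (FiberBundle.mem_baseSet_trivializationAt' x₀),
      (trivializationAt G₂ W₂ x₀).open_baseSet.mem_nhds
      (FiberBundle.mem_baseSet_trivializationAt' x₀)] with x h₁ h₂
    set e := trivializationAt (G₁ × G₂) (W₁ ×ᵇ W₂) x₀ with he
    have h : x ∈ e.baseSet := ⟨h₁, h₂⟩
    refine ContinuousLinearMap.ext fun v => ?_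
    obtain ⟨w, rfl⟩ : ∃ w, e.continuousLinearMapAt ℝ x w = v :=
      ⟨_, e.continuousLinearMapAt_symmL h v⟩
    refine Eq.trans (b := (trivializationAt G₁ W₁ x₀).continuousLinearMapAt ℝ x
      (e.symmL ℝ x (e.continuousLinearMapAt ℝ x w)).1) rfl ?_
    rw [e.symmL_continuousLinearMapAt h, e.continuousLinearMapAt_apply_of_mem ℝ h,
      (trivializationAt G₁ W₁ x₀).continuousLinearMapAt_apply_of_mem ℝ h₁]
    rfl⟩

/-- The section `(s, 0)` of `W₁ ⊕ W₂` for a section `s` of `W₁`. -/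
def inlSection (s : Cₛ^∞⟮I; G₁, W₁⟯) : Cₛ^∞⟮I; G₁ × G₂, W₁ ×ᵇ W₂⟯ :=
  ⟨fun x => (s x, 0), by
    intro x₀
    have hs := s.contMDiff x₀
    have h0 : ContMDiffAt I (I.prod 𝓘(ℝ, G₂)) ∞
        (fun x => TotalSpace.mk' G₂ x (0 : W₂ x)) x₀ := contMDiff_zeroSection ℝ W₂ x₀
    rw [contMDiffAt_section] at hs h0 ⊢
    exact hs.prodMk_space h0⟩

end Sections

/-! ### Dull brackets and complex Lie algebroids -/

section Algebroids

variable {EM : Type*} [NormedAddCommGroup EM] [NormedSpace ℝ EM] {HM : Type*} [TopologicalSpace HM]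
  {I : ModelWithCorners ℝ EM HM} {M : Type*} [TopologicalSpace M] [ChartedSpace HM M]
  [IsManifold I ∞ M]
  {G : Type*} [NormedAddCommGroup G] [NormedSpace ℝ G]
  {W : M → Type*} [TopologicalSpace (TotalSpace G W)] [∀ x, AddCommGroup (W x)]
  [∀ x, Module ℝ (W x)] [∀ x, TopologicalSpace (W x)] [FiberBundle G W] [VectorBundle ℝ G W]

instance (x : M) : IsTopologicalAddGroup (TangentSpace I x) := inferInstance

/-- The differential of a real function at `x`, as a covector at `x`. -/
def dReal (I : ModelWithCorners ℝ EM HM) (f : M → ℝ) (x : M) : TangentSpace I x →L[ℝ] ℝ :=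
  mfderiv I 𝓘(ℝ, ℝ) f x

/-- The differential of a complex-valued function at `x`. -/
def dComplex (I : ModelWithCorners ℝ EM HM) (f : M → ℂ) (x : M) : TangentSpace I x →L[ℝ] ℂ :=
  mfderiv I 𝓘(ℝ, ℂ) f x

/-- A dull bracket on the sections of a vector bundle `W` anchored by `ρ : W → TM`: an
`ℝ`-bilinear bracket that is compatible with the Lie bracket of vector fields through `ρ` and
satisfies the Leibniz identity in both arguments (neither skew-symmetry nor the Jacobi identity
is required). -/
structure IsDullBracket (ρ : BundleHom I G W EM (fun x : M => TangentSpace I x))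
    (D : Cₛ^∞⟮I; G, W⟯ →ₗ[ℝ] Cₛ^∞⟮I; G, W⟯ →ₗ[ℝ] Cₛ^∞⟮I; G, W⟯) : Prop where
  anchor_bracket : ∀ s t x, ρ x (D s t x) =
    VectorField.mlieBracket I (fun y => ρ y (s y)) (fun y => ρ y (t y)) x
  leibniz : ∀ (f g : C^∞⟮I, M; ℝ⟯) s t x, D (smulSection f s) (smulSection g t) x =
    (f x * g x) • D s t x + (f x * dReal I g x (ρ x (s x))) • t x
      - (g x * dReal I f x (ρ x (t x))) • s x

variable [∀ x, IsTopologicalAddGroup (W x)] [∀ x, ContinuousSMul ℝ (W x)]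

/-- Scalar multiplication by `z ∈ ℂ` on a fibre of `W`, where `j` is multiplication by `i`. -/
def complexSMul (j : BundleHom I G W G W) {x : M} (z : ℂ) (w : W x) : W x :=
  z.re • w + z.im • j x w

/-- The product `f · s` of a smooth complex-valued function and a section, where `j` is
multiplication by `i`. -/
def complexSMulSection (j : BundleHom I G W G W) (f : C^∞⟮I, M; 𝓘(ℝ, ℂ), ℂ⟯)
    (s : Cₛ^∞⟮I; G, W⟯) : Cₛ^∞⟮I; G, W⟯ :=
  smulSection ⟨fun x => (f x).re, Complex.reCLM.contMDiff.comp f.contMDiff⟩ s +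
    smulSection ⟨fun x => (f x).im, Complex.imCLM.contMDiff.comp f.contMDiff⟩ (j.mapSection s)

variable (I M) in
/-- The complexified tangent bundle `T_ℂ M = TM ⊗ ℂ`; the pair `(X, Y)` stands for
`X ⊗ 1 + Y ⊗ i`. -/
abbrev ComplexTangent : M → Type _ :=
  (fun x : M => TangentSpace I x) ×ᵇ (fun x : M => TangentSpace I x)

/-- The derivative of a complex-valued function along a complex tangent vector,
`(X + iY)(f) = X(f) + i Y(f)`. -/
def complexLieDeriv {x : M} (Z : ComplexTangent I M x) (f : M → ℂ) : ℂ :=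
  dComplex I f x Z.1 + Complex.I * dComplex I f x Z.2

/-- A complex Lie algebroid structure on `(W, j)`: `j` is a complex structure in the fibres of `W`,
the bracket is a `ℂ`-bilinear Lie bracket on the sections of `W`, and the anchor is a morphism
`W → T_ℂ M` of complex vector bundles, such that the Leibniz identity holds for complex-valued
functions. -/
@[ext]
structure ComplexLieAlgebroid (j : BundleHom I G W G W) where
  j_sq : ∀ x (w : W x), j x (j x w) = -w
  bracket : Cₛ^∞⟮I; G, W⟯ →ₗ[ℝ] Cₛ^∞⟮I; G, W⟯ →ₗ[ℝ] Cₛ^∞⟮I; G, W⟯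
  bracket_j_left : ∀ s t, bracket (j.mapSection s) t = j.mapSection (bracket s t)
  bracket_j_right : ∀ s t, bracket s (j.mapSection t) = j.mapSection (bracket s t)
  bracket_self : ∀ s, bracket s s = 0
  jacobi : ∀ s t u,
    bracket s (bracket t u) + bracket t (bracket u s) + bracket u (bracket s t) = 0
  anchor : BundleHom I G W (EM × EM) (ComplexTangent I M)
  anchor_j : ∀ x (w : W x), anchor x (j x w) = (-(anchor x w).2, (anchor x w).1)
  leibniz : ∀ (f : C^∞⟮I, M; 𝓘(ℝ, ℂ), ℂ⟯) s t x,
    bracket s (complexSMulSection j f t) x =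
      complexSMul j (complexLieDeriv (anchor x (s x)) f) (t x) + complexSMul j (f x) (bracket s t x)

/-- The complex anchor `ρ_j(w) = ½ (ρ(w) ⊗ 1 - ρ(j w) ⊗ i)` defined by a real anchor `ρ`. -/
def complexAnchor (j : BundleHom I G W G W)
    (ρ : BundleHom I G W EM (fun x : M => TangentSpace I x)) (x : M) (w : W x) :
    ComplexTangent I M x :=
  ((1 / 2 : ℝ) • ρ x w, -((1 / 2 : ℝ) • ρ x (j x w)))

/-- The complexification of a real-bilinear bracket; the pair `(s, t)` stands for the section
`s ⊗ 1 + t ⊗ i` of `W ⊗ ℂ`. -/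
def complexifiedBracket
    (D : Cₛ^∞⟮I; G, W⟯ →ₗ[ℝ] Cₛ^∞⟮I; G, W⟯ →ₗ[ℝ] Cₛ^∞⟮I; G, W⟯)
    (u v : Cₛ^∞⟮I; G, W⟯ × Cₛ^∞⟮I; G, W⟯) : Cₛ^∞⟮I; G, W⟯ × Cₛ^∞⟮I; G, W⟯ :=
  (D u.1 v.1 - D u.2 v.2, D u.1 v.2 + D u.2 v.1)

/-- The canonical isomorphism `s ↦ ½ (s ⊗ 1 - j s ⊗ i)` from the sections of `W` to the sections
of `W^{1,0}`, the `i`-eigenbundle of the complexification of `j`. -/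
def toHolomorphic (j : BundleHom I G W G W) (s : Cₛ^∞⟮I; G, W⟯) :
    Cₛ^∞⟮I; G, W⟯ × Cₛ^∞⟮I; G, W⟯ :=
  ((1 / 2 : ℝ) • s, -((1 / 2 : ℝ) • j.mapSection s))

/-- The bracket `D` realises the complex bracket `A`: the complexification of `D` restricts to
the sections of the `i`-eigenbundle `W^{1,0}` and is carried to `A` by the canonical isomorphism
`W ≃ W^{1,0}`. -/
def Realises (j : BundleHom I G W G W)
    (D A : Cₛ^∞⟮I; G, W⟯ →ₗ[ℝ] Cₛ^∞⟮I; G, W⟯ →ₗ[ℝ] Cₛ^∞⟮I; G, W⟯) : Prop :=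
  ∀ s t, complexifiedBracket D (toHolomorphic j s) (toHolomorphic j t) = toHolomorphic j (A s t)

/-- A complex Lie algebroid is quasi-real if its anchor is `ρ_j` for a real vector bundle morphism
`ρ : W → TM` and its bracket is realised by a dull bracket on `(W, ρ)`. -/
def ComplexLieAlgebroid.IsQuasiReal {j : BundleHom I G W G W} (A : ComplexLieAlgebroid j) : Prop :=
  ∃ ρ : BundleHom I G W EM (fun x : M => TangentSpace I x),
    (∀ x w, A.anchor x w = complexAnchor j ρ x w) ∧
    ∃ D, IsDullBracket ρ D ∧ Realises j D A.bracket

end Algebroids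

/-! ### The standard Courant algebroid and generalised complex structures -/

section Courant

variable {EN : Type*} [NormedAddCommGroup EN] [NormedSpace ℝ EN] {HN : Type*} [TopologicalSpace HN]
  (J : ModelWithCorners ℝ EN HN) {N : Type*} [TopologicalSpace N] [ChartedSpace HN N]
  [IsManifold J ∞ N]

/-- The fibres of the cotangent bundle `T*N`. -/
abbrev Cotangent (x : N) : Type _ := TangentSpace J x →L[ℝ] ℝ

instance (x : N) : IsTopologicalAddGroup (Cotangent J x) := inferInstance
instance (x : N) : ContinuousAdd (Cotangent J x) := inferInstance

variable (N) in
/-- The generalised tangent bundle `TN ⊕ T*N`. -/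
abbrev GenTangent : N → Type _ := (fun x : N => TangentSpace J x) ×ᵇ (fun x : N => Cotangent J x)

instance (x : N) : IsTopologicalAddGroup (GenTangent J N x) := inferInstance
instance (x : N) : ContinuousSMul ℝ (GenTangent J N x) := inferInstance

/-- The symmetric pairing `⟨(v, θ), (w, η)⟩ = θ(w) + η(v)` on `TN ⊕ T*N`. -/
def genPairing {x : N} (ξ η : GenTangent J N x) : ℝ := ξ.2 η.1 + η.2 ξ.1

/-- The contraction `ι_X dθ` at `x` of the exterior derivative of the 1-form `θ` with the vector
field `X`: if `θ'` is the expression of `θ` in the chart at `x` and `X'`, `V'` are the expressions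
of `X(x)` and of a tangent vector `V` at `x`, then
`dθ(X, V) = (∂_{X'} θ')(V') - (∂_{V'} θ')(X')`. -/
def contractExtDeriv (X : ∀ x : N, TangentSpace J x) (θ : ∀ x : N, Cotangent J x) (x : N) :
    Cotangent J x :=
  let θ' : EN → EN →L[ℝ] ℝ := fun y =>
    (θ ((extChartAt J x).symm y)).comp
      (mfderivWithin 𝓘(ℝ, EN) J (extChartAt J x).symm (Set.range J) y)
  let dθ' : EN →L[ℝ] EN →L[ℝ] ℝ := fderivWithin ℝ θ' (Set.range J) (extChartAt J x x)
  let T : TangentSpace J x →L[ℝ] EN := mfderiv J 𝓘(ℝ, EN) (extChartAt J x) x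
  (dθ' (T (X x)) - dθ'.flip (T (X x))).comp T

/-- The Lie derivative of a 1-form, `L_X η = d(η(X)) + ι_X dη`. -/
def lieDerivForm (X : ∀ x : N, TangentSpace J x) (η : ∀ x : N, Cotangent J x) (x : N) :
    Cotangent J x :=
  dReal J (fun y => η y (X y)) x + contractExtDeriv J X η x

/-- The Courant-Dorfman bracket `⟦(X, θ), (Y, η)⟧ = ([X, Y], L_X η - ι_Y dθ)`. -/
def courantBracket (e₁ e₂ : ∀ x : N, GenTangent J N x) (x : N) : GenTangent J N x :=
  (VectorField.mlieBracket J (fun y => (e₁ y).1) (fun y => (e₂ y).1) x,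
    lieDerivForm J (fun y => (e₁ y).1) (fun y => (e₂ y).2) x
      - contractExtDeriv J (fun y => (e₂ y).1) (fun y => (e₁ y).2) x)

variable (N) in
/-- A generalised complex structure on the manifold `N`: an orthogonal endomorphism of
`TN ⊕ T*N` squaring to `-1`, whose Nijenhuis tensor with respect to the Courant-Dorfman bracket
vanishes. -/
@[ext]
structure GenComplexStructure where
  toHom : BundleHom J (EN × (EN →L[ℝ] ℝ)) (GenTangent J N) (EN × (EN →L[ℝ] ℝ)) (GenTangent J N)
  sq : ∀ x (ξ : GenTangent J N x), toHom x (toHom x ξ) = -ξ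
  orthogonal : ∀ x (ξ η : GenTangent J N x),
    genPairing J (toHom x ξ) (toHom x η) = genPairing J ξ η
  nijenhuis : ∀ (e₁ e₂ : Cₛ^∞⟮J; EN × (EN →L[ℝ] ℝ), GenTangent J N⟯) x,
    courantBracket J e₁ e₂ x
      - courantBracket J (toHom.mapSection e₁) (toHom.mapSection e₂) x
      + toHom x (courantBracket J (toHom.mapSection e₁) e₂ x
        + courantBracket J e₁ (toHom.mapSection e₂) x) = 0

end Courant

/-! ### Linear generalised complex structures on a vector bundle -/

section Linear

variable {EM : Type*} [NormedAddCommGroup EM] [NormedSpace ℝ EM] {HM : Type*} [TopologicalSpace HM]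
  (I : ModelWithCorners ℝ EM HM) {M : Type*} [TopologicalSpace M] [ChartedSpace HM M]
  [IsManifold I ∞ M]
  (F : Type*) [NormedAddCommGroup F] [NormedSpace ℝ F]
  (V : M → Type*) [TopologicalSpace (TotalSpace F V)] [∀ x, AddCommGroup (V x)]
  [∀ x, Module ℝ (V x)] [∀ x, TopologicalSpace (V x)] [FiberBundle F V] [VectorBundle ℝ F V]
  [∀ x, IsTopologicalAddGroup (V x)] [∀ x, ContinuousSMul ℝ (V x)] [ContMDiffVectorBundle ∞ F V I]

/-- The fibres of the dual bundle `V*`. -/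
abbrev DualFibre (x : M) : Type _ := V x →L[ℝ] ℝ

instance (x : M) : IsTopologicalAddGroup (DualFibre V x) := inferInstance
instance (x : M) : ContinuousAdd (DualFibre V x) := inferInstance

/-- The vector bundle `TM ⊕ V*`, the side of `TE ⊕ T*E` for `E` the total space of `V`. -/
abbrev Side : M → Type _ := (fun x : M => TangentSpace I x) ×ᵇ (fun x : M => DualFibre V x)

/-- The vector bundle `V ⊕ T*M`, the core of `TE ⊕ T*E` for `E` the total space of `V`. -/
abbrev Core : M → Type _ := (fun x : M => V x) ×ᵇ (fun x : M => Cotangent I x)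

instance (x : M) : IsTopologicalAddGroup (Side I V x) := inferInstance
instance (x : M) : ContinuousSMul ℝ (Side I V x) := inferInstance
instance (x : M) : IsTopologicalAddGroup (Core I V x) := inferInstance
instance (x : M) : ContinuousSMul ℝ (Core I V x) := inferInstance

/-- The tangent space at `p` of the total space `E` of `V`. -/
abbrev TangentTotal (p : TotalSpace F V) : Type _ := TangentSpace (I.prod 𝓘(ℝ, F)) p

/-- The fibre at `p` of the generalised tangent bundle `TE ⊕ T*E` of the total space `E` of `V`. -/
abbrev GenTangentTotal (p : TotalSpace F V) : Type _ :=
  GenTangent (I.prod 𝓘(ℝ, F)) (TotalSpace F V) p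

variable {F V}

/-- The derivative `Tq` at `p` of the projection `q : E → M`. -/
def dProj (p : TotalSpace F V) : TangentTotal I F V p →L[ℝ] TangentSpace I p.proj :=
  mfderiv (I.prod 𝓘(ℝ, F)) I (TotalSpace.proj : TotalSpace F V → M) p

/-- The vertical tangent vector `d/dt|_{t=0} (p + t w)` at `p ∈ E`. -/
def vertical (p : TotalSpace F V) (w : V p.proj) : TangentTotal I F V p :=
  (mfderiv 𝓘(ℝ, ℝ) (I.prod 𝓘(ℝ, F))
    (fun t : ℝ => (⟨p.proj, p.snd + t • w⟩ : TotalSpace F V)) 0 : ℝ →L[ℝ] EM × F) 1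

theorem vertical_eq (p : TotalSpace F V) (w : V p.proj) :
    vertical I p w =
      ((0, (trivializationAt F V p.proj).continuousLinearMapAt ℝ p.proj w) : EM × F) := by
  set L := (trivializationAt F V p.proj).continuousLinearMapAt ℝ p.proj with hL
  have key : ∀ v : V p.proj, (trivializationAt F V p.proj ⟨p.proj, v⟩).2 = L v := fun v => by
    rw [hL, Bundle.Trivialization.continuousLinearMapAt_apply_of_mem]
    exact FiberBundle.mem_baseSet_trivializationAt' p.proj
  have h : HasMFDerivAt 𝓘(ℝ, ℝ) (I.prod 𝓘(ℝ, F))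
      (fun t : ℝ => (⟨p.proj, p.snd + t • w⟩ : TotalSpace F V)) 0
      ((0 : ℝ →L[ℝ] EM).prod ((1 : ℝ →L[ℝ] ℝ).smulRight (L w))) := by
    constructor
    · have hc : ContMDiffAt 𝓘(ℝ, ℝ) (I.prod 𝓘(ℝ, F)) ∞
          (fun t : ℝ => (⟨p.proj, p.snd + t • w⟩ : TotalSpace F V)) 0 := by
        rw [contMDiffAt_totalSpace]
        refine ⟨contMDiffAt_const, ?_⟩
        simp only [key, map_add, map_smul]
        exact (contDiff_const.add (contDiff_id.smul contDiff_const)).contMDiff.contMDiffAt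
      exact hc.continuousAt
    · have h2 : HasFDerivAt (fun t : ℝ => ((extChartAt I p.proj p.proj, L p.snd + t • L w) : EM × F))
          ((0 : ℝ →L[ℝ] EM).prod ((1 : ℝ →L[ℝ] ℝ).smulRight (L w))) 0 := by
        refine (hasFDerivAt_const _ _).prodMk ?_
        exact ((hasFDerivAt_id (0 : ℝ)).smul_const (L w)).const_add _
      refine (h2.congr_of_eventuallyEq (Filter.Eventually.of_forall fun t => ?_)).hasFDerivWithinAt
      have e0 : p.snd + (0 : ℝ) • w = p.snd := by simp
      simp only [writtenInExtChartAt, Function.comp_apply, e0]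
      rw [FiberBundle.extChartAt]
      refine Prod.ext (congrArg (extChartAt I p.proj) ((trivializationAt F V p.proj).coe_fst'
        (FiberBundle.mem_baseSet_trivializationAt' p.proj))) ?_
      exact (key _).trans (by simp; rfl)
  refine (congrArg (fun A : ℝ →L[ℝ] EM × F => A 1) h.mfderiv).trans ?_
  exact Prod.ext rfl (one_smul ℝ (L w))

/-- The linear map `w ↦ d/dt|_{t=0} (p + t w)` from the fibre of `E` through `p` to `T_pE`. -/
def verticalLift (p : TotalSpace F V) : V p.proj →L[ℝ] TangentTotal I F V p where
  toFun := vertical I p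
  map_add' v w := by
    simp only [vertical_eq, map_add]
    exact (Prod.mk_add_mk _ _ _ _ |>.trans (by rw [add_zero])).symm
  map_smul' c v := by
    simp only [vertical_eq, map_smul]
    exact (Prod.smul_mk _ _ _ |>.trans (by rw [smul_zero]; rfl)).symm
  cont := by
    rw [show vertical I p = fun w => ((0, (trivializationAt F V p.proj).continuousLinearMapAt ℝ
      p.proj w) : EM × F) from funext (vertical_eq I p)]
    exact continuous_const.prodMk (ContinuousLinearMap.continuous _)

/-- The projection `TE ⊕ T*E → TM ⊕ V*`, given by `Tq` on `TE` and on `T*E` by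
`⟨r(θ), w⟩ = θ(d/dt|_{t=0} (p + t w))` for `θ ∈ T*_pE`. -/
def sideMap (p : TotalSpace F V) (ξ : GenTangentTotal I F V p) : Side I V p.proj :=
  (dProj I p ξ.1, ξ.2.comp (verticalLift I p))

/-- The value at `p` of the core section `τ^↑` of `TE ⊕ T*E` defined by `τ = (e, θ)`: the pair
consisting of the vertical lift of `e` and of the pullback of `θ`. -/
def coreLift (p : TotalSpace F V) (τ : Core I V p.proj) : GenTangentTotal I F V p :=
  (verticalLift I p τ.1, τ.2.comp (dProj I p))

/-- `v₃ = v₁ + v₂` in the vector bundle `TE → TM`, whose addition is the derivative of the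
fibrewise addition `E ⊕ E → E`. -/
def IsTangentSum {x : M} {e₁ e₂ : V x} (v₁ : TangentTotal I F V ⟨x, e₁⟩)
    (v₂ : TangentTotal I F V ⟨x, e₂⟩) (v₃ : TangentTotal I F V ⟨x, e₁ + e₂⟩) : Prop :=
  ∃ w : TangentTotal I (F × F) (V ×ᵇ V) ⟨x, (e₁, e₂)⟩,
    mfderiv (I.prod 𝓘(ℝ, F × F)) (I.prod 𝓘(ℝ, F))
      (fun p : TotalSpace (F × F) (V ×ᵇ V) => (⟨p.proj, p.snd.1⟩ : TotalSpace F V))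
      ⟨x, (e₁, e₂)⟩ w = v₁ ∧
    mfderiv (I.prod 𝓘(ℝ, F × F)) (I.prod 𝓘(ℝ, F))
      (fun p : TotalSpace (F × F) (V ×ᵇ V) => (⟨p.proj, p.snd.2⟩ : TotalSpace F V))
      ⟨x, (e₁, e₂)⟩ w = v₂ ∧
    mfderiv (I.prod 𝓘(ℝ, F × F)) (I.prod 𝓘(ℝ, F))
      (fun p : TotalSpace (F × F) (V ×ᵇ V) => (⟨p.proj, p.snd.1 + p.snd.2⟩ : TotalSpace F V))
      ⟨x, (e₁, e₂)⟩ w = v₃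

/-- `ξ₃ = ξ₁ + ξ₂` in the vector bundle `TE ⊕ T*E → TM ⊕ V*`; the addition of `T*E → V*` is
characterised by `⟨θ₁ + θ₂, v₁ + v₂⟩ = ⟨θ₁, v₁⟩ + ⟨θ₂, v₂⟩` for sums `v₁ + v₂` in `TE → TM`. -/
def IsSideSum {x : M} {e₁ e₂ : V x} (ξ₁ : GenTangentTotal I F V ⟨x, e₁⟩)
    (ξ₂ : GenTangentTotal I F V ⟨x, e₂⟩) (ξ₃ : GenTangentTotal I F V ⟨x, e₁ + e₂⟩) : Prop :=
  IsTangentSum I ξ₁.1 ξ₂.1 ξ₃.1 ∧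
    ∀ v₁ v₂ v₃, IsTangentSum I v₁ v₂ v₃ → ξ₃.2 v₃ = ξ₁.2 v₁ + ξ₂.2 v₂

/-- The derivative at `(x, e)` of the fibrewise scalar multiplication `E → E` by `c`. -/
def dScale (c : ℝ) {x : M} (e : V x) :
    TangentTotal I F V ⟨x, e⟩ →L[ℝ] TangentTotal I F V ⟨x, c • e⟩ :=
  mfderiv (I.prod 𝓘(ℝ, F)) (I.prod 𝓘(ℝ, F))
    (fun p : TotalSpace F V => (⟨p.proj, c • p.snd⟩ : TotalSpace F V)) ⟨x, e⟩

/-- `ξ' = c · ξ` in the vector bundle `TE ⊕ T*E → TM ⊕ V*`; the scalar multiplication of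
`TE → TM` is the derivative of that of `E`, and the one of `T*E → V*` preserves the projection to
`V*` and satisfies `⟨c · θ, c · v⟩ = c ⟨θ, v⟩`. -/
def IsSideSMul (c : ℝ) {x : M} {e : V x} (ξ : GenTangentTotal I F V ⟨x, e⟩)
    (ξ' : GenTangentTotal I F V ⟨x, c • e⟩) : Prop :=
  ξ'.1 = dScale I c e ξ.1 ∧ (∀ v, ξ'.2 (dScale I c e v) = c * ξ.2 v) ∧
    (sideMap I _ ξ').2 = (sideMap I _ ξ).2

variable (V) in
/-- Endomorphisms of `TM ⊕ V*` over the identity of `M`. -/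
abbrev SideEnd : Type _ :=
  BundleHom I (EM × (F →L[ℝ] ℝ)) (Side I V) (EM × (F →L[ℝ] ℝ)) (Side I V)

/-- The smooth sections of `TM ⊕ V*`. -/
abbrev SideSection : Type _ := Cₛ^∞⟮I; EM × (F →L[ℝ] ℝ), Side I V⟯

variable (V) in
/-- The morphism `pr_TM : TM ⊕ V* → TM`. -/
def prTM : BundleHom I (EM × (F →L[ℝ] ℝ)) (Side I V) EM (fun x : M => TangentSpace I x) :=
  fstHom

variable {I}

/-- `𝒥 : TE ⊕ T*E → TE ⊕ T*E` is a morphism of double vector bundles with side morphism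
`j : TM ⊕ V* → TM ⊕ V*`: besides being linear over `E`, it covers `j` and is linear with respect to
the vector bundle structure of `TE ⊕ T*E → TM ⊕ V*`. -/
structure IsLinearOver (𝒥 : GenComplexStructure (I.prod 𝓘(ℝ, F)) (TotalSpace F V))
    (j : SideEnd I V (F := F)) : Prop where
  side : ∀ p ξ, sideMap I p (𝒥.toHom p ξ) = j p.proj (sideMap I p ξ)
  add : ∀ (x : M) (e₁ e₂ : V x) (ξ₁ : GenTangentTotal I F V ⟨x, e₁⟩)
    (ξ₂ : GenTangentTotal I F V ⟨x, e₂⟩) (ξ₃ : GenTangentTotal I F V ⟨x, e₁ + e₂⟩),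
    IsSideSum I ξ₁ ξ₂ ξ₃ → IsSideSum I (𝒥.toHom _ ξ₁) (𝒥.toHom _ ξ₂) (𝒥.toHom _ ξ₃)
  smul : ∀ (c : ℝ) (x : M) (e : V x) (ξ : GenTangentTotal I F V ⟨x, e⟩)
    (ξ' : GenTangentTotal I F V ⟨x, c • e⟩),
    IsSideSMul I c ξ ξ' → IsSideSMul I c (𝒥.toHom _ ξ) (𝒥.toHom _ ξ')

/-- The linear generalised complex structures on the vector bundle `V` with side morphism `j`. -/
def LinearGenComplexStructure (j : SideEnd I V (F := F)) : Type _ :=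
  {𝒥 : GenComplexStructure (I.prod 𝓘(ℝ, F)) (TotalSpace F V) // IsLinearOver 𝒥 j}

/-- The quasi-real complex Lie algebroid structures on `(TM ⊕ V*, j)` with anchor `pr_{TM, j}`. -/
def QuasiRealStructure (j : SideEnd I V (F := F)) : Type _ :=
  {A : ComplexLieAlgebroid j //
    (∀ x ν, A.anchor x ν = complexAnchor j (prTM I V) x ν) ∧ A.IsQuasiReal}

/-- The natural pairing `⟨(X, ε), (e, θ)⟩ = ε(e) + θ(X)` of `TM ⊕ V*` with `V ⊕ T*M`. -/
def sidePairing {x : M} (ν : Side I V x) (τ : Core I V x) : ℝ := ν.2 τ.1 + τ.2 ν.1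

variable (I F V) in
/-- Dorfman `TM ⊕ V*`-connections on `V ⊕ T*M`. -/
structure DorfmanConnection where
  toFun : SideSection I (F := F) (V := V) →ₗ[ℝ] Cₛ^∞⟮I; F × (EM →L[ℝ] ℝ), Core I V⟯ →ₗ[ℝ]
    Cₛ^∞⟮I; F × (EM →L[ℝ] ℝ), Core I V⟯
  leibniz : ∀ (f : C^∞⟮I, M; ℝ⟯) ν τ x, toFun ν (smulSection f τ) x =
    f x • toFun ν τ x + dReal I f x (ν x).1 • τ x
  smul_left : ∀ (f : C^∞⟮I, M; ℝ⟯) ν τ x, toFun (smulSection f ν) τ x =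
    f x • toFun ν τ x + sidePairing (ν x) (τ x) • ((0, dReal I f x) : Core I V x)
  exact_form : ∀ (f : C^∞⟮I, M; ℝ⟯) ν τ, (∀ x, τ x = (0, dReal I f x)) →
    ∀ x, toFun ν τ x = (0, dReal I (fun y => dReal I f y (ν y).1) x)

/-- The Dorfman connection `Δ` and the dull bracket `D` are dual to each other:
`X⟨ν', τ⟩ = ⟨D(ν, ν'), τ⟩ + ⟨ν', Δ_ν τ⟩` for `ν = (X, ε)`. -/
def IsDual (Δ : DorfmanConnection I F V)
    (D : SideSection I (V := V) (F := F) →ₗ[ℝ] SideSection I (V := V) (F := F) →ₗ[ℝ]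
      SideSection I (V := V) (F := F)) : Prop :=
  ∀ ν ν' τ x, dReal I (fun y => sidePairing (ν' y) (τ y)) x (ν x).1 =
    sidePairing (D ν ν' x) (τ x) + sidePairing (ν' x) (Δ.toFun ν τ x)

/-- The horizontal lift `σ^Δ(ν)` defined by `Δ`, at the point `e(x)` of `E` for a section `e`:
`σ^Δ(X, ε)(e(x)) = (T_x e (X(x)), dℓ_ε(e(x))) - (Δ_{(X, ε)}(e, 0))^↑(e(x))`, where `ℓ_ε` is the
function on `E` that is given by `ε` on the fibres. -/
def horizontalLift (Δ : DorfmanConnection I F V) (ν : SideSection I (V := V) (F := F))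
    (e : Cₛ^∞⟮I; F, V⟯) (x : M) : GenTangentTotal I F V ⟨x, e x⟩ :=
  (mfderiv I (I.prod 𝓘(ℝ, F)) (fun y => (⟨y, e y⟩ : TotalSpace F V)) x (ν x).1,
    dReal (I.prod 𝓘(ℝ, F)) (fun p : TotalSpace F V => (ν p.proj).2 p.snd) ⟨x, e x⟩)
  - coreLift I ⟨x, e x⟩ (Δ.toFun ν (inlSection e) x)

/-- The dull bracket `D` is adapted to `𝒥`: the horizontal lift `σ` defined by the Dorfman
connection dual to `D` satisfies `𝒥(σ(ν)) = σ(j ν)`. -/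
def IsAdapted (𝒥 : GenComplexStructure (I.prod 𝓘(ℝ, F)) (TotalSpace F V))
    (j : SideEnd I V (F := F))
    (D : SideSection I (V := V) (F := F) →ₗ[ℝ] SideSection I (V := V) (F := F) →ₗ[ℝ]
      SideSection I (V := V) (F := F)) : Prop :=
  ∃ Δ : DorfmanConnection I F V, IsDual Δ D ∧ ∀ ν e x,
    𝒥.toHom ⟨x, e x⟩ (horizontalLift Δ ν e x) = horizontalLift Δ (j.mapSection ν) e x

end Linear

end LinearGC

end

open LinearGC

/-! Write E for the total space of V. The bundle TE ⊕ T*E projects onto the side TM ⊕ V* by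
`sideMap`, and the kernel of this projection is the core V ⊕ T*M, embedded by `coreLift`. A dull
bracket D on the side splits this extension: through its dual Dorfman connection it lifts a section
ν of the side to a section σ(ν) of TE ⊕ T*E over ν, and every generalised tangent vector is a lift
plus a core element (`exists_liftAt_add_coreLift`). The lift is handled through the formula
`IsLift`, which mentions only D and the fibrewise linear functions ℓ_ν = `linFun ν`.

In this splitting D computes both the pairing and the Courant bracket. One has ⟨σ(μ), σ(ν)⟩ = ℓ of
D(μ,ν) + D(ν,μ); the bracket ⟦σ(ν₁), σ(ν₂)⟧ pairs with τ^↑ to ⟨D(ν₁,ν₂), τ⟩, and with σ(ν₃) to ℓ of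
D(ν₁,D(ν₂,ν₃)) - D(ν₂,D(ν₁,ν₃)) + D(ν₃,D(ν₁,ν₂)); a bracket with a core section pairs to zero with
core sections.

A linear 𝒥 over j acts on the core by the negative transpose of j (`actsOnCore`), because it is
orthogonal and covers j. Hence an adapted D together with j determines 𝒥. The Nijenhuis tensor of an
orthogonal 𝒥 with square -1 is alternating and tensorial, so it is enough to test it on lifts and
core sections. On two lifts and a core section it is the Nijenhuis expression of j with respect to
D, whose vanishing means that the complexification of D restricts to the i-eigenbundle and induces
A(s,t) = ½(D(s,t) - D(js,jt)). Orthogonality on lifts is the skew-symmetry of A. On three lifts the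
tensor is ℓ of four times the Jacobiator of A (`dullCurvature_eq_jacobiator`). Thus a fixed D
translates one kind of structure into the other.

The choice of D is immaterial. If D is adapted, then D' is adapted exactly when B = D' - D satisfies
B(jν,μ) = -B(ν,jμ); the same holds for realising A (`liftsTo_iff`, `Realises.realises_iff_sub`). So
the relation `Corresponds`, having a common adapted and realising bracket, is one-to-one. It is
total on both sides: quasi-reality supplies a realising bracket, and for a given 𝒥 any horizontal
lift σ can be replaced by ½(σ - 𝒥σj), which is the lift of another dull bracket and is adapted
(`exists_liftsTo`). -/

noncomputable section

namespace LinearGC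

open VectorField

set_option linter.unusedSectionVars false

/-! ### Cartan's formula and the Lie bracket, computed in a chart. -/

section Calculus
set_option linter.unusedSectionVars false

variable {EN : Type*} [NormedAddCommGroup EN] [NormedSpace ℝ EN] {HN : Type*} [TopologicalSpace HN]
  {J : ModelWithCorners ℝ EN HN} {N : Type*} [TopologicalSpace N] [ChartedSpace HN N]
  [IsManifold J ∞ N]

/-- The expression of a 1-form in the chart at `x`. -/
def formInChart (θ : ∀ x : N, Cotangent J x) (x : N) (y : EN) : EN →L[ℝ] ℝ :=
  (θ ((extChartAt J x).symm y)).comp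
    (mfderivWithin 𝓘(ℝ, EN) J (extChartAt J x).symm (Set.range J) y)

/-- The expression of a vector field in the chart at `x`. -/
def fieldInChart (X : ∀ x : N, TangentSpace J x) (x : N) (y : EN) : EN :=
  mpullbackWithin 𝓘(ℝ, EN) J (extChartAt J x).symm X (Set.range J) y

/-- The form is composed with the derivative of the inverse chart and the field with its inverse, so
their pairing is unchanged. -/
theorem formInChart_fieldInChart (θ : ∀ x : N, Cotangent J x) (X : ∀ x : N, TangentSpace J x)
    (x : N) {y : EN} (hy : y ∈ (extChartAt J x).target) :
    formInChart θ x y (fieldInChart X x y) =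
      θ ((extChartAt J x).symm y) (X ((extChartAt J x).symm y)) := by
  have h := isInvertible_mfderivWithin_extChartAt_symm (I := J) (x := x) hy
  exact congrArg (θ ((extChartAt J x).symm y)) (h.self_apply_inverse _)

theorem fieldInChart_self (X : ∀ x : N, TangentSpace J x) (x : N) :
    fieldInChart X x (extChartAt J x x) = X x := by
  have h := mfderivWithin_extChartAt_symm_inverse_apply (I := J) (x := x)
    (X ((extChartAt J x).symm (extChartAt J x x)))
  exact h.trans (by rw [extChartAt_to_inv])

theorem formInChart_self (θ : ∀ x : N, Cotangent J x) (x : N) :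
    formInChart θ x (extChartAt J x x) = θ x := by
  have h := mfderivWithin_range_extChartAt_symm (I := J) (x := x)
  have h' : formInChart θ x (extChartAt J x x) = θ ((extChartAt J x).symm (extChartAt J x x)) := by
    refine ContinuousLinearMap.ext fun v => ?_
    exact congrArg (θ ((extChartAt J x).symm (extChartAt J x x))) (congrArg (fun A : EN →L[ℝ] EN => A v) h)
  exact h'.trans (by rw [extChartAt_to_inv])

/-- The derivative of the extended chart at its own base point is the identity of the model space,
so the transport maps in the definition disappear. -/
theorem contractExtDeriv_apply (X : ∀ x : N, TangentSpace J x) (θ : ∀ x : N, Cotangent J x) (x : N)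
    (v : TangentSpace J x) :
    contractExtDeriv J X θ x v =
      fderivWithin ℝ (formInChart θ x) (Set.range J) (extChartAt J x x) (X x) v
      - fderivWithin ℝ (formInChart θ x) (Set.range J) (extChartAt J x x) v (X x) := by
  have h : (mfderiv J 𝓘(ℝ, EN) (extChartAt J x) x : EN →L[ℝ] EN) = ContinuousLinearMap.id ℝ EN :=
    mfderiv_extChartAt_self
  exact congrArg (fun T : EN →L[ℝ] EN =>
    fderivWithin ℝ (formInChart θ x) (Set.range J) (extChartAt J x x) (T (X x)) (T v)
      - fderivWithin ℝ (formInChart θ x) (Set.range J) (extChartAt J x x) (T v) (T (X x))) h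

variable [J.Boundaryless]

theorem mlieBracket_eq_lieBracket (X Y : ∀ x : N, TangentSpace J x) (x : N) :
    mlieBracket J X Y x = lieBracket ℝ (fieldInChart X x) (fieldInChart Y x) (extChartAt J x x) := by
  have h : (mfderiv J 𝓘(ℝ, EN) (extChartAt J x) x : EN →L[ℝ] EN) = ContinuousLinearMap.id ℝ EN :=
    mfderiv_extChartAt_self
  have h1 : mlieBracket J X Y x = (mfderiv J 𝓘(ℝ, EN) (extChartAt J x) x : EN →L[ℝ] EN).inverse
      (lieBracketWithin ℝ (E := EN) (fieldInChart X x) (fieldInChart Y x)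
      ((extChartAt J x).symm ⁻¹' Set.univ ∩ Set.range J) (extChartAt J x x)) := rfl
  refine h1.trans ?_
  rw [J.range_eq_univ, Set.preimage_univ, Set.inter_univ, lieBracketWithin_univ]
  refine (congrArg (fun A : EN →L[ℝ] EN => A.inverse (lieBracket ℝ (fieldInChart X x)
    (fieldInChart Y x) (extChartAt J x x))) h).trans ?_
  rw [ContinuousLinearMap.inverse_id]
  rfl

theorem dReal_eq_fderiv {f : N → ℝ} {x : N} (hf : MDifferentiableAt J 𝓘(ℝ, ℝ) f x) :
    dReal J f x = fderiv ℝ (f ∘ (extChartAt J x).symm) (extChartAt J x x) := by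
  rw [dReal, hf.mfderiv, J.range_eq_univ, fderivWithin_univ]
  rfl

theorem eventually_mem_target (x : N) :
    ∀ᶠ y in nhds (extChartAt J x x), y ∈ (extChartAt J x).target :=
  extChartAt_target_mem_nhds x

variable [CompleteSpace EN]

theorem differentiableAt_fieldInChart {X : ∀ x : N, TangentSpace J x} {x : N}
    (hX : MDifferentiableAt J J.tangent (fun y => (X y : TangentBundle J N)) x) :
    DifferentiableAt ℝ (fieldInChart X x) (extChartAt J x x) := by
  have : IsManifold J 2 N := IsManifold.of_le (n := ∞) (by norm_cast)
  have h := (hX.mdifferentiableWithinAt (s := Set.univ)).differentiableWithinAt_mpullbackWithin_vectorField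
  have h' : DifferentiableWithinAt ℝ (fieldInChart X x)
      ((extChartAt J x).symm ⁻¹' Set.univ ∩ Set.range J) (extChartAt J x x) := h
  rwa [J.range_eq_univ, Set.preimage_univ, Set.inter_univ, differentiableWithinAt_univ] at h'

/-- The product rule in the chart splits Z(θ(Y)) into a derivative of θ and a derivative of Y. The
derivatives of θ form dθ(X, Y), and those of the fields form θ([X, Y]). -/
theorem cartan_of_differentiableAt {X Y : ∀ x : N, TangentSpace J x} {θ : ∀ x : N, Cotangent J x}
    {x : N} (hX : MDifferentiableAt J J.tangent (fun y => (X y : TangentBundle J N)) x)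
    (hY : MDifferentiableAt J J.tangent (fun y => (Y y : TangentBundle J N)) x)
    (hθ : DifferentiableAt ℝ (formInChart θ x) (extChartAt J x x))
    (hθX : MDifferentiableAt J 𝓘(ℝ, ℝ) (fun y => θ y (X y)) x)
    (hθY : MDifferentiableAt J 𝓘(ℝ, ℝ) (fun y => θ y (Y y)) x) :
    contractExtDeriv J X θ x (Y x) =
      dReal J (fun y => θ y (Y y)) x (X x) - dReal J (fun y => θ y (X y)) x (Y x)
        - θ x (mlieBracket J X Y x) := by
  have key : ∀ {Z : ∀ x : N, TangentSpace J x} (_ : MDifferentiableAt J J.tangent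
      (fun y => (Z y : TangentBundle J N)) x) (_ : MDifferentiableAt J 𝓘(ℝ, ℝ) (fun y => θ y (Z y)) x)
      (v : EN), dReal J (fun y => θ y (Z y)) x v =
        formInChart θ x (extChartAt J x x) (fderiv ℝ (fieldInChart Z x) (extChartAt J x x) v) +
        fderiv ℝ (formInChart θ x) (extChartAt J x x) v (fieldInChart Z x (extChartAt J x x)) := by
    intro Z hZ hθZ v
    have h1 : ((fun y => θ y (Z y)) ∘ (extChartAt J x).symm) =ᶠ[nhds (extChartAt J x x)]
        fun y => formInChart θ x y (fieldInChart Z x y) := by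
      filter_upwards [eventually_mem_target (J := J) x] with y hy
      exact (formInChart_fieldInChart θ Z x hy).symm
    rw [dReal_eq_fderiv hθZ, h1.fderiv_eq,
      (hθ.hasFDerivAt.clm_apply (differentiableAt_fieldInChart hZ).hasFDerivAt).fderiv]
    rfl
  -- The values of the two fields are kept as variables `a` and `b`, so that `X x` and `Y x` can
  -- replace the chart expressions.
  have hb : ∀ a b : EN, fieldInChart X x (extChartAt J x x) = a →
      fieldInChart Y x (extChartAt J x x) = b →
      formInChart θ x (extChartAt J x x) (lieBracket ℝ (fieldInChart X x) (fieldInChart Y x)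
        (extChartAt J x x)) =
      formInChart θ x (extChartAt J x x) (fderiv ℝ (fieldInChart Y x) (extChartAt J x x) a)
      - formInChart θ x (extChartAt J x x) (fderiv ℝ (fieldInChart X x) (extChartAt J x x) b) := by
    rintro a b rfl rfl
    rw [← map_sub, lieBracket_eq]
  have e1 := hb _ _ (fieldInChart_self X x) (fieldInChart_self Y x)
  have e2 : dReal J (fun y => θ y (Y y)) x (X x) = _ := key hY hθY (X x)
  have e3 : dReal J (fun y => θ y (X y)) x (Y x) = _ := key hX hθX (Y x)
  have e4 : θ x (mlieBracket J X Y x) = formInChart θ x (extChartAt J x x)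
      (lieBracket ℝ (fieldInChart X x) (fieldInChart Y x) (extChartAt J x x)) :=
    (congrArg (θ x) (mlieBracket_eq_lieBracket X Y x)).trans
      (congrArg (fun A : EN →L[ℝ] ℝ => A _) (formInChart_self θ x).symm)
  rw [fieldInChart_self] at e2 e3
  rw [e2, e3, e4, e1, contractExtDeriv_apply, J.range_eq_univ, fderivWithin_univ]
  ring

theorem formInChart_dReal {f : N → ℝ} (hf : ContMDiff J 𝓘(ℝ, ℝ) ∞ f) (x : N) {y : EN}
    (hy : y ∈ (extChartAt J x).target) :
    formInChart (dReal J f) x y = fderiv ℝ (f ∘ (extChartAt J x).symm) y := by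
  have hs : MDifferentiableAt 𝓘(ℝ, EN) J (extChartAt J x).symm y := by
    have := mdifferentiableWithinAt_extChartAt_symm (I := J) hy
    rwa [J.range_eq_univ, mdifferentiableWithinAt_univ] at this
  have h := mfderiv_comp (I := 𝓘(ℝ, EN)) (I' := J) (I'' := 𝓘(ℝ, ℝ)) y
    (hf.mdifferentiable (by simp) _) hs
  rw [formInChart, J.range_eq_univ, mfderivWithin_univ, ← mfderiv_eq_fderiv]
  exact h.symm

theorem contDiffAt_comp_extChartAt_symm {f : N → ℝ} (hf : ContMDiff J 𝓘(ℝ, ℝ) ∞ f) (x : N) :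
    ContDiffAt ℝ ∞ (f ∘ (extChartAt J x).symm) (extChartAt J x x) := by
  have h := contMDiffOn_extChartAt_symm (I := J) (n := ∞) x
  exact (hf.comp_contMDiffOn h).contMDiffAt (extChartAt_target_mem_nhds x) |>.contDiffAt

/-- This is Cartan's formula for θ = df: the contraction of ddf vanishes by the symmetry of the
second derivative. -/
theorem dReal_mlieBracket {X Y : ∀ x : N, TangentSpace J x} {f : N → ℝ} {x : N}
    (hf : ContMDiff J 𝓘(ℝ, ℝ) ∞ f)
    (hX : MDifferentiableAt J J.tangent (fun y => (X y : TangentBundle J N)) x)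
    (hY : MDifferentiableAt J J.tangent (fun y => (Y y : TangentBundle J N)) x)
    (hfX : MDifferentiableAt J 𝓘(ℝ, ℝ) (fun y => dReal J f y (X y)) x)
    (hfY : MDifferentiableAt J 𝓘(ℝ, ℝ) (fun y => dReal J f y (Y y)) x) :
    dReal J f x (mlieBracket J X Y x) =
      dReal J (fun y => dReal J f y (Y y)) x (X x) - dReal J (fun y => dReal J f y (X y)) x (Y x) := by
  have hc := contDiffAt_comp_extChartAt_symm hf x
  have he : formInChart (dReal J f) x =ᶠ[nhds (extChartAt J x x)]
      fderiv ℝ (f ∘ (extChartAt J x).symm) := by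
    filter_upwards [eventually_mem_target (J := J) x] with y hy using formInChart_dReal hf x hy
  have hd : DifferentiableAt ℝ (formInChart (dReal J f) x) (extChartAt J x x) :=
    ((hc.fderiv_right (m := 1) (by norm_cast)).differentiableAt (by simp)).congr_of_eventuallyEq he
  have h := cartan_of_differentiableAt hX hY hd hfX hfY
  have h0 : contractExtDeriv J X (dReal J f) x (Y x) = 0 := by
    rw [contractExtDeriv_apply, J.range_eq_univ, fderivWithin_univ, he.fderiv_eq]
    exact sub_eq_zero.2 ((hc.isSymmSndFDerivAt (by simp; norm_cast)) (X x) (Y x))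
  rw [h0] at h
  linarith

end Calculus

/-! ### Components of sections of a direct sum. -/

section ProductSections

variable {EM : Type*} [NormedAddCommGroup EM] [NormedSpace ℝ EM] {HM : Type*} [TopologicalSpace HM]
  {I : ModelWithCorners ℝ EM HM} {M : Type*} [TopologicalSpace M] [ChartedSpace HM M]
  {G₁ : Type*} [NormedAddCommGroup G₁] [NormedSpace ℝ G₁]
  {W₁ : M → Type*} [TopologicalSpace (TotalSpace G₁ W₁)] [∀ x, AddCommGroup (W₁ x)]
  [∀ x, Module ℝ (W₁ x)] [∀ x, TopologicalSpace (W₁ x)] [FiberBundle G₁ W₁] [VectorBundle ℝ G₁ W₁]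
  {G₂ : Type*} [NormedAddCommGroup G₂] [NormedSpace ℝ G₂]
  {W₂ : M → Type*} [TopologicalSpace (TotalSpace G₂ W₂)] [∀ x, AddCommGroup (W₂ x)]
  [∀ x, Module ℝ (W₂ x)] [∀ x, TopologicalSpace (W₂ x)] [FiberBundle G₂ W₂] [VectorBundle ℝ G₂ W₂]

/-- The first component of a section of `W₁ ⊕ W₂`. -/
def fstSection (s : Cₛ^∞⟮I; G₁ × G₂, W₁ ×ᵇ W₂⟯) : Cₛ^∞⟮I; G₁, W₁⟯ :=
  ⟨fun x => (s x).1, fun x => by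
    have h := s.contMDiff x
    rw [Bundle.contMDiffAt_section] at h ⊢
    exact (contDiff_fst (𝕜 := ℝ) (E := G₁) (F := G₂)).contMDiff.contMDiffAt.comp x h⟩

/-- The second component of a section of `W₁ ⊕ W₂`. -/
def sndSection (s : Cₛ^∞⟮I; G₁ × G₂, W₁ ×ᵇ W₂⟯) : Cₛ^∞⟮I; G₂, W₂⟯ :=
  ⟨fun x => (s x).2, fun x => by
    have h := s.contMDiff x
    rw [Bundle.contMDiffAt_section] at h ⊢
    exact (contDiff_snd (𝕜 := ℝ) (E := G₁) (F := G₂)).contMDiff.contMDiffAt.comp x h⟩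

/-- The section of `W₁ ⊕ W₂` with given components. -/
def pairSection (s : Cₛ^∞⟮I; G₁, W₁⟯) (t : Cₛ^∞⟮I; G₂, W₂⟯) : Cₛ^∞⟮I; G₁ × G₂, W₁ ×ᵇ W₂⟯ :=
  ⟨fun x => (s x, t x), fun x => by
    have h1 := s.contMDiff x
    have h2 := t.contMDiff x
    rw [Bundle.contMDiffAt_section] at h1 h2 ⊢
    exact h1.prodMk_space h2⟩

end ProductSections

/-! ### The Courant bracket, and the Nijenhuis tensor as an alternating form. -/

section Courant

variable {EN : Type*} [NormedAddCommGroup EN] [NormedSpace ℝ EN] {HN : Type*} [TopologicalSpace HN]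
  {J : ModelWithCorners ℝ EN HN} {N : Type*} [TopologicalSpace N] [ChartedSpace HN N]
  [IsManifold J ∞ N]

variable (J N) in
/-- Smooth vector fields on `N`. -/
abbrev VectorFields : Type _ := Cₛ^∞⟮J; EN, fun x : N => TangentSpace J x⟯

variable (J N) in
/-- Smooth 1-forms on `N`. -/
abbrev OneForms : Type _ := Cₛ^∞⟮J; EN →L[ℝ] ℝ, fun x : N => Cotangent J x⟯

variable (J N) in
/-- Smooth sections of the generalised tangent bundle of `N`. -/
abbrev GenSections : Type _ := Cₛ^∞⟮J; EN × (EN →L[ℝ] ℝ), GenTangent J N⟯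

theorem contMDiff_form_apply (θ : OneForms J N) (X : VectorFields J N) :
    ContMDiff J 𝓘(ℝ, ℝ) ∞ (fun x => θ x (X x)) := by
  have h := ContMDiff.clm_bundle_apply θ.contMDiff X.contMDiff
  intro x
  have h2 := h x
  rw [Bundle.contMDiffAt_section] at h2
  exact h2

/-- The function df(X) is the fibre component of the tangent map of f composed with X. -/
theorem contMDiff_dReal_apply {f : N → ℝ} (hf : ContMDiff J 𝓘(ℝ, ℝ) ∞ f) (X : VectorFields J N) :
    ContMDiff J 𝓘(ℝ, ℝ) ∞ (fun x => dReal J f x (X x)) := by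
  have : IsManifold J 1 N := IsManifold.of_le (n := ∞) (by norm_cast)
  have h := (hf.contMDiff_tangentMap (m := ∞) (by simp)).comp X.contMDiff
  exact (contMDiff_snd_tangentBundle_modelSpace ℝ 𝓘(ℝ, ℝ)).comp h

theorem VectorFields.mdifferentiableAt (X : VectorFields J N) (x : N) :
    MDifferentiableAt J J.tangent (fun y => (X y : TangentBundle J N)) x :=
  X.contMDiff.mdifferentiable (by simp) x

/-- The local trivialisation of the tangent bundle at x is inverse to the derivative of the inverse
chart, so near x the chart expression of θ agrees with its smooth expression in the trivialised
cotangent bundle. -/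
theorem differentiableAt_formInChart [J.Boundaryless] (θ : OneForms J N) (x : N) :
    DifferentiableAt ℝ (formInChart θ x) (extChartAt J x x) := by
  have h := ((contMDiffAt_hom_bundle _).1 (θ.contMDiff x)).2
  have h3 : ContMDiffAt 𝓘(ℝ, EN) 𝓘(ℝ, EN →L[ℝ] ℝ) ∞ _ (extChartAt J x x) :=
    ContMDiffAt.comp (extChartAt J x x)
      (g := fun y => ContinuousLinearMap.inCoordinates EN (TangentSpace J) ℝ (fun _ : N => ℝ)
        x y x y (θ y)) (f := (extChartAt J x).symm) (by rw [extChartAt_to_inv]; exact h)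
      ((contMDiffOn_extChartAt_symm x).contMDiffAt (extChartAt_target_mem_nhds x))
  refine (h3.contDiffAt.differentiableAt (by simp)).congr_of_eventuallyEq ?_
  filter_upwards [eventually_mem_target (J := J) x] with y hy
  have hy' : (extChartAt J x).symm y ∈ (chartAt HN x).source := by
    rw [← extChartAt_source J]
    exact (extChartAt J x).map_target hy
  have h4 := TangentBundle.symmL_trivializationAt (I := J) hy'
  rw [(extChartAt J x).right_inv hy] at h4
  refine ContinuousLinearMap.ext fun v => ?_
  refine (congrArg (fun A : EN →L[ℝ] EN => θ ((extChartAt J x).symm y) (A v)) h4).symm.trans ?_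
  have hc : (trivializationAt ℝ (fun _ : N => ℝ) x).continuousLinearMapAt ℝ
      ((extChartAt J x).symm y) = ContinuousLinearMap.id ℝ ℝ :=
    Bundle.Trivial.continuousLinearMapAt_trivialization ℝ N ℝ _
  exact (congrArg (fun A : ℝ →L[ℝ] ℝ => A (θ ((extChartAt J x).symm y)
    ((trivializationAt EN (TangentSpace J) x).symmL ℝ ((extChartAt J x).symm y) v))) hc).symm

/-- The vector field underlying a section of `TN ⊕ T*N`. -/
def GenSections.field (e : GenSections J N) : VectorFields J N := fstSection e

/-- The 1-form underlying a section of `TN ⊕ T*N`. -/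
def GenSections.form (e : GenSections J N) : OneForms J N := sndSection e

theorem genPairing_add_left {x : N} (a b c : GenTangent J N x) :
    genPairing J (a + b) c = genPairing J a c + genPairing J b c := by
  have h1 : c.2 (a.1 + b.1) = c.2 a.1 + c.2 b.1 := map_add _ _ _
  have h2 : (a.2 + b.2) c.1 = a.2 c.1 + b.2 c.1 := rfl
  have h : genPairing J (a + b) c = (a.2 + b.2) c.1 + c.2 (a.1 + b.1) := rfl
  rw [h, h1, h2, genPairing, genPairing]
  ring

theorem genPairing_comm {x : N} (a b : GenTangent J N x) : genPairing J a b = genPairing J b a :=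
  add_comm _ _

theorem genPairing_add_right {x : N} (a b c : GenTangent J N x) :
    genPairing J a (b + c) = genPairing J a b + genPairing J a c := by
  rw [genPairing_comm, genPairing_add_left, genPairing_comm b, genPairing_comm c]

theorem genPairing_smul_left {x : N} (r : ℝ) (a b : GenTangent J N x) :
    genPairing J (r • a) b = r * genPairing J a b := by
  have h1 : b.2 (r • a.1) = r * b.2 a.1 := map_smul _ _ _
  have h2 : (r • a.2) b.1 = r * a.2 b.1 := rfl
  have h : genPairing J (r • a) b = (r • a.2) b.1 + b.2 (r • a.1) := rfl
  rw [h, h1, h2, genPairing]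
  ring

theorem genPairing_smul_right {x : N} (r : ℝ) (a b : GenTangent J N x) :
    genPairing J a (r • b) = r * genPairing J a b := by
  rw [genPairing_comm, genPairing_smul_left, genPairing_comm]

theorem genPairing_neg_left {x : N} (a b : GenTangent J N x) :
    genPairing J (-a) b = -genPairing J a b := by
  rw [← neg_one_smul ℝ, genPairing_smul_left, neg_one_mul]

theorem genPairing_sub_left {x : N} (a b c : GenTangent J N x) :
    genPairing J (a - b) c = genPairing J a c - genPairing J b c := by
  rw [sub_eq_add_neg, genPairing_add_left, genPairing_neg_left, sub_eq_add_neg]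

theorem eq_zero_of_genPairing_eq_zero {x : N} {a : GenTangent J N x}
    (h : ∀ b : GenTangent J N x, genPairing J a b = 0) : a = 0 := by
  refine Prod.ext ?_ (ContinuousLinearMap.ext fun v => ?_)
  · refine SeparatingDual.eq_zero_of_forall_dual_eq_zero (R := ℝ) (V := EN) (x := a.1) fun g => ?_
    have h1 := h ((0 : TangentSpace J x), g)
    have h2 : a.2 (0 : TangentSpace J x) + g a.1 = 0 := h1
    rwa [map_zero, zero_add] at h2
  · have h1 := h (v, (0 : Cotangent J x))
    have h2 : a.2 v + (0 : ℝ) = 0 := h1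
    rwa [add_zero] at h2

theorem contMDiff_genPairing (e₁ e₂ : GenSections J N) :
    ContMDiff J 𝓘(ℝ, ℝ) ∞ (fun x => genPairing J (e₁ x) (e₂ x)) :=
  (contMDiff_form_apply e₁.form e₂.field).add (contMDiff_form_apply e₂.form e₁.field)

theorem dReal_add {f g : N → ℝ} (hf : ContMDiff J 𝓘(ℝ, ℝ) ∞ f) (hg : ContMDiff J 𝓘(ℝ, ℝ) ∞ g)
    (x : N) (v : TangentSpace J x) :
    dReal J (fun y => f y + g y) x v = dReal J f x v + dReal J g x v := by
  have h := mfderiv_add (hf.mdifferentiable (by simp) x) (hg.mdifferentiable (by simp) x)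
  exact congrArg (fun A : EN →L[ℝ] ℝ => A v) h

theorem dReal_sub {f g : N → ℝ} (hf : ContMDiff J 𝓘(ℝ, ℝ) ∞ f) (hg : ContMDiff J 𝓘(ℝ, ℝ) ∞ g)
    (x : N) (v : TangentSpace J x) :
    dReal J (fun y => f y - g y) x v = dReal J f x v - dReal J g x v := by
  have h := mfderiv_sub (hf.mdifferentiable (by simp) x) (hg.mdifferentiable (by simp) x)
  exact congrArg (fun A : EN →L[ℝ] ℝ => A v) h

theorem dReal_mul {f g : N → ℝ} (hf : ContMDiff J 𝓘(ℝ, ℝ) ∞ f) (hg : ContMDiff J 𝓘(ℝ, ℝ) ∞ g)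
    (x : N) (v : TangentSpace J x) :
    dReal J (fun y => f y * g y) x v = f x * dReal J g x v + g x * dReal J f x v := by
  have h := (hf.mdifferentiable (by simp) x).hasMFDerivAt.mul (hg.mdifferentiable (by simp) x).hasMFDerivAt
  exact (congrArg (fun A : EN →L[ℝ] ℝ => A v) h.mfderiv)

theorem dReal_const (c : ℝ) (x : N) (v : TangentSpace J x) : dReal J (fun _ : N => c) x v = 0 :=
  congrArg (fun A : EN →L[ℝ] ℝ => A v) mfderiv_const

variable [J.Boundaryless] [CompleteSpace EN]

theorem dReal_bracket {f : N → ℝ} (hf : ContMDiff J 𝓘(ℝ, ℝ) ∞ f) (X Y : VectorFields J N) (x : N) :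
    dReal J f x (mlieBracket J X Y x) =
      dReal J (fun y => dReal J f y (Y y)) x (X x) - dReal J (fun y => dReal J f y (X y)) x (Y x) :=
  dReal_mlieBracket hf (X.mdifferentiableAt x) (Y.mdifferentiableAt x)
    ((contMDiff_dReal_apply hf X).mdifferentiable (by simp) x)
    ((contMDiff_dReal_apply hf Y).mdifferentiable (by simp) x)

theorem cartan (X Y : VectorFields J N) (θ : OneForms J N) (x : N) :
    contractExtDeriv J X θ x (Y x) =
      dReal J (fun y => θ y (Y y)) x (X x) - dReal J (fun y => θ y (X y)) x (Y x)
        - θ x (mlieBracket J X Y x) :=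
  cartan_of_differentiableAt (X.mdifferentiableAt x) (Y.mdifferentiableAt x)
    (differentiableAt_formInChart θ x)
    ((contMDiff_form_apply θ X).mdifferentiable (by simp) x)
    ((contMDiff_form_apply θ Y).mdifferentiable (by simp) x)

/-- Cartan's formula removes every exterior derivative. What remains are Lie brackets and
derivatives of functions, the form in which all Courant brackets are computed below. -/
theorem genPairing_courantBracket (e₁ e₂ e₃ : GenSections J N) (x : N) :
    genPairing J (courantBracket J e₁ e₂ x) (e₃ x) =
      (e₃ x).2 (mlieBracket J e₁.field e₂.field x)
      - (e₂ x).2 (mlieBracket J e₁.field e₃.field x)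
      + (e₁ x).2 (mlieBracket J e₂.field e₃.field x)
      + dReal J (fun y => (e₂ y).2 (e₃ y).1) x (e₁ x).1
      - dReal J (fun y => (e₁ y).2 (e₃ y).1) x (e₂ x).1
      + dReal J (fun y => (e₁ y).2 (e₂ y).1) x (e₃ x).1 := by
  have h1 := cartan e₁.field e₃.field e₂.form x
  have h2 := cartan e₂.field e₃.field e₁.form x
  have h : genPairing J (courantBracket J e₁ e₂ x) (e₃ x) =
      (dReal J (fun y => e₂.form y (e₁.field y)) x (e₃.field x)
        + contractExtDeriv J e₁.field e₂.form x (e₃.field x)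
        - contractExtDeriv J e₂.field e₁.form x (e₃.field x))
      + (e₃ x).2 (mlieBracket J e₁.field e₂.field x) := rfl
  rw [h, h1, h2]
  have a1 : ∀ y, e₁.form y = (e₁ y).2 := fun _ => rfl
  have a2 : ∀ y, e₂.form y = (e₂ y).2 := fun _ => rfl
  have b1 : ∀ y, e₁.field y = (e₁ y).1 := fun _ => rfl
  have b2 : ∀ y, e₂.field y = (e₂ y).1 := fun _ => rfl
  have b3 : ∀ y, e₃.field y = (e₃ y).1 := fun _ => rfl
  simp only [a1, a2, b1, b2, b3]
  ring

/-- First metric axiom of a Courant algebroid: the symmetric part of the bracket is the differential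
of the pairing. -/
theorem genPairing_courantBracket_swap_left (e₁ e₂ e₃ : GenSections J N) (x : N) :
    genPairing J (courantBracket J e₁ e₂ x) (e₃ x) +
      genPairing J (courantBracket J e₂ e₁ x) (e₃ x) =
      dReal J (fun y => genPairing J (e₁ y) (e₂ y)) x (e₃ x).1 := by
  rw [genPairing_courantBracket, genPairing_courantBracket,
    mlieBracket_swap_apply (V := e₂.field) (W := e₁.field), map_neg]
  have h := dReal_add (contMDiff_form_apply e₁.form e₂.field) (contMDiff_form_apply e₂.form e₁.field)
    x (e₃ x).1
  have h' : dReal J (fun y => genPairing J (e₁ y) (e₂ y)) x (e₃ x).1 =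
    dReal J (fun y => (e₁ y).2 (e₂ y).1) x (e₃ x).1 + dReal J (fun y => (e₂ y).2 (e₁ y).1) x (e₃ x).1 := h
  rw [h']
  ring

/-- Second metric axiom of a Courant algebroid: the pairing is invariant under the bracket. -/
theorem genPairing_courantBracket_swap_right (e₁ e₂ e₃ : GenSections J N) (x : N) :
    genPairing J (courantBracket J e₁ e₂ x) (e₃ x) +
      genPairing J (courantBracket J e₁ e₃ x) (e₂ x) =
      dReal J (fun y => genPairing J (e₂ y) (e₃ y)) x (e₁ x).1 := by
  rw [genPairing_courantBracket, genPairing_courantBracket,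
    mlieBracket_swap_apply (V := e₃.field) (W := e₂.field), map_neg]
  have h := dReal_add (contMDiff_form_apply e₂.form e₃.field) (contMDiff_form_apply e₃.form e₂.field)
    x (e₁ x).1
  have h' : dReal J (fun y => genPairing J (e₂ y) (e₃ y)) x (e₁ x).1 =
    dReal J (fun y => (e₂ y).2 (e₃ y).1) x (e₁ x).1 + dReal J (fun y => (e₃ y).2 (e₂ y).1) x (e₁ x).1 := h
  rw [h']
  ring

/-- Bundle endomorphisms of the generalised tangent bundle. -/
abbrev GenEnd (J : ModelWithCorners ℝ EN HN) (N : Type*) [TopologicalSpace N] [ChartedSpace HN N]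
    [IsManifold J ∞ N] : Type _ :=
  BundleHom J (EN × (EN →L[ℝ] ℝ)) (GenTangent J N) (EN × (EN →L[ℝ] ℝ)) (GenTangent J N)

/-- The Nijenhuis tensor of `𝒥`, with all arguments lowered by the pairing. -/
def nijenhuisForm (𝒥 : GenEnd J N) (e₁ e₂ e₃ : GenSections J N) (x : N) : ℝ :=
  genPairing J (courantBracket J e₁ e₂ x) (e₃ x)
  - genPairing J (courantBracket J (𝒥.mapSection e₁) (𝒥.mapSection e₂) x) (e₃ x)
  - genPairing J (courantBracket J (𝒥.mapSection e₁) e₂ x) (𝒥.mapSection e₃ x)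
  - genPairing J (courantBracket J e₁ (𝒥.mapSection e₂) x) (𝒥.mapSection e₃ x)

variable {𝒥 : GenEnd J N}

theorem genPairing_apply_left (hsq : ∀ x (ξ : GenTangent J N x), 𝒥 x (𝒥 x ξ) = -ξ)
    (hor : ∀ x (ξ η : GenTangent J N x), genPairing J (𝒥 x ξ) (𝒥 x η) = genPairing J ξ η)
    {x : N} (ξ η : GenTangent J N x) : genPairing J (𝒥 x ξ) η = -genPairing J ξ (𝒥 x η) := by
  rw [← hor x (𝒥 x ξ) η, hsq, genPairing_neg_left]

/-- An orthogonal 𝒥 with square -1 is skew for the pairing, so the outer 𝒥 moves to `e₃` with a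
sign. -/
theorem nijenhuisForm_eq (hsq : ∀ x (ξ : GenTangent J N x), 𝒥 x (𝒥 x ξ) = -ξ)
    (hor : ∀ x (ξ η : GenTangent J N x), genPairing J (𝒥 x ξ) (𝒥 x η) = genPairing J ξ η)
    (e₁ e₂ e₃ : GenSections J N) (x : N) :
    nijenhuisForm 𝒥 e₁ e₂ e₃ x = genPairing J (courantBracket J e₁ e₂ x
      - courantBracket J (𝒥.mapSection e₁) (𝒥.mapSection e₂) x
      + 𝒥 x (courantBracket J (𝒥.mapSection e₁) e₂ x
        + courantBracket J e₁ (𝒥.mapSection e₂) x)) (e₃ x) := by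
  rw [genPairing_add_left, genPairing_sub_left, genPairing_apply_left hsq hor, genPairing_add_left,
    nijenhuisForm]
  have : 𝒥.mapSection e₃ x = 𝒥 x (e₃ x) := rfl
  rw [this]
  ring

/-- By the first metric axiom the symmetric part is a sum of four differentials of pairings. They
cancel in pairs: ⟨𝒥e₁, 𝒥e₂⟩ = ⟨e₁, e₂⟩ and ⟨𝒥e₁, e₂⟩ = -⟨e₁, 𝒥e₂⟩. -/
theorem nijenhuisForm_swap_left (hsq : ∀ x (ξ : GenTangent J N x), 𝒥 x (𝒥 x ξ) = -ξ)
    (hor : ∀ x (ξ η : GenTangent J N x), genPairing J (𝒥 x ξ) (𝒥 x η) = genPairing J ξ η)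
    (e₁ e₂ e₃ : GenSections J N) (x : N) :
    nijenhuisForm 𝒥 e₁ e₂ e₃ x = -nijenhuisForm 𝒥 e₂ e₁ e₃ x := by
  have h1 := genPairing_courantBracket_swap_left e₁ e₂ e₃ x
  have h2 := genPairing_courantBracket_swap_left (𝒥.mapSection e₁) (𝒥.mapSection e₂) e₃ x
  have h3 := genPairing_courantBracket_swap_left (𝒥.mapSection e₁) e₂ (𝒥.mapSection e₃) x
  have h4 := genPairing_courantBracket_swap_left e₁ (𝒥.mapSection e₂) (𝒥.mapSection e₃) x
  have k2 : (fun y => genPairing J (𝒥.mapSection e₁ y) (𝒥.mapSection e₂ y)) =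
      fun y => genPairing J (e₁ y) (e₂ y) := funext fun y => hor y _ _
  have k3 : (fun y => genPairing J (𝒥.mapSection e₁ y) (e₂ y)) =
      fun y => 0 - genPairing J (e₁ y) (𝒥.mapSection e₂ y) := funext fun y =>
    (genPairing_apply_left hsq hor _ _).trans (zero_sub _).symm
  rw [k2] at h2
  rw [k3, dReal_sub contMDiff_const (contMDiff_genPairing _ _), dReal_const] at h3
  rw [nijenhuisForm, nijenhuisForm]
  linarith

/-- The argument is the same with the second metric axiom. The derivatives along `e₁` cancel by
orthogonality and those along 𝒥e₁ by skewness. -/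
theorem nijenhuisForm_swap_right (hsq : ∀ x (ξ : GenTangent J N x), 𝒥 x (𝒥 x ξ) = -ξ)
    (hor : ∀ x (ξ η : GenTangent J N x), genPairing J (𝒥 x ξ) (𝒥 x η) = genPairing J ξ η)
    (e₁ e₂ e₃ : GenSections J N) (x : N) :
    nijenhuisForm 𝒥 e₁ e₂ e₃ x = -nijenhuisForm 𝒥 e₁ e₃ e₂ x := by
  have h1 := genPairing_courantBracket_swap_right e₁ e₂ e₃ x
  have h2 := genPairing_courantBracket_swap_right (𝒥.mapSection e₁) (𝒥.mapSection e₂) e₃ x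
  have h3 := genPairing_courantBracket_swap_right (𝒥.mapSection e₁) e₂ (𝒥.mapSection e₃) x
  have h4 := genPairing_courantBracket_swap_right e₁ (𝒥.mapSection e₂) (𝒥.mapSection e₃) x
  have k4 : (fun y => genPairing J (𝒥.mapSection e₂ y) (𝒥.mapSection e₃ y)) =
      fun y => genPairing J (e₂ y) (e₃ y) := funext fun y => hor y _ _
  have k3 : (fun y => genPairing J (𝒥.mapSection e₂ y) (e₃ y)) =
      fun y => 0 - genPairing J (e₂ y) (𝒥.mapSection e₃ y) := funext fun y =>
    (genPairing_apply_left hsq hor _ _).trans (zero_sub _).symm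
  rw [k4] at h4
  rw [k3, dReal_sub contMDiff_const (contMDiff_genPairing _ _), dReal_const] at h2
  rw [nijenhuisForm, nijenhuisForm]
  linarith

/-- The last argument enters only through a pairing with its value at x, so a decomposition at the
single point x suffices. -/
theorem nijenhuisForm_eq_add (hsq : ∀ x (ξ : GenTangent J N x), 𝒥 x (𝒥 x ξ) = -ξ)
    (hor : ∀ x (ξ η : GenTangent J N x), genPairing J (𝒥 x ξ) (𝒥 x η) = genPairing J ξ η)
    (e₁ e₂ : GenSections J N) {e₃ g g' : GenSections J N} {x : N} (h : g x + g' x = e₃ x) :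
    nijenhuisForm 𝒥 e₁ e₂ e₃ x = nijenhuisForm 𝒥 e₁ e₂ g x + nijenhuisForm 𝒥 e₁ e₂ g' x := by
  simp only [nijenhuisForm_eq hsq hor, ← h, genPairing_add_right]

/-- The Nijenhuis tensor of an orthogonal almost complex structure vanishes if it vanishes on
sections whose sums exhaust all fibres. -/
theorem nijenhuis_eq_zero_of_generators (hsq : ∀ x (ξ : GenTangent J N x), 𝒥 x (𝒥 x ξ) = -ξ)
    (hor : ∀ x (ξ η : GenTangent J N x), genPairing J (𝒥 x ξ) (𝒥 x η) = genPairing J ξ η)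
    (S : Set (GenSections J N))
    (hS : ∀ x (ξ : GenTangent J N x), ∃ g ∈ S, ∃ g' ∈ S, g x + g' x = ξ)
    (h : ∀ g₁ ∈ S, ∀ g₂ ∈ S, ∀ g₃ ∈ S, ∀ x, nijenhuisForm 𝒥 g₁ g₂ g₃ x = 0)
    (e₁ e₂ : GenSections J N) (x : N) :
    courantBracket J e₁ e₂ x
      - courantBracket J (𝒥.mapSection e₁) (𝒥.mapSection e₂) x
      + 𝒥 x (courantBracket J (𝒥.mapSection e₁) e₂ x
        + courantBracket J e₁ (𝒥.mapSection e₂) x) = 0 := by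
  -- Only the last slot is visibly pointwise. Alternation carries the other slots there one at a
  -- time, which frees all three arguments from the generators.
  have key : ∀ a b : GenSections J N, (∀ g ∈ S, nijenhuisForm 𝒥 a b g x = 0) →
      ∀ c, nijenhuisForm 𝒥 a b c x = 0 := by
    intro a b hab c
    obtain ⟨g, hg, g', hg', hgg⟩ := hS x (c x)
    rw [nijenhuisForm_eq_add hsq hor a b hgg, hab g hg, hab g' hg', add_zero]
  have h2 : ∀ g₁ ∈ S, ∀ g₂ ∈ S, ∀ c, nijenhuisForm 𝒥 g₁ g₂ c x = 0 := fun g₁ h₁ g₂ h₂ =>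
    key g₁ g₂ fun g hg => h g₁ h₁ g₂ h₂ g hg x
  have h3 : ∀ g₁ ∈ S, ∀ b c, nijenhuisForm 𝒥 g₁ b c x = 0 := fun g₁ h₁ b =>
    key g₁ b fun g hg => by rw [nijenhuisForm_swap_right hsq hor, h2 g₁ h₁ g hg, neg_zero]
  have h4 : ∀ a b c, nijenhuisForm 𝒥 a b c x = 0 := fun a b =>
    key a b fun g hg => by
      rw [nijenhuisForm_swap_right hsq hor, nijenhuisForm_swap_left hsq hor, h3 g hg, neg_zero,
        neg_zero]
  refine eq_zero_of_genPairing_eq_zero fun b => ?_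
  obtain ⟨g, -, g', -, rfl⟩ := hS x b
  rw [genPairing_add_right, ← nijenhuisForm_eq hsq hor, ← nijenhuisForm_eq hsq hor, h4, h4, add_zero]

end Courant

/-! ### Smoothness criteria for families of vectors and linear maps. -/

section Smoothness

variable {EM : Type*} [NormedAddCommGroup EM] [NormedSpace ℝ EM] {HM : Type*} [TopologicalSpace HM]
  {I : ModelWithCorners ℝ EM HM} {M : Type*} [TopologicalSpace M] [ChartedSpace HM M]
  {G : Type*} [NormedAddCommGroup G] [NormedSpace ℝ G] [FiniteDimensional ℝ G]
  {G' : Type*} [NormedAddCommGroup G'] [NormedSpace ℝ G'] [FiniteDimensional ℝ G']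

theorem contMDiffAt_inverse {B : M → G →L[ℝ] G} {x₀ : M}
    (hB : ContMDiffAt I 𝓘(ℝ, G →L[ℝ] G) ∞ B x₀) (h0 : B x₀ = ContinuousLinearMap.id ℝ G) :
    ContMDiffAt I 𝓘(ℝ, G →L[ℝ] G) ∞ (fun x => (B x).inverse) x₀ := by
  have : CompleteSpace G := FiniteDimensional.complete ℝ G
  have h1 : ContDiffAt ℝ ∞ ContinuousLinearMap.inverse (B x₀) := by
    rw [h0]
    exact contDiffAt_map_inverse (ContinuousLinearEquiv.refl ℝ G)
  exact h1.contMDiffAt.comp x₀ hB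

theorem eventually_isInvertible {B : M → G →L[ℝ] G} {x₀ : M}
    (hB : ContMDiffAt I 𝓘(ℝ, G →L[ℝ] G) ∞ B x₀) (h0 : B x₀ = ContinuousLinearMap.id ℝ G) :
    ∀ᶠ x in nhds x₀, (B x).IsInvertible := by
  have : CompleteSpace G := FiniteDimensional.complete ℝ G
  have h := hB.continuousAt (ContinuousLinearEquiv.nhds (ContinuousLinearEquiv.refl ℝ G) |> fun h => by
    rw [h0]; exact h)
  filter_upwards [h] with x hx using hx

/-- With a left inverse L of `A x₀`, the family L ∘ A is smooth and equals the identity at `x₀`. It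
is therefore invertible nearby, and c = (L ∘ A)⁻¹ L (A c) is smooth. -/
theorem contMDiffAt_of_injective_apply {c : M → G} {A : M → G →L[ℝ] G'} {x₀ : M}
    (hA : ContMDiffAt I 𝓘(ℝ, G →L[ℝ] G') ∞ A x₀) (hinj : ∀ v, A x₀ v = 0 → v = 0)
    (hc : ContMDiffAt I 𝓘(ℝ, G') ∞ (fun x => A x (c x)) x₀) : ContMDiffAt I 𝓘(ℝ, G) ∞ c x₀ := by
  obtain ⟨L, hL⟩ := (A x₀ : G →ₗ[ℝ] G').exists_leftInverse_of_injective
    (LinearMap.ker_eq_bot'.2 hinj)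
  set L' : G' →L[ℝ] G := LinearMap.toContinuousLinearMap L with hL'
  have hB : ContMDiffAt I 𝓘(ℝ, G →L[ℝ] G) ∞ (fun x => L'.comp (A x)) x₀ :=
    contMDiffAt_const.clm_comp hA
  have h0 : L'.comp (A x₀) = ContinuousLinearMap.id ℝ G :=
    ContinuousLinearMap.ext fun v => LinearMap.congr_fun hL v
  have h1 := (contMDiffAt_inverse hB h0).clm_apply
    ((contMDiffAt_const (c := L')).clm_apply hc)
  refine h1.congr_of_eventuallyEq ?_
  filter_upwards [eventually_isInvertible hB h0] with x hx
  exact (hx.inverse_apply_self (c x)).symm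

theorem contMDiffAt_sum_smulRight {K : Type*} [NormedAddCommGroup K] [NormedSpace ℝ K]
    {ι : Type*} [Fintype ι] (φ : ι → G →L[ℝ] ℝ) {t : ι → M → K} {x₀ : M}
    (ht : ∀ i, ContMDiffAt I 𝓘(ℝ, K) ∞ (t i) x₀) :
    ContMDiffAt I 𝓘(ℝ, G →L[ℝ] K) ∞ (fun x => ∑ i, (φ i).smulRight (t i x)) x₀ :=
  contMDiffAt_finsetSum fun i _ =>
    ((ContinuousLinearMap.smulRightL ℝ G K (φ i)).contDiff.contMDiff.contMDiffAt).comp x₀ (ht i)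

variable {W₁ : M → Type*} [TopologicalSpace (TotalSpace G W₁)] [∀ x, AddCommGroup (W₁ x)]
  [∀ x, Module ℝ (W₁ x)] [∀ x, TopologicalSpace (W₁ x)] [FiberBundle G W₁] [VectorBundle ℝ G W₁]
  {G₂ : Type*} [NormedAddCommGroup G₂] [NormedSpace ℝ G₂]
  {W₂ : M → Type*} [TopologicalSpace (TotalSpace G₂ W₂)] [∀ x, AddCommGroup (W₂ x)]
  [∀ x, Module ℝ (W₂ x)] [∀ x, TopologicalSpace (W₂ x)] [FiberBundle G₂ W₂] [VectorBundle ℝ G₂ W₂]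
  [∀ x, IsTopologicalAddGroup (W₂ x)] [∀ x, ContinuousSMul ℝ (W₂ x)]

/-- A family of linear maps of fibres is smooth if it maps sufficiently many smooth sections to
smooth sections. -/
theorem contMDiffAt_hom_of_sections (φ : ∀ x, W₁ x →L[ℝ] W₂ x) (x₀ : M)
    (S : Set Cₛ^∞⟮I; G, W₁⟯)
    (hφ : ∀ s ∈ S, ContMDiffAt I (I.prod 𝓘(ℝ, G₂)) ∞
      (fun x => TotalSpace.mk' G₂ x (φ x (s x))) x₀)
    (hS : ∀ w : W₁ x₀, ∃ s ∈ S, s x₀ = w) :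
    ContMDiffAt I (I.prod 𝓘(ℝ, G →L[ℝ] G₂)) ∞
      (fun x => TotalSpace.mk' (G →L[ℝ] G₂) (E := fun x => W₁ x →L[ℝ] W₂ x) x (φ x)) x₀ := by
  rw [contMDiffAt_hom_bundle]
  refine ⟨contMDiffAt_id, ?_⟩
  set b := Module.finBasis ℝ G
  set e₁ := trivializationAt G W₁ x₀
  set e₂ := trivializationAt G₂ W₂ x₀
  have hx₁ : x₀ ∈ e₁.baseSet := FiberBundle.mem_baseSet_trivializationAt' x₀
  have hx₂ : x₀ ∈ e₂.baseSet := FiberBundle.mem_baseSet_trivializationAt' x₀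
  choose s hsS hs using fun i => hS (e₁.symmL ℝ x₀ (b i))
  have hs1 : ∀ i, ContMDiffAt I 𝓘(ℝ, G) ∞ (fun x => (e₁ ⟨x, s i x⟩).2) x₀ := fun i => by
    have h := (s i).contMDiff x₀
    rwa [Bundle.contMDiffAt_section] at h
  have hs2 : ∀ i, ContMDiffAt I 𝓘(ℝ, G₂) ∞ (fun x => (e₂ ⟨x, φ x (s i x)⟩).2) x₀ := fun i => by
    have h := hφ (s i) (hsS i)
    rwa [Bundle.contMDiffAt_section] at h
  let coord : ∀ _, G →L[ℝ] ℝ := fun i => LinearMap.toContinuousLinearMap (b.coord i)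
  -- Let B and T send the basis vector `b i` to the coordinates of `s i` and of φ(`s i`). In
  -- coordinates φ is T ∘ B⁻¹ near `x₀`, where B is the identity.
  have hB := contMDiffAt_sum_smulRight coord hs1
  have hT := contMDiffAt_sum_smulRight coord hs2
  have h0 : (∑ i, (coord i).smulRight (e₁ ⟨x₀, s i x₀⟩).2) = ContinuousLinearMap.id ℝ G := by
    refine ContinuousLinearMap.ext fun v => ?_
    have : ∀ i, (e₁ ⟨x₀, s i x₀⟩).2 = b i := fun i => by
      rw [hs, ← e₁.continuousLinearMapAt_apply_of_mem ℝ hx₁, e₁.continuousLinearMapAt_symmL hx₁]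
    simp only [this, sum_apply, ContinuousLinearMap.smulRight_apply]
    exact b.sum_repr v
  refine (hT.clm_comp (contMDiffAt_inverse hB h0)).congr_of_eventuallyEq ?_
  filter_upwards [eventually_isInvertible hB h0, e₁.open_baseSet.mem_nhds hx₁,
    e₂.open_baseSet.mem_nhds hx₂] with x hx h₁ h₂
  refine ContinuousLinearMap.ext fun v => ?_
  obtain ⟨w, rfl⟩ := hx.surjective v
  rw [ContinuousLinearMap.comp_apply, hx.inverse_apply_self]
  simp only [sum_apply, ContinuousLinearMap.smulRight_apply, map_sum, map_smul]
  refine Finset.sum_congr rfl fun i _ => congrArg _ ?_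
  refine Eq.trans (b := e₂.continuousLinearMapAt ℝ x (φ x (e₁.symmL ℝ x (e₁ ⟨x, s i x⟩).2))) rfl ?_
  rw [← e₁.continuousLinearMapAt_apply_of_mem ℝ h₁, e₁.symmL_continuousLinearMapAt h₁,
    e₂.continuousLinearMapAt_apply_of_mem ℝ h₂]

end Smoothness

/-! ### Vector fields tested on functions. -/

section Fields

variable {EN : Type*} [NormedAddCommGroup EN] [NormedSpace ℝ EN] [FiniteDimensional ℝ EN]
  {HN : Type*} [TopologicalSpace HN]
  {J : ModelWithCorners ℝ EN HN} [J.Boundaryless] {N : Type*} [TopologicalSpace N]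
  [ChartedSpace HN N] [IsManifold J ∞ N]

/-- Here the chart is fixed at `x₀` while x varies, which is needed to see the dependence on x. -/
theorem dReal_eq_fderiv_comp {f : N → ℝ} (hf : ContMDiff J 𝓘(ℝ, ℝ) ∞ f) {x₀ x : N}
    (hx : x ∈ (extChartAt J x₀).source) (v : TangentSpace J x) :
    dReal J f x v = fderiv ℝ (f ∘ (extChartAt J x₀).symm) (extChartAt J x₀ x)
      ((trivializationAt EN (TangentSpace J) x₀).continuousLinearMapAt ℝ x v) := by
  have hx' : x ∈ (chartAt HN x₀).source := by rwa [← extChartAt_source J]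
  have h := formInChart_dReal hf x₀ ((extChartAt J x₀).map_source hx)
  have hm : x ∈ (trivializationAt EN (TangentSpace J) x₀).baseSet := hx'
  have h4 := TangentBundle.symmL_trivializationAt (I := J) hx'
  rw [← h, formInChart]
  have hv := (trivializationAt EN (TangentSpace J) x₀).symmL_continuousLinearMapAt (R := ℝ) hm v
  refine (congrArg (dReal J f x) hv).symm.trans ?_
  generalize (trivializationAt EN (TangentSpace J) x₀).continuousLinearMapAt ℝ x v = w
  refine (congrArg (fun A : EN →L[ℝ] EN => dReal J f x (A w)) h4).trans ?_
  rw [(extChartAt J x₀).left_inv hx]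
  rfl

/-- A vector field is smooth if the derivatives along it of sufficiently many functions are. -/
theorem contMDiffAt_field_of_dReal (X : ∀ x : N, TangentSpace J x) (x₀ : N) (S : Set (N → ℝ))
    (hS : ∀ f ∈ S, ContMDiff J 𝓘(ℝ, ℝ) ∞ f)
    (hX : ∀ f ∈ S, ContMDiffAt J 𝓘(ℝ, ℝ) ∞ (fun x => dReal J f x (X x)) x₀)
    (hsep : ∀ v : TangentSpace J x₀, (∀ f ∈ S, dReal J f x₀ v = 0) → v = 0) :
    ContMDiffAt J (J.prod 𝓘(ℝ, EN)) ∞ (fun x => TotalSpace.mk' EN x (X x)) x₀ := by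
  rw [Bundle.contMDiffAt_section]
  let F : (N → ℝ) → Module.Dual ℝ EN := fun f =>
    ContinuousLinearMap.toLinearMap (show EN →L[ℝ] ℝ from dReal J f x₀)
  -- A linearly independent family of differentials at `x₀` with the same span is finite, so the
  -- joint differential A of these functions takes values in a finite-dimensional space and is still
  -- injective at `x₀`.
  obtain ⟨b, hbS, hspan, hb⟩ := exists_linearIndependent ℝ (F '' S)
  have hfin : Finite b := hb.finite
  have : Fintype b := Fintype.ofFinite b
  choose g hgS hg using fun i : b => hbS i.2
  let A : N → EN →L[ℝ] (b → ℝ) := fun x => ContinuousLinearMap.pi fun i =>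
    fderiv ℝ (g i ∘ (extChartAt J x₀).symm) (extChartAt J x₀ x)
  have hsrc := extChartAt_source_mem_nhds (I := J) x₀
  have hA : ContMDiffAt J 𝓘(ℝ, EN →L[ℝ] (b → ℝ)) ∞ A x₀ := by
    have h1 : ContDiffAt ℝ ∞ (fun y => ContinuousLinearMap.pi fun i =>
        fderiv ℝ (g i ∘ (extChartAt J x₀).symm) y) (extChartAt J x₀ x₀) := by
      have h2 : ContDiffAt ℝ ∞ (fun y => fun i : b => fderiv ℝ (g i ∘ (extChartAt J x₀).symm) y)
          (extChartAt J x₀ x₀) := contDiffAt_pi.2 fun i =>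
        (contDiffAt_comp_extChartAt_symm (hS _ (hgS i)) x₀).fderiv_right (by simp)
      exact (ContinuousLinearMap.piEquivL ℝ EN (fun _ : b => ℝ)).contDiff.contDiffAt.comp _ h2
    exact h1.contMDiffAt.comp x₀ contMDiffAt_extChartAt
  refine contMDiffAt_of_injective_apply hA ?_ ?_
  · intro v hv
    have h0 : ∀ (f : N → ℝ), f ∈ S → F f v = fderiv ℝ (f ∘ (extChartAt J x₀).symm)
        (extChartAt J x₀ x₀) v := fun f hf => by
      rw [← dReal_eq_fderiv ((hS f hf).mdifferentiable (by simp) x₀)]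
      rfl
    refine hsep v fun f hf => ?_
    have hmem : F f ∈ Submodule.span ℝ b := by
      rw [hspan]
      exact Submodule.subset_span ⟨f, hf, rfl⟩
    have hle : Submodule.span ℝ b ≤ LinearMap.ker (Module.Dual.eval ℝ EN v) := by
      refine Submodule.span_le.2 fun φ hφ => ?_
      have h1 : A x₀ v ⟨φ, hφ⟩ = 0 := by rw [hv]; rfl
      have h2 := h0 _ (hgS ⟨φ, hφ⟩)
      rw [hg ⟨φ, hφ⟩] at h2
      exact h2.trans h1
    have h1 := hle hmem
    exact h1
  · rw [contMDiffAt_pi_space]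
    intro i
    refine (hX _ (hgS i)).congr_of_eventuallyEq ?_
    filter_upwards [hsrc] with x hx
    have hx' : x ∈ (trivializationAt EN (TangentSpace J) x₀).baseSet := by
      rwa [extChartAt_source J] at hx
    rw [dReal_eq_fderiv_comp (hS _ (hgS i)) hx,
      (trivializationAt EN (TangentSpace J) x₀).continuousLinearMapAt_apply_of_mem ℝ hx']
    rfl

end Fields

/-! ### Global extensions of vectors, and tensoriality. -/

section Extension

variable {EM : Type*} [NormedAddCommGroup EM] [NormedSpace ℝ EM] [FiniteDimensional ℝ EM]
  {HM : Type*} [TopologicalSpace HM]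
  {I : ModelWithCorners ℝ EM HM} {M : Type*} [TopologicalSpace M] [ChartedSpace HM M]
  [IsManifold I ∞ M] [T2Space M]
  {G : Type*} [NormedAddCommGroup G] [NormedSpace ℝ G]
  {W : M → Type*} [TopologicalSpace (TotalSpace G W)] [∀ x, AddCommGroup (W x)]
  [∀ x, Module ℝ (W x)] [∀ x, TopologicalSpace (W x)] [FiberBundle G W] [VectorBundle ℝ G W]
  [ContMDiffVectorBundle ∞ G W I]

variable (I G W) in
/-- A bump function centred at `x` with support in the domain of the trivialisation at `x`. -/
theorem exists_bump (x : M) :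
    ∃ ψ : SmoothBumpFunction I x, tsupport ψ ⊆ (trivializationAt G W x).baseSet := by
  obtain ⟨ψ, -, h⟩ := (SmoothBumpFunction.nhds_basis_tsupport (I := I) x).mem_iff.1
    ((trivializationAt G W x).open_baseSet.mem_nhds (FiberBundle.mem_baseSet_trivializationAt' x))
  exact ⟨ψ, h⟩

variable (I G W) in
/-- The bump function used to extend vectors at `x` to sections. -/
def extensionBump (x : M) : SmoothBumpFunction I x := (exists_bump I G W x).choose

theorem tsupport_extensionBump (x : M) :
    tsupport (extensionBump I G W x) ⊆ (trivializationAt G W x).baseSet :=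
  (exists_bump I G W x).choose_spec

variable (I W) in
/-- The global section that is `ψ • g` in the trivialisation at `x`, for a bump function `ψ`. -/
def bumpSection (x : M) : G →ₗ[ℝ] Cₛ^∞⟮I; G, W⟯ where
  toFun g := ⟨fun y => extensionBump I G W x y • (trivializationAt G W x).symmL ℝ y g, by
    refine ContMDiffOn.smul_section_of_tsupport (extensionBump I G W x).contMDiff.contMDiffOn
      (trivializationAt G W x).open_baseSet (tsupport_extensionBump x)
      (s := fun y => (trivializationAt G W x).symmL ℝ y g) ?_
    rw [(trivializationAt G W x).contMDiffOn_section_baseSet_iff]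
    refine (contMDiffOn_const (c := g)).congr fun y hy => ?_
    rw [← (trivializationAt G W x).continuousLinearMapAt_apply_of_mem ℝ hy,
      (trivializationAt G W x).continuousLinearMapAt_symmL hy]⟩
  map_add' a b := by
    ext y
    exact (congrArg _ (map_add _ a b)).trans (smul_add _ _ _)
  map_smul' r a := by
    ext y
    exact (congrArg _ (map_smul _ r a)).trans (smul_comm _ _ _)

variable (I G) in
/-- A linear extension of vectors at `x` to global sections. -/
def extendSection (x : M) : W x →ₗ[ℝ] Cₛ^∞⟮I; G, W⟯ :=
  (bumpSection I W x).comp ((trivializationAt G W x).continuousLinearMapAt ℝ x : W x →ₗ[ℝ] G)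

@[simp]
theorem extendSection_self (x : M) (w : W x) : extendSection I G x w x = w := by
  have h : extendSection I G x w x = extensionBump I G W x x •
    (trivializationAt G W x).symmL ℝ x ((trivializationAt G W x).continuousLinearMapAt ℝ x w) := rfl
  rw [h, (trivializationAt G W x).symmL_continuousLinearMapAt
    (FiberBundle.mem_baseSet_trivializationAt' x), (extensionBump I G W x).eq_one, one_smul]

variable (I G) in
theorem exists_section {x : M} (w : W x) : ∃ s : Cₛ^∞⟮I; G, W⟯, s x = w :=
  ⟨extendSection I G x w, extendSection_self x w⟩

variable [FiniteDimensional ℝ G]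

/-- A linear map on sections that is linear over the functions at `x` only depends on the value of
the section at `x`. -/
theorem eq_zero_of_tensorial {A : Type*} [AddCommGroup A] [Module ℝ A] {x : M}
    (Φ : Cₛ^∞⟮I; G, W⟯ →ₗ[ℝ] A)
    (hΦ : ∀ (f : C^∞⟮I, M; ℝ⟯) s, Φ (smulSection f s) = f x • Φ s) {s : Cₛ^∞⟮I; G, W⟯}
    (hs : s x = 0) : Φ s = 0 := by
  set b := Module.finBasis ℝ G
  set e := trivializationAt G W x with he
  set ψ := extensionBump I G W x with hψ
  have hc : ∀ i, ContMDiff I 𝓘(ℝ, ℝ) ∞ (fun y => ψ y * b.repr (e ⟨y, s y⟩).2 i) := by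
    intro i
    refine contMDiff_of_tsupport fun y hy => ?_
    have hy' : y ∈ e.baseSet := tsupport_extensionBump x (tsupport_mul_subset_left hy)
    have h1 := (e.contMDiffAt_section_iff hy').1 (s.contMDiff y)
    have h2 : ContMDiffAt I 𝓘(ℝ, ℝ) ∞ (fun y => (LinearMap.toContinuousLinearMap (b.coord i))
        (e ⟨y, s y⟩).2) y := contMDiffAt_const.clm_apply h1
    exact ψ.contMDiffAt.mul h2
  let c : ∀ _, C^∞⟮I, M; ℝ⟯ := fun i => ⟨_, hc i⟩
  -- The square of the bump function is needed: one factor makes the coefficients of s global and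
  -- the other the local frame.
  let f : C^∞⟮I, M; ℝ⟯ := ⟨fun y => ψ y * ψ y, ψ.contMDiff.mul ψ.contMDiff⟩
  have hsum : smulSection f s = ∑ i, smulSection (c i) (bumpSection I W x (b i)) := by
    ext y
    have h1 : (∑ i, smulSection (c i) (bumpSection I W x (b i))) y =
        ∑ i, (ψ y * b.repr (e ⟨y, s y⟩).2 i) • (ψ y • e.symmL ℝ y (b i)) := by
      refine (congrFun (map_sum (ContMDiffSection.coeAddHom I G ∞ W) _ _) y).trans ?_
      rw [Finset.sum_apply]
      rfl
    have h2 : smulSection f s y = (ψ y * ψ y) • s y := rfl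
    rw [h1, h2]
    by_cases hy : ψ y = 0
    · simp [hy]
    · have hy' : y ∈ e.baseSet := tsupport_extensionBump x (subset_tsupport _ hy)
      have h3 : s y = ∑ i, b.repr (e ⟨y, s y⟩).2 i • e.symmL ℝ y (b i) := by
        conv_lhs => rw [← e.symmL_continuousLinearMapAt (R := ℝ) hy' (s y)]
        rw [e.continuousLinearMapAt_apply_of_mem ℝ hy']
        conv_lhs => rw [← b.sum_repr (e ⟨y, s y⟩).2]
        rw [map_sum]
        exact Finset.sum_congr rfl fun i _ => map_smul _ _ _
      conv_lhs => rw [h3]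
      rw [Finset.smul_sum]
      refine Finset.sum_congr rfl fun i _ => ?_
      rw [smul_smul, smul_smul]
      congr 1
      ring
  have hf : f x = 1 := by
    have : f x = ψ x * ψ x := rfl
    rw [this, ψ.eq_one, mul_one]
  have h := hΦ f s
  rw [hf, one_smul, hsum, map_sum] at h
  rw [← h]
  refine Finset.sum_eq_zero fun i _ => ?_
  rw [hΦ]
  have hx : x ∈ e.baseSet := FiberBundle.mem_baseSet_trivializationAt' x
  have : c i x = 0 := by
    have h4 : c i x = ψ x * b.repr (e ⟨x, s x⟩).2 i := rfl
    rw [h4, hs, ← e.continuousLinearMapAt_apply_of_mem ℝ hx, map_zero, map_zero]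
    simp
  rw [this, zero_smul]

theorem tensorial_congr {A : Type*} [AddCommGroup A] [Module ℝ A] {x : M}
    (Φ : Cₛ^∞⟮I; G, W⟯ →ₗ[ℝ] A)
    (hΦ : ∀ (f : C^∞⟮I, M; ℝ⟯) s, Φ (smulSection f s) = f x • Φ s) {s t : Cₛ^∞⟮I; G, W⟯}
    (h : s x = t x) : Φ s = Φ t := by
  rw [← sub_eq_zero, ← map_sub]
  refine eq_zero_of_tensorial Φ hΦ ?_
  have : (s - t) x = s x - t x := rfl
  rw [this, h, sub_self]

end Extension

/-! ### Existence of linear connections. -/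

section Connection

variable {EM : Type*} [NormedAddCommGroup EM] [NormedSpace ℝ EM] [FiniteDimensional ℝ EM]
  {HM : Type*} [TopologicalSpace HM]
  {I : ModelWithCorners ℝ EM HM} {M : Type*} [TopologicalSpace M] [ChartedSpace HM M]
  [IsManifold I ∞ M] [T2Space M] [SigmaCompactSpace M]
  {G : Type*} [NormedAddCommGroup G] [NormedSpace ℝ G]
  {W : M → Type*} [TopologicalSpace (TotalSpace G W)] [∀ x, AddCommGroup (W x)]
  [∀ x, Module ℝ (W x)] [∀ x, TopologicalSpace (W x)] [FiberBundle G W] [VectorBundle ℝ G W]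
  [ContMDiffVectorBundle ∞ G W I]

variable (I) in
/-- The derivative along `v` of a section in the trivialisation at `i`. -/
def trivDeriv (i : M) (s : Cₛ^∞⟮I; G, W⟯) (x : M) (v : TangentSpace I x) : W x :=
  (trivializationAt G W i).symmL ℝ x
    ((mfderiv I 𝓘(ℝ, G) (fun y => (trivializationAt G W i ⟨y, s y⟩).2) x : EM →L[ℝ] G) v)

theorem contMDiffAt_trivialization (i : M) (s : Cₛ^∞⟮I; G, W⟯) {x : M}
    (hx : x ∈ (trivializationAt G W i).baseSet) :
    ContMDiffAt I 𝓘(ℝ, G) ∞ (fun y => (trivializationAt G W i ⟨y, s y⟩).2) x :=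
  ((trivializationAt G W i).contMDiffAt_section_iff hx).1 (s.contMDiff x)

theorem contMDiffOn_trivDeriv (i : M) (s : Cₛ^∞⟮I; G, W⟯) (X : VectorFields I M) :
    ContMDiffOn I (I.prod 𝓘(ℝ, G)) ∞ (fun x => TotalSpace.mk' G x (trivDeriv I i s x (X x)))
      (trivializationAt G W i).baseSet := by
  set e := trivializationAt G W i
  rw [e.contMDiffOn_section_baseSet_iff]
  have : IsManifold I 1 M := IsManifold.of_le (n := ∞) (by norm_cast)
  have h1 : ContMDiffOn I 𝓘(ℝ, G) ∞ (fun y => (e ⟨y, s y⟩).2) e.baseSet := fun x hx =>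
    (contMDiffAt_trivialization i s hx).contMDiffWithinAt
  have h2 := h1.contMDiffOn_tangentMapWithin (m := ∞) (by simp) e.open_baseSet.uniqueMDiffOn
  have h3 := (contMDiff_snd_tangentBundle_modelSpace (n := ∞) G 𝓘(ℝ, G)).comp_contMDiffOn
    (h2.comp X.contMDiff.contMDiffOn (s := e.baseSet) (fun x hx => hx))
  refine h3.congr fun x hx => ?_
  rw [← e.continuousLinearMapAt_apply_of_mem ℝ hx]
  refine (e.continuousLinearMapAt_symmL (R := ℝ) hx _).trans ?_
  have h4 := mfderivWithin_of_isOpen (I := I) (I' := 𝓘(ℝ, G)) (f := fun y => (e ⟨y, s y⟩).2)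
    e.open_baseSet hx
  exact congrArg (fun A : EM →L[ℝ] G => A (X x)) h4.symm

theorem trivDeriv_add {i : M} (s t : Cₛ^∞⟮I; G, W⟯) {x : M} (v : TangentSpace I x)
    (hx : x ∈ (trivializationAt G W i).baseSet) :
    trivDeriv I i (s + t) x v = trivDeriv I i s x v + trivDeriv I i t x v := by
  set e := trivializationAt G W i with he
  have h1 := mfderiv_add ((contMDiffAt_trivialization i s hx).mdifferentiableAt (by simp))
    ((contMDiffAt_trivialization i t hx).mdifferentiableAt (by simp))
  have h2 : (fun y => (e ⟨y, (s + t) y⟩).2) =ᶠ[nhds x]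
      ((fun y => (e ⟨y, s y⟩).2) + fun y => (e ⟨y, t y⟩).2) := by
    filter_upwards [e.open_baseSet.mem_nhds hx] with y hy
    simp only [Pi.add_apply, ← e.continuousLinearMapAt_apply_of_mem ℝ hy, ← map_add]
    rfl
  rw [← h2.mfderiv_eq] at h1
  exact (congrArg (fun A : EM →L[ℝ] G => e.symmL ℝ x (A v)) h1).trans (map_add _ _ _)

theorem trivDeriv_smul {i : M} (f : C^∞⟮I, M; ℝ⟯) (s : Cₛ^∞⟮I; G, W⟯) {x : M}
    (v : TangentSpace I x) (hx : x ∈ (trivializationAt G W i).baseSet) :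
    trivDeriv I i (smulSection f s) x v = f x • trivDeriv I i s x v + dReal I f x v • s x := by
  set e := trivializationAt G W i with he
  have h1 := mvfderiv_smul ((f.contMDiff x).mdifferentiableAt (by simp))
    ((contMDiffAt_trivialization i s hx).mdifferentiableAt (by simp))
  have h2 : (fun y => (e ⟨y, (smulSection f s) y⟩).2) =ᶠ[nhds x]
      ((f : M → ℝ) • fun y => (e ⟨y, s y⟩).2) := by
    filter_upwards [e.open_baseSet.mem_nhds hx] with y hy
    simp only [Pi.smul_apply', ← e.continuousLinearMapAt_apply_of_mem ℝ hy, ← map_smul]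
    rfl
  refine (congrArg (fun A : EM →L[ℝ] G => e.symmL ℝ x (A v)) (h2.mfderiv_eq (I := I) (I' := 𝓘(ℝ, G)))).trans ?_
  refine (congrArg (fun A : EM →L[ℝ] G => e.symmL ℝ x (A v)) h1).trans ?_
  refine (map_add (e.symmL ℝ x) _ _).trans ?_
  refine congrArg₂ (· + ·) (map_smul (e.symmL ℝ x) _ _) ?_
  refine (map_smul (e.symmL ℝ x) _ _).trans ?_
  have h3 := e.symmL_continuousLinearMapAt (R := ℝ) hx (s x)
  rw [e.continuousLinearMapAt_apply_of_mem ℝ hx] at h3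
  exact congrArg _ h3

theorem trivDeriv_add_right {i : M} (s : Cₛ^∞⟮I; G, W⟯) {x : M} (v w : TangentSpace I x) :
    trivDeriv I i s x (v + w) = trivDeriv I i s x v + trivDeriv I i s x w :=
  (congrArg ((trivializationAt G W i).symmL ℝ x) (map_add (mfderiv I 𝓘(ℝ, G)
    (fun y => (trivializationAt G W i ⟨y, s y⟩).2) x : EM →L[ℝ] G) v w)).trans (map_add _ _ _)

theorem trivDeriv_smul_right {i : M} (s : Cₛ^∞⟮I; G, W⟯) {x : M} (r : ℝ) (v : TangentSpace I x) :
    trivDeriv I i s x (r • v) = r • trivDeriv I i s x v :=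
  (congrArg ((trivializationAt G W i).symmL ℝ x) (map_smul (mfderiv I 𝓘(ℝ, G)
    (fun y => (trivializationAt G W i ⟨y, s y⟩).2) x : EM →L[ℝ] G) r v)).trans (map_smul _ _ _)

variable (I G W) in
/-- Linear connections exist. -/
theorem exists_connection : ∃ C : VectorFields I M →ₗ[ℝ] Cₛ^∞⟮I; G, W⟯ →ₗ[ℝ] Cₛ^∞⟮I; G, W⟯,
    (∀ (f : C^∞⟮I, M; ℝ⟯) X s x, C (smulSection f X) s x = f x • C X s x) ∧
    ∀ (f : C^∞⟮I, M; ℝ⟯) X s x,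
      C X (smulSection f s) x = f x • C X s x + dReal I f x (X x) • s x := by
  -- The flat connections of the local trivialisations are glued with a partition of unity. The
  -- derivative terms of their Leibniz rules add up correctly because the weights have sum one.
  obtain ⟨ρ, hρ⟩ := SmoothPartitionOfUnity.exists_isSubordinate I isClosed_univ
    (fun i : M => (trivializationAt G W i).baseSet)
    (fun i => (trivializationAt G W i).open_baseSet)
    (fun x _ => Set.mem_iUnion.2 ⟨x, FiberBundle.mem_baseSet_trivializationAt' x⟩)
  have hmem : ∀ i x, i ∈ ρ.finsupport x → x ∈ (trivializationAt G W i).baseSet := fun i x hi =>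
    hρ i (subset_tsupport _ ((ρ.mem_finsupport x).1 hi))
  have hsm : ∀ (X : VectorFields I M) (s : Cₛ^∞⟮I; G, W⟯), ContMDiff I (I.prod 𝓘(ℝ, G)) ∞ (fun x => TotalSpace.mk' G (E := W) x
      (∑ᶠ i, ρ i x • trivDeriv I i s x (X x))) := fun X s =>
    ContMDiff.finsum_section_of_locallyFinite (t := fun i x => ρ i x • trivDeriv I i s x (X x))
      (ρ.locallyFinite.subset fun i x hx => fun h => hx (by simp [h]))
      fun i => ContMDiffOn.smul_section_of_tsupport (ρ i).contMDiff.contMDiffOn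
        (trivializationAt G W i).open_baseSet (hρ i) (contMDiffOn_trivDeriv i s X)
  have heq : ∀ (X : VectorFields I M) (s : Cₛ^∞⟮I; G, W⟯) (x : M),
      ∑ᶠ i, ρ i x • trivDeriv I i s x (X x) =
        ∑ i ∈ ρ.finsupport x, ρ i x • trivDeriv I i s x (X x) := fun X s x =>
    finsum_eq_sum_of_support_subset _ fun i hi => by
      rw [ρ.coe_finsupport]
      exact fun h => hi (by simp [h])
  have hone : ∀ x, ∑ i ∈ ρ.finsupport x, ρ i x = 1 := fun x => ρ.sum_finsupport x (Set.mem_univ x)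
  let C₀ : VectorFields I M → Cₛ^∞⟮I; G, W⟯ → Cₛ^∞⟮I; G, W⟯ := fun X s => ⟨_, hsm X s⟩
  have hC : ∀ (X : VectorFields I M) (s : Cₛ^∞⟮I; G, W⟯) (x : M), C₀ X s x = ∑ i ∈ ρ.finsupport x, ρ i x • trivDeriv I i s x (X x) := heq
  have hl : ∀ (f : C^∞⟮I, M; ℝ⟯) (X : VectorFields I M) (s : Cₛ^∞⟮I; G, W⟯) (x : M),
      C₀ X (smulSection f s) x = f x • C₀ X s x + dReal I f x (X x) • s x := by
    intro f X s x
    rw [hC, hC, Finset.sum_congr rfl fun i hi => congrArg (ρ i x • ·)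
      (trivDeriv_smul f s (X x) (hmem i x hi))]
    simp only [smul_add, Finset.sum_add_distrib]
    rw [← Finset.sum_smul, hone, one_smul, Finset.smul_sum]
    simp only [smul_comm (f x)]
  have hr : ∀ (f : C^∞⟮I, M; ℝ⟯) (X : VectorFields I M) (s : Cₛ^∞⟮I; G, W⟯) (x : M), C₀ (smulSection f X) s x = f x • C₀ X s x := by
    intro f X s x
    rw [hC, hC, Finset.smul_sum]
    refine Finset.sum_congr rfl fun i _ => ?_
    rw [smul_comm]
    exact congrArg _ (trivDeriv_smul_right s (f x) (X x))
  refine ⟨LinearMap.mk₂ ℝ C₀ ?_ ?_ ?_ ?_, hr, hl⟩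
  · intro X Y s
    ext x
    refine (hC _ _ _).trans (Eq.trans ?_ (congrArg₂ (· + ·) (hC X s x) (hC Y s x)).symm)
    rw [← Finset.sum_add_distrib]
    refine Finset.sum_congr rfl fun i _ => ?_
    rw [← smul_add]
    exact congrArg _ (trivDeriv_add_right s (X x) (Y x))
  · intro r X s
    ext x
    exact hr ⟨fun _ => r, contMDiff_const⟩ X s x
  · intro X s t
    ext x
    refine (hC _ _ _).trans (Eq.trans ?_ (congrArg₂ (· + ·) (hC X s x) (hC X t x)).symm)
    rw [← Finset.sum_add_distrib]
    refine Finset.sum_congr rfl fun i hi => ?_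
    rw [← smul_add, trivDeriv_add s t (X x) (hmem i x hi)]
  · intro r X s
    ext x
    refine (hl ⟨fun _ => r, contMDiff_const⟩ X s x).trans ?_
    have h : dReal I (fun _ : M => r) x (X x) = 0 := dReal_const r x (X x)
    exact (congrArg (fun c : ℝ => r • C₀ X s x + c • s x) h).trans (by rw [zero_smul, add_zero]; rfl)

end Connection

/-- The fibre carries no norm, so the separation of points by functionals is transported from the
model fibre F. -/
theorem eq_zero_of_forall_dual {M : Type*} [TopologicalSpace M] (F : Type*) [NormedAddCommGroup F]
    [NormedSpace ℝ F] {V : M → Type*} [TopologicalSpace (TotalSpace F V)] [∀ x, AddCommGroup (V x)]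
    [∀ x, Module ℝ (V x)] [∀ x, TopologicalSpace (V x)] [FiberBundle F V] [VectorBundle ℝ F V]
    {x : M} {c : V x} (h : ∀ η : V x →L[ℝ] ℝ, η c = 0) : c = 0 := by
  have hx := FiberBundle.mem_baseSet_trivializationAt' (F := F) (E := V) x
  have h1 : (trivializationAt F V x).continuousLinearMapAt ℝ x c = 0 :=
    SeparatingDual.eq_zero_of_forall_dual_eq_zero (R := ℝ) fun g =>
      h (g.comp ((trivializationAt F V x).continuousLinearMapAt ℝ x))
  rw [← (trivializationAt F V x).symmL_continuousLinearMapAt (R := ℝ) hx c, h1, map_zero]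

/-! ### Tangent vectors of the total space: vertical part, projection, linear functions. -/

section TotalSpaceGeometry

variable {EM : Type*} [NormedAddCommGroup EM] [NormedSpace ℝ EM] [FiniteDimensional ℝ EM]
  {HM : Type*} [TopologicalSpace HM]
  {I : ModelWithCorners ℝ EM HM} {M : Type*} [TopologicalSpace M] [ChartedSpace HM M]
  [IsManifold I ∞ M]
  {F : Type*} [NormedAddCommGroup F] [NormedSpace ℝ F] [FiniteDimensional ℝ F]
  {V : M → Type*} [TopologicalSpace (TotalSpace F V)] [∀ x, AddCommGroup (V x)]
  [∀ x, Module ℝ (V x)] [∀ x, TopologicalSpace (V x)]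
  [∀ x, IsTopologicalAddGroup (V x)] [∀ x, ContinuousSMul ℝ (V x)]
  [FiberBundle F V] [VectorBundle ℝ F V] [ContMDiffVectorBundle ∞ F V I]

namespace Shortcuts

scoped instance : FiniteDimensional ℝ (F →L[ℝ] ℝ) := inferInstance
scoped instance : ContMDiffVectorBundle ∞ (EM × (F →L[ℝ] ℝ)) (Side I V) I := inferInstance
scoped instance : IsManifold (I.prod 𝓘(ℝ, F)) ∞ (TotalSpace F V) := inferInstance

end Shortcuts

open scoped Shortcuts


/-- The fibrewise linear function on the total space defined by the `V*`-component of `ν`. -/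
def linFun (ν : SideSection I (F := F) (V := V)) (p : TotalSpace F V) : ℝ := (ν p.proj).2 p.snd

theorem contMDiff_proj_total : ContMDiff (I.prod 𝓘(ℝ, F)) I ∞ (TotalSpace.proj : TotalSpace F V → M) :=
  Bundle.contMDiff_proj V

theorem contMDiff_linFun (ν : SideSection I (F := F) (V := V)) :
    ContMDiff (I.prod 𝓘(ℝ, F)) 𝓘(ℝ, ℝ) ∞ (linFun ν) := by
  have h1 : ContMDiff (I.prod 𝓘(ℝ, F)) (I.prod 𝓘(ℝ, F →L[ℝ] ℝ)) ∞ (fun p : TotalSpace F V =>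
      (⟨p.proj, (ν p.proj).2⟩ : TotalSpace (F →L[ℝ] ℝ) (fun x => DualFibre V x))) :=
    (sndSection ν).contMDiff.comp contMDiff_proj_total
  have h2 : ContMDiff (I.prod 𝓘(ℝ, F)) (I.prod 𝓘(ℝ, F)) ∞ (fun p : TotalSpace F V =>
      (⟨p.proj, p.snd⟩ : TotalSpace F V)) := contMDiff_id
  have h := ContMDiff.clm_bundle_apply (F₂ := ℝ) (E₂ := fun _ : M => ℝ) h1 h2
  intro p
  exact (Bundle.contMDiffAt_totalSpace.1 (h p)).2

theorem contMDiff_comp_proj {f : M → ℝ} (hf : ContMDiff I 𝓘(ℝ, ℝ) ∞ f) :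
    ContMDiff (I.prod 𝓘(ℝ, F)) 𝓘(ℝ, ℝ) ∞ (fun p : TotalSpace F V => f p.proj) :=
  hf.comp contMDiff_proj_total

theorem dReal_comp_proj {f : M → ℝ} (hf : ContMDiff I 𝓘(ℝ, ℝ) ∞ f) (p : TotalSpace F V)
    (w : TangentTotal I F V p) :
    dReal (I.prod 𝓘(ℝ, F)) (fun p : TotalSpace F V => f p.proj) p w =
      dReal I f p.proj (dProj I p w) := by
  have h := mfderiv_comp p (hf.mdifferentiable (by simp) p.proj)
    ((contMDiff_proj_total (I := I) (F := F) (V := V)).mdifferentiable (by simp) p)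
  exact congrArg (fun A : EM × F →L[ℝ] ℝ => A w) h

/-- The line `t ↦ p + t w` in a fibre. -/
def fibreLine (p : TotalSpace F V) (w : V p.proj) (t : ℝ) : TotalSpace F V :=
  ⟨p.proj, p.snd + t • w⟩

theorem contMDiff_fibreLine (p : TotalSpace F V) (w : V p.proj) :
    ContMDiff 𝓘(ℝ, ℝ) (I.prod 𝓘(ℝ, F)) ∞ (fibreLine p w) := by
  intro t
  have key : ∀ v : V p.proj, (trivializationAt F V p.proj ⟨p.proj, v⟩).2 =
      (trivializationAt F V p.proj).continuousLinearMapAt ℝ p.proj v := fun v =>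
    ((trivializationAt F V p.proj).continuousLinearMapAt_apply_of_mem ℝ
      (FiberBundle.mem_baseSet_trivializationAt' p.proj) v).symm
  rw [contMDiffAt_totalSpace]
  refine ⟨contMDiffAt_const, ?_⟩
  simp only [fibreLine, key, map_add, map_smul]
  exact (contDiff_const.add (contDiff_id.smul contDiff_const)).contMDiff.contMDiffAt

theorem fibreLine_zero (p : TotalSpace F V) (w : V p.proj) : fibreLine p w 0 = p := by
  simp [fibreLine]

/-- Vertical derivatives become derivatives of one real variable along `fibreLine`. -/
theorem mfderiv_vertical {EN : Type*} [NormedAddCommGroup EN] [NormedSpace ℝ EN] {HN : Type*}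
    [TopologicalSpace HN] {J : ModelWithCorners ℝ EN HN} {N : Type*} [TopologicalSpace N]
    [ChartedSpace HN N] {g : TotalSpace F V → N} (hg : ContMDiff (I.prod 𝓘(ℝ, F)) J ∞ g)
    (p : TotalSpace F V) (w : V p.proj) :
    (mfderiv (I.prod 𝓘(ℝ, F)) J g p : EM × F →L[ℝ] EN) (verticalLift I p w) =
      (mfderiv 𝓘(ℝ, ℝ) J (fun t => g (fibreLine p w t)) 0 : ℝ →L[ℝ] EN) 1 := by
  have h := mfderiv_comp (0 : ℝ) (hg.mdifferentiable (by simp) _)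
    ((contMDiff_fibreLine (I := I) p w).mdifferentiable (by simp) 0)
  refine Eq.trans ?_ (congrArg (fun A : ℝ →L[ℝ] EN => A 1) h).symm
  exact congrArg (fun q => (mfderiv (I.prod 𝓘(ℝ, F)) J g q : EM × F →L[ℝ] EN) (verticalLift I p w))
    (fibreLine_zero p w).symm

theorem dReal_vertical {g : TotalSpace F V → ℝ} (hg : ContMDiff (I.prod 𝓘(ℝ, F)) 𝓘(ℝ, ℝ) ∞ g)
    (p : TotalSpace F V) (w : V p.proj) :
    dReal (I.prod 𝓘(ℝ, F)) g p (verticalLift I p w) = deriv (fun t => g (fibreLine p w t)) 0 := by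
  refine (mfderiv_vertical hg p w).trans ?_
  rw [mfderiv_eq_fderiv]
  rfl

theorem dReal_linFun_vertical (ν : SideSection I (F := F) (V := V)) (p : TotalSpace F V)
    (w : V p.proj) :
    dReal (I.prod 𝓘(ℝ, F)) (linFun ν) p (verticalLift I p w) = (ν p.proj).2 w := by
  rw [dReal_vertical (contMDiff_linFun ν)]
  have h : (fun t => linFun ν (fibreLine p w t)) =
      fun t : ℝ => (ν p.proj).2 p.snd + t * (ν p.proj).2 w := by
    funext t
    exact (map_add (ν p.proj).2 _ _).trans (congrArg _ (map_smul (ν p.proj).2 t w))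
  rw [h]
  simp

theorem dProj_vertical (p : TotalSpace F V) (w : V p.proj) : dProj I p (verticalLift I p w) = 0 := by
  refine (mfderiv_vertical (contMDiff_proj_total (I := I)) p w).trans ?_
  have h : (fun t => (fibreLine p w t).proj) = fun _ : ℝ => p.proj := rfl
  exact congrArg (fun A : ℝ →L[ℝ] EM => A 1) (mfderiv_const (I := 𝓘(ℝ, ℝ)) (I' := I) (c := p.proj))

/-- The tangent space at p is read in the preferred chart at p, whose first component is the
preferred chart of M at the projection of p. -/
theorem dProj_eq_fst (p : TotalSpace F V) : (dProj I p : EM × F →L[ℝ] EM) =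
    ContinuousLinearMap.fst ℝ EM F := by
  have h : HasMFDerivAt (I.prod 𝓘(ℝ, F)) I (TotalSpace.proj : TotalSpace F V → M) p
      (ContinuousLinearMap.fst ℝ EM F) := by
    refine ⟨(FiberBundle.continuous_proj F V).continuousAt, ?_⟩
    refine (hasFDerivWithinAt_fst (𝕜 := ℝ) (E := EM) (F := F)).congr_of_eventuallyEq ?_ ?_
    · filter_upwards [extChartAt_target_mem_nhdsWithin (I := I.prod 𝓘(ℝ, F)) p] with y hy
      have h1 := (extChartAt (I.prod 𝓘(ℝ, F)) p).right_inv hy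
      have h2 := (extChartAt (I.prod 𝓘(ℝ, F)) p).map_target hy
      simp only [writtenInExtChartAt, Function.comp_apply]
      conv_rhs => rw [← h1]
      rw [FiberBundle.extChartAt] at h2 ⊢
      refine congrArg (extChartAt I p.proj) ?_
      refine ((trivializationAt F V p.proj).coe_fst ?_).symm
      exact h2.1
    · simp only [writtenInExtChartAt, Function.comp_apply, extChartAt_to_inv]
      rw [FiberBundle.extChartAt]
      exact congrArg (extChartAt I p.proj) ((trivializationAt F V p.proj).coe_fst'
        (FiberBundle.mem_baseSet_trivializationAt' p.proj)).symm
  exact h.mfderiv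

/-- A right inverse of `dProj`. -/
def dProjSection (p : TotalSpace F V) : TangentSpace I p.proj →L[ℝ] TangentTotal I F V p :=
  (ContinuousLinearMap.inl ℝ EM F : EM →L[ℝ] EM × F)

theorem dProj_dProjSection (p : TotalSpace F V) (v : TangentSpace I p.proj) :
    dProj I p (dProjSection p v) = v :=
  congrArg (fun A : EM × F →L[ℝ] EM => A (v, 0)) (dProj_eq_fst (I := I) p)

theorem exists_vertical_of_dProj_eq_zero {p : TotalSpace F V} {w : TangentTotal I F V p}
    (h : dProj I p w = 0) : ∃ c, verticalLift I p c = w := by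
  have h1 : (w : EM × F).1 = 0 :=
    (congrArg (fun A : EM × F →L[ℝ] EM => A w) (dProj_eq_fst (I := I) p)).symm.trans h
  refine ⟨(trivializationAt F V p.proj).symmL ℝ p.proj (w : EM × F).2, ?_⟩
  refine (vertical_eq I p _).trans ?_
  rw [(trivializationAt F V p.proj).continuousLinearMapAt_symmL
    (FiberBundle.mem_baseSet_trivializationAt' p.proj)]
  exact Prod.ext h1.symm rfl

variable [T2Space M]

theorem exists_sideSection {x : M} (v : TangentSpace I x) (η : V x →L[ℝ] ℝ) :
    ∃ ν : SideSection I (F := F) (V := V), ν x = (v, η) :=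
  exists_section I (EM × (F →L[ℝ] ℝ)) (W := Side I V) ((v, η) : Side I V x)

/-- Vectors with equal projections differ by a vertical lift of some c, on which the linear function
of η has derivative η(c). All η occur, hence c = 0. Identities in TE are tested in this way below.
-/
theorem tangent_ext {p : TotalSpace F V} {v w : TangentTotal I F V p}
    (h : dProj I p v = dProj I p w)
    (hl : ∀ ν : SideSection I (F := F) (V := V), dReal (I.prod 𝓘(ℝ, F)) (linFun ν) p v =
      dReal (I.prod 𝓘(ℝ, F)) (linFun ν) p w) : v = w := by
  obtain ⟨c, hc⟩ := exists_vertical_of_dProj_eq_zero (w := v - w) (by rw [map_sub, h, sub_self])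
  have h0 : c = 0 := eq_zero_of_forall_dual F fun η => by
    obtain ⟨ν, hν⟩ := exists_sideSection (F := F) (V := V) (0 : TangentSpace I p.proj) η
    have h1 := dReal_linFun_vertical ν p c
    rw [hc, map_sub, hl, sub_self, hν] at h1
    exact h1.symm
  rw [← sub_eq_zero, ← hc, h0, map_zero]

theorem mfderiv_section {EN : Type*} [NormedAddCommGroup EN] [NormedSpace ℝ EN] {HN : Type*}
    [TopologicalSpace HN] {J : ModelWithCorners ℝ EN HN} {N : Type*} [TopologicalSpace N]
    [ChartedSpace HN N] {g : TotalSpace F V → N} (hg : ContMDiff (I.prod 𝓘(ℝ, F)) J ∞ g)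
    (e : Cₛ^∞⟮I; F, V⟯) (x : M) (v : TangentSpace I x) :
    (mfderiv (I.prod 𝓘(ℝ, F)) J g ⟨x, e x⟩ : EM × F →L[ℝ] EN)
      (mfderiv I (I.prod 𝓘(ℝ, F)) (fun y => (⟨y, e y⟩ : TotalSpace F V)) x v) =
      (mfderiv I J (fun y => g ⟨y, e y⟩) x : EM →L[ℝ] EN) v := by
  have h := mfderiv_comp x (hg.mdifferentiable (by simp) _) (e.contMDiff.mdifferentiable (by simp) x)
  exact (congrArg (fun A : EM →L[ℝ] EN => A v) h).symm

theorem dProj_mfderiv_section (e : Cₛ^∞⟮I; F, V⟯) (x : M) (v : TangentSpace I x) :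
    dProj I ⟨x, e x⟩ (mfderiv I (I.prod 𝓘(ℝ, F)) (fun y => (⟨y, e y⟩ : TotalSpace F V)) x v) = v :=
  (mfderiv_section contMDiff_proj_total e x v).trans
    (congrArg (fun A : EM →L[ℝ] EM => A v) (mfderiv_id (I := I) (x := x)))

theorem dReal_mfderiv_section {g : TotalSpace F V → ℝ}
    (hg : ContMDiff (I.prod 𝓘(ℝ, F)) 𝓘(ℝ, ℝ) ∞ g) (e : Cₛ^∞⟮I; F, V⟯) (x : M)
    (v : TangentSpace I x) :
    dReal (I.prod 𝓘(ℝ, F)) g ⟨x, e x⟩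
      (mfderiv I (I.prod 𝓘(ℝ, F)) (fun y => (⟨y, e y⟩ : TotalSpace F V)) x v) =
      dReal I (fun y => g ⟨y, e y⟩) x v :=
  mfderiv_section hg e x v

end TotalSpaceGeometry

open scoped Shortcuts

/-! ### Addition and scaling of TE over TM. -/

section DoubleBundle

variable {EM : Type*} [NormedAddCommGroup EM] [NormedSpace ℝ EM] [FiniteDimensional ℝ EM]
  {HM : Type*} [TopologicalSpace HM]
  {I : ModelWithCorners ℝ EM HM} {M : Type*} [TopologicalSpace M] [ChartedSpace HM M]
  [IsManifold I ∞ M]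
  {F : Type*} [NormedAddCommGroup F] [NormedSpace ℝ F] [FiniteDimensional ℝ F]
  {V : M → Type*} [TopologicalSpace (TotalSpace F V)] [∀ x, AddCommGroup (V x)]
  [∀ x, Module ℝ (V x)] [∀ x, TopologicalSpace (V x)]
  [∀ x, IsTopologicalAddGroup (V x)] [∀ x, ContinuousSMul ℝ (V x)]
  [FiberBundle F V] [VectorBundle ℝ F V] [ContMDiffVectorBundle ∞ F V I]

/-- The first projection of `E ⊕ E`. -/
def totalFst (p : TotalSpace (F × F) (V ×ᵇ V)) : TotalSpace F V := ⟨p.proj, p.snd.1⟩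

/-- The second projection of `E ⊕ E`. -/
def totalSnd (p : TotalSpace (F × F) (V ×ᵇ V)) : TotalSpace F V := ⟨p.proj, p.snd.2⟩

/-- The fibrewise addition of `E`. -/
def totalAdd (p : TotalSpace (F × F) (V ×ᵇ V)) : TotalSpace F V := ⟨p.proj, p.snd.1 + p.snd.2⟩

/-- The fibrewise scalar multiplication of `E`. -/
def totalScale (c : ℝ) (p : TotalSpace F V) : TotalSpace F V := ⟨p.proj, c • p.snd⟩

theorem contMDiffAt_trivialization_snd (p : TotalSpace F V) :
    ContMDiffAt (I.prod 𝓘(ℝ, F)) 𝓘(ℝ, F) ∞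
      (fun q : TotalSpace F V => (trivializationAt F V p.proj q).2) p :=
  (contMDiffAt_totalSpace.1 (contMDiffAt_id (I := I.prod 𝓘(ℝ, F)) (n := ∞) (x := p))).2

theorem contMDiff_totalFst : ContMDiff (I.prod 𝓘(ℝ, F × F)) (I.prod 𝓘(ℝ, F)) ∞
    (totalFst (F := F) (V := V)) := fun p => by
  rw [contMDiffAt_totalSpace]
  exact ⟨(contMDiff_proj_total (V := V ×ᵇ V)) p,
    (contDiff_fst (𝕜 := ℝ) (E := F) (F := F)).contMDiff.contMDiffAt.comp p
      (contMDiffAt_trivialization_snd p)⟩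

theorem contMDiff_totalSnd : ContMDiff (I.prod 𝓘(ℝ, F × F)) (I.prod 𝓘(ℝ, F)) ∞
    (totalSnd (F := F) (V := V)) := fun p => by
  rw [contMDiffAt_totalSpace]
  exact ⟨(contMDiff_proj_total (V := V ×ᵇ V)) p,
    (contDiff_snd (𝕜 := ℝ) (E := F) (F := F)).contMDiff.contMDiffAt.comp p
      (contMDiffAt_trivialization_snd p)⟩

theorem eventually_proj_mem_baseSet (p : TotalSpace F V) :
    ∀ᶠ q in nhds p, q.proj ∈ (trivializationAt F V p.proj).baseSet :=
  (FiberBundle.continuous_proj F V).continuousAt.eventually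
    ((trivializationAt F V p.proj).open_baseSet.mem_nhds
      (FiberBundle.mem_baseSet_trivializationAt' p.proj))

theorem contMDiff_totalAdd : ContMDiff (I.prod 𝓘(ℝ, F × F)) (I.prod 𝓘(ℝ, F)) ∞
    (totalAdd (F := F) (V := V)) := fun p => by
  rw [contMDiffAt_totalSpace]
  refine ⟨(contMDiff_proj_total (V := V ×ᵇ V)) p, ?_⟩
  have h := ((contDiff_fst (𝕜 := ℝ) (E := F) (F := F)).add contDiff_snd).contMDiff.contMDiffAt.comp p
      (contMDiffAt_trivialization_snd (I := I) p)
  refine h.congr_of_eventuallyEq ?_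
  filter_upwards [eventually_proj_mem_baseSet p] with q hq
  exact ((trivializationAt F V p.proj).linear ℝ hq.1).map_add q.snd.1 q.snd.2

theorem contMDiff_totalScale (c : ℝ) : ContMDiff (I.prod 𝓘(ℝ, F)) (I.prod 𝓘(ℝ, F)) ∞
    (totalScale c (F := F) (V := V)) := fun p => by
  rw [contMDiffAt_totalSpace]
  refine ⟨contMDiff_proj_total p, ?_⟩
  have h := (contDiff_const_smul (𝕜 := ℝ) (F := F) c).contMDiff.contMDiffAt.comp p
      (contMDiffAt_trivialization_snd (I := I) p)
  refine h.congr_of_eventuallyEq ?_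
  filter_upwards [eventually_proj_mem_baseSet p] with q hq
  exact ((trivializationAt F V p.proj).linear ℝ hq).map_smul c q.snd

section FibrePreserving

variable {F' : Type*} [NormedAddCommGroup F'] [NormedSpace ℝ F'] [FiniteDimensional ℝ F']
  {V' : M → Type*} [TopologicalSpace (TotalSpace F' V')] [∀ x, AddCommGroup (V' x)]
  [∀ x, Module ℝ (V' x)] [∀ x, TopologicalSpace (V' x)]
  [∀ x, IsTopologicalAddGroup (V' x)] [∀ x, ContinuousSMul ℝ (V' x)]
  [FiberBundle F' V'] [VectorBundle ℝ F' V'] [ContMDiffVectorBundle ∞ F' V' I]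
  {g : ∀ x, V' x → V x}

theorem dProj_mfderiv (hg : ContMDiff (I.prod 𝓘(ℝ, F')) (I.prod 𝓘(ℝ, F)) ∞
      (fun p : TotalSpace F' V' => (⟨p.proj, g p.proj p.snd⟩ : TotalSpace F V)))
    (p : TotalSpace F' V') (w : TangentTotal I F' V' p) :
    dProj I (⟨p.proj, g p.proj p.snd⟩ : TotalSpace F V) (mfderiv (I.prod 𝓘(ℝ, F')) (I.prod 𝓘(ℝ, F))
      (fun p : TotalSpace F' V' => (⟨p.proj, g p.proj p.snd⟩ : TotalSpace F V)) p w) =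
      dProj I p w := by
  have h := mfderiv_comp p ((contMDiff_proj_total (I := I) (V := V)).mdifferentiable (by simp) _)
    (hg.mdifferentiable (by simp) p)
  exact (congrArg (fun A : EM × F' →L[ℝ] EM => A w) h).symm

theorem dReal_mfderiv (hg : ContMDiff (I.prod 𝓘(ℝ, F')) (I.prod 𝓘(ℝ, F)) ∞
      (fun p : TotalSpace F' V' => (⟨p.proj, g p.proj p.snd⟩ : TotalSpace F V)))
    {f : TotalSpace F V → ℝ} (hf : ContMDiff (I.prod 𝓘(ℝ, F)) 𝓘(ℝ, ℝ) ∞ f)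
    (p : TotalSpace F' V') (w : TangentTotal I F' V' p) :
    dReal (I.prod 𝓘(ℝ, F)) f ⟨p.proj, g p.proj p.snd⟩
      (mfderiv (I.prod 𝓘(ℝ, F')) (I.prod 𝓘(ℝ, F))
      (fun p : TotalSpace F' V' => (⟨p.proj, g p.proj p.snd⟩ : TotalSpace F V)) p w) =
      dReal (I.prod 𝓘(ℝ, F')) (fun p : TotalSpace F' V' => f ⟨p.proj, g p.proj p.snd⟩) p w := by
  have h := mfderiv_comp p (hf.mdifferentiable (by simp) _) (hg.mdifferentiable (by simp) p)
  exact (congrArg (fun A : EM × F' →L[ℝ] ℝ => A w) h).symm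

end FibrePreserving

theorem dProj_dScale (c : ℝ) {x : M} (e : V x) (v : TangentTotal I F V ⟨x, e⟩) :
    dProj I ⟨x, c • e⟩ (dScale I c e v) = dProj I ⟨x, e⟩ v :=
  dProj_mfderiv (g := fun _ w => c • w) (contMDiff_totalScale c) ⟨x, e⟩ v

theorem dReal_linFun_dScale (c : ℝ) {x : M} (e : V x) (v : TangentTotal I F V ⟨x, e⟩)
    (ν : SideSection I (F := F) (V := V)) :
    dReal (I.prod 𝓘(ℝ, F)) (linFun ν) ⟨x, c • e⟩ (dScale I c e v) =
      c * dReal (I.prod 𝓘(ℝ, F)) (linFun ν) ⟨x, e⟩ v := by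
  refine (dReal_mfderiv (g := fun _ w => c • w) (contMDiff_totalScale c) (contMDiff_linFun ν)
    ⟨x, e⟩ v).trans ?_
  have h : (fun p : TotalSpace F V => linFun ν ⟨p.proj, c • p.snd⟩) =
      fun p => (fun _ => c) p * linFun ν p := by
    funext p
    exact map_smul (ν p.proj).2 c p.snd
  rw [h, dReal_mul contMDiff_const (contMDiff_linFun ν), dReal_const]
  simp

variable [T2Space M]

theorem dReal_linFun_of_isTangentSum {x : M} {e₁ e₂ : V x} {v₁ : TangentTotal I F V ⟨x, e₁⟩}
    {v₂ : TangentTotal I F V ⟨x, e₂⟩} {v₃ : TangentTotal I F V ⟨x, e₁ + e₂⟩}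
    (h : IsTangentSum I v₁ v₂ v₃) (ν : SideSection I (F := F) (V := V)) :
    dReal (I.prod 𝓘(ℝ, F)) (linFun ν) _ v₃ = dReal (I.prod 𝓘(ℝ, F)) (linFun ν) _ v₁ +
      dReal (I.prod 𝓘(ℝ, F)) (linFun ν) _ v₂ := by
  obtain ⟨w, rfl, rfl, rfl⟩ := h
  have h1 := dReal_mfderiv (F' := F × F) (V' := V ×ᵇ V) (g := fun _ w => w.1) (contMDiff_totalFst (I := I)) (contMDiff_linFun ν)
    ⟨x, (e₁, e₂)⟩ w
  have h2 := dReal_mfderiv (F' := F × F) (V' := V ×ᵇ V) (g := fun _ w => w.2) (contMDiff_totalSnd (I := I)) (contMDiff_linFun ν)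
    ⟨x, (e₁, e₂)⟩ w
  have h3 := dReal_mfderiv (F' := F × F) (V' := V ×ᵇ V) (g := fun _ w => w.1 + w.2) (contMDiff_totalAdd (I := I))
    (contMDiff_linFun ν) ⟨x, (e₁, e₂)⟩ w
  refine h3.trans (Eq.trans ?_ (congrArg₂ (· + ·) h1 h2).symm)
  have h : (fun p : TotalSpace (F × F) (V ×ᵇ V) => linFun ν ⟨p.proj, p.snd.1 + p.snd.2⟩) =
      fun p => linFun ν ⟨p.proj, p.snd.1⟩ + linFun ν ⟨p.proj, p.snd.2⟩ := by
    funext p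
    exact map_add (ν p.proj).2 p.snd.1 p.snd.2
  rw [h]
  exact dReal_add ((contMDiff_linFun ν).comp contMDiff_totalFst)
    ((contMDiff_linFun ν).comp contMDiff_totalSnd) _ _

theorem dProj_of_isTangentSum {x : M} {e₁ e₂ : V x} {v₁ : TangentTotal I F V ⟨x, e₁⟩}
    {v₂ : TangentTotal I F V ⟨x, e₂⟩} {v₃ : TangentTotal I F V ⟨x, e₁ + e₂⟩}
    (h : IsTangentSum I v₁ v₂ v₃) : dProj I _ v₃ = dProj I _ v₁ ∧ dProj I _ v₃ = dProj I _ v₂ := by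
  obtain ⟨w, rfl, rfl, rfl⟩ := h
  have h1 := dProj_mfderiv (F' := F × F) (V' := V ×ᵇ V) (g := fun _ w => w.1) (contMDiff_totalFst (I := I) (F := F) (V := V))
    ⟨x, (e₁, e₂)⟩ w
  have h2 := dProj_mfderiv (F' := F × F) (V' := V ×ᵇ V) (g := fun _ w => w.2) (contMDiff_totalSnd (I := I) (F := F) (V := V))
    ⟨x, (e₁, e₂)⟩ w
  have h3 := dProj_mfderiv (F' := F × F) (V' := V ×ᵇ V) (g := fun _ w => w.1 + w.2)
    (contMDiff_totalAdd (I := I) (F := F) (V := V)) ⟨x, (e₁, e₂)⟩ w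
  exact ⟨h3.trans h1.symm, h3.trans h2.symm⟩

/-- Each vector is a vertical lift plus the derivative, along the common projection X, of a section
through its base point. The two sections together and the two vertical parts together give a tangent
vector of E ⊕ E with the prescribed components. -/
theorem exists_isTangentSum {x : M} {e₁ e₂ : V x} (v₁ : TangentTotal I F V ⟨x, e₁⟩)
    (v₂ : TangentTotal I F V ⟨x, e₂⟩) (h : dProj I _ v₁ = dProj I _ v₂) :
    ∃ v₃ : TangentTotal I F V ⟨x, e₁ + e₂⟩, IsTangentSum I v₁ v₂ v₃ := by
  obtain ⟨s₁, rfl⟩ := exists_section I F e₁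
  obtain ⟨s₂, rfl⟩ := exists_section I F e₂
  have key : ∀ (s : Cₛ^∞⟮I; F, V⟯) (v : TangentTotal I F V ⟨x, s x⟩), ∃ c, verticalLift I ⟨x, s x⟩ c +
      mfderiv I (I.prod 𝓘(ℝ, F)) (fun y => (⟨y, s y⟩ : TotalSpace F V)) x (dProj I _ v) = v := by
    intro s v
    obtain ⟨c, hc⟩ := exists_vertical_of_dProj_eq_zero (w := v -
      mfderiv I (I.prod 𝓘(ℝ, F)) (fun y => (⟨y, s y⟩ : TotalSpace F V)) x (dProj I _ v)) (by
        rw [map_sub, dProj_mfderiv_section, sub_self])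
    exact ⟨c, by rw [hc, sub_add_cancel]⟩
  obtain ⟨c₁, hc₁⟩ := key s₁ v₁
  obtain ⟨c₂, hc₂⟩ := key s₂ v₂
  rw [← h] at hc₂
  set X := dProj I _ v₁
  let s := pairSection s₁ s₂
  let w : TangentTotal I (F × F) (V ×ᵇ V) ⟨x, (s₁ x, s₂ x)⟩ :=
    verticalLift I (F := F × F) (V := V ×ᵇ V) ⟨x, s x⟩ (c₁, c₂) +
      mfderiv I (I.prod 𝓘(ℝ, F × F)) (fun y => (⟨y, s y⟩ : TotalSpace (F × F) (V ×ᵇ V))) x X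
  refine ⟨_, w, ?_, ?_, rfl⟩
  · refine Eq.trans (map_add (mfderiv (I.prod 𝓘(ℝ, F × F)) (I.prod 𝓘(ℝ, F))
      (totalFst (F := F) (V := V)) ⟨x, s x⟩) _ _) ?_
    refine Eq.trans (congrArg₂ (· + ·) (mfderiv_vertical contMDiff_totalFst ⟨x, s x⟩ (c₁, c₂))
      (mfderiv_section contMDiff_totalFst s x X)) hc₁
  · refine Eq.trans (map_add (mfderiv (I.prod 𝓘(ℝ, F × F)) (I.prod 𝓘(ℝ, F))
      (totalSnd (F := F) (V := V)) ⟨x, s x⟩) _ _) ?_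
    refine Eq.trans (congrArg₂ (· + ·) (mfderiv_vertical contMDiff_totalSnd ⟨x, s x⟩ (c₁, c₂))
      (mfderiv_section contMDiff_totalSnd s x X)) hc₂

/-- A sum in `TE → TM` is determined by the derivatives of the fibrewise linear functions. -/
theorem isTangentSum_iff {x : M} {e₁ e₂ : V x} {v₁ : TangentTotal I F V ⟨x, e₁⟩}
    {v₂ : TangentTotal I F V ⟨x, e₂⟩} {v₃ : TangentTotal I F V ⟨x, e₁ + e₂⟩} :
    IsTangentSum I v₁ v₂ v₃ ↔ (dProj I _ v₃ = dProj I _ v₁ ∧ dProj I _ v₃ = dProj I _ v₂) ∧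
      ∀ ν : SideSection I (F := F) (V := V), dReal (I.prod 𝓘(ℝ, F)) (linFun ν) _ v₃ =
        dReal (I.prod 𝓘(ℝ, F)) (linFun ν) _ v₁ + dReal (I.prod 𝓘(ℝ, F)) (linFun ν) _ v₂ := by
  refine ⟨fun h => ⟨dProj_of_isTangentSum h, dReal_linFun_of_isTangentSum h⟩, fun h => ?_⟩
  obtain ⟨v, hv⟩ := exists_isTangentSum v₁ v₂ (h.1.1.symm.trans h.1.2)
  have : v = v₃ := tangent_ext ((dProj_of_isTangentSum hv).1.trans h.1.1.symm) fun ν =>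
    (dReal_linFun_of_isTangentSum hv ν).trans (h.2 ν).symm
  exact this ▸ hv

theorem isTangentSum_vertical {x : M} {e₁ e₂ : V x} (c₁ c₂ : V x) :
    IsTangentSum I (verticalLift I (⟨x, e₁⟩ : TotalSpace F V) c₁)
      (verticalLift I (⟨x, e₂⟩ : TotalSpace F V) c₂)
      (verticalLift I (⟨x, e₁ + e₂⟩ : TotalSpace F V) (c₁ + c₂)) := by
  rw [isTangentSum_iff]
  refine ⟨⟨?_, ?_⟩, fun ν => ?_⟩
  · rw [dProj_vertical, dProj_vertical]
  · rw [dProj_vertical, dProj_vertical]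
  · rw [dReal_linFun_vertical, dReal_linFun_vertical, dReal_linFun_vertical]
    exact map_add (ν x).2 c₁ c₂

theorem IsTangentSum.add {x : M} {e₁ e₂ : V x} {v₁ w₁ : TangentTotal I F V ⟨x, e₁⟩}
    {v₂ w₂ : TangentTotal I F V ⟨x, e₂⟩} {v₃ w₃ : TangentTotal I F V ⟨x, e₁ + e₂⟩}
    (hv : IsTangentSum I v₁ v₂ v₃) (hw : IsTangentSum I w₁ w₂ w₃) :
    IsTangentSum I (v₁ + w₁) (v₂ + w₂) (v₃ + w₃) := by
  rw [isTangentSum_iff] at hv hw ⊢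
  refine ⟨⟨?_, ?_⟩, fun ν => ?_⟩
  · rw [map_add, map_add, hv.1.1, hw.1.1]
  · rw [map_add, map_add, hv.1.2, hw.1.2]
  · rw [map_add, map_add, map_add, hv.2, hw.2]; ring

theorem IsTangentSum.smul {x : M} {e₁ e₂ : V x} {v₁ : TangentTotal I F V ⟨x, e₁⟩}
    {v₂ : TangentTotal I F V ⟨x, e₂⟩} {v₃ : TangentTotal I F V ⟨x, e₁ + e₂⟩}
    (hv : IsTangentSum I v₁ v₂ v₃) (r : ℝ) : IsTangentSum I (r • v₁) (r • v₂) (r • v₃) := by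
  rw [isTangentSum_iff] at hv ⊢
  refine ⟨⟨?_, ?_⟩, fun ν => ?_⟩
  · rw [map_smul, map_smul, hv.1.1]
  · rw [map_smul, map_smul, hv.1.2]
  · rw [map_smul, map_smul, map_smul, hv.2, smul_add]

/-- Two arbitrary vectors over the projection of `v₃` have a sum that differs from `v₃` by a
vertical vector, which is absorbed into the first summand. -/
theorem exists_isTangentSum_eq {x : M} {e₁ e₂ : V x} (v₃ : TangentTotal I F V ⟨x, e₁ + e₂⟩) :
    ∃ (v₁ : TangentTotal I F V ⟨x, e₁⟩) (v₂ : TangentTotal I F V ⟨x, e₂⟩),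
      IsTangentSum I v₁ v₂ v₃ := by
  let w₁ : TangentTotal I F V ⟨x, e₁⟩ := dProjSection (I := I) _ (dProj I ⟨x, e₁ + e₂⟩ v₃)
  let w₂ : TangentTotal I F V ⟨x, e₂⟩ := dProjSection (I := I) _ (dProj I ⟨x, e₁ + e₂⟩ v₃)
  have h₁ : dProj I ⟨x, e₁⟩ w₁ = dProj I ⟨x, e₁ + e₂⟩ v₃ := dProj_dProjSection (I := I) (⟨x, e₁⟩ : TotalSpace F V) (dProj I ⟨x, e₁ + e₂⟩ v₃)
  have h₂ : dProj I ⟨x, e₂⟩ w₂ = dProj I ⟨x, e₁ + e₂⟩ v₃ := dProj_dProjSection (I := I) (⟨x, e₂⟩ : TotalSpace F V) (dProj I ⟨x, e₁ + e₂⟩ v₃)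
  obtain ⟨w₃, hw⟩ := exists_isTangentSum w₁ w₂ (h₁.trans h₂.symm)
  obtain ⟨c, hc⟩ := exists_vertical_of_dProj_eq_zero (w := v₃ - w₃) (by
    rw [map_sub, (dProj_of_isTangentSum hw).1, h₁, sub_self])
  refine ⟨_, _, (?_ : IsTangentSum I (w₁ + verticalLift I ⟨x, e₁⟩ c) (w₂ + verticalLift I ⟨x, e₂⟩ 0) v₃)⟩
  have h := hw.add (isTangentSum_vertical (F := F) (e₁ := e₁) (e₂ := e₂) c 0)
  rw [add_zero, hc, add_sub_cancel] at h
  exact h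

end DoubleBundle

/-! ### Sections tested on dual sections. -/

section DualSmooth

variable {EM : Type*} [NormedAddCommGroup EM] [NormedSpace ℝ EM] [FiniteDimensional ℝ EM]
  {HM : Type*} [TopologicalSpace HM]
  {I : ModelWithCorners ℝ EM HM} {M : Type*} [TopologicalSpace M] [ChartedSpace HM M]
  [IsManifold I ∞ M] [T2Space M]
  {G : Type*} [NormedAddCommGroup G] [NormedSpace ℝ G] [FiniteDimensional ℝ G]
  {W : M → Type*} [TopologicalSpace (TotalSpace G W)] [∀ x, AddCommGroup (W x)]
  [∀ x, Module ℝ (W x)] [∀ x, TopologicalSpace (W x)] [FiberBundle G W] [VectorBundle ℝ G W]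
  [∀ x, IsTopologicalAddGroup (W x)] [∀ x, ContinuousSMul ℝ (W x)] [ContMDiffVectorBundle ∞ G W I]

/-- A section is smooth if its pairings with the smooth sections of the dual bundle are. -/
theorem contMDiffAt_of_dual_apply (e : ∀ x, W x) (x₀ : M)
    (h : ∀ η : Cₛ^∞⟮I; G →L[ℝ] ℝ, fun x => DualFibre W x⟯,
      ContMDiffAt I 𝓘(ℝ, ℝ) ∞ (fun x => η x (e x)) x₀) :
    ContMDiffAt I (I.prod 𝓘(ℝ, G)) ∞ (fun x => TotalSpace.mk' G x (e x)) x₀ := by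
  set b := Module.finBasis ℝ G
  set t := trivializationAt G W x₀ with ht
  have hx₀ : x₀ ∈ t.baseSet := FiberBundle.mem_baseSet_trivializationAt' x₀
  choose η hη using fun i => exists_section I (G →L[ℝ] ℝ) (W := fun x => DualFibre W x) (x := x₀)
    ((LinearMap.toContinuousLinearMap (b.coord i)).comp (t.continuousLinearMapAt ℝ x₀))
  -- A is the coordinate matrix of sections `η i` extending the dual basis at `x₀`. It is injective
  -- at `x₀`, and its value on the coordinates of e consists of the functions η_i(e).
  let A : M → G →L[ℝ] (Fin (Module.finrank ℝ G) → ℝ) := fun x =>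
    ∑ i, ((η i x).comp (t.symmL ℝ x)).smulRight (Pi.single i (1 : ℝ))
  have hAi : ∀ x v i, A x v i = η i x (t.symmL ℝ x v) := fun x v i => by
    simp [A, Finset.sum_apply, Pi.single_apply]
  have hA : ContMDiffAt I 𝓘(ℝ, G →L[ℝ] (Fin (Module.finrank ℝ G) → ℝ)) ∞ A x₀ := by
    refine contMDiffAt_finsetSum fun i _ => ?_
    have h1 := ((contMDiffAt_hom_bundle _).1 ((η i).contMDiff x₀)).2
    have h2 := (((ContinuousLinearMap.smulRightL ℝ G (Fin (Module.finrank ℝ G) → ℝ)).flip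
      (Pi.single i (1 : ℝ))).contDiff.contMDiff.contMDiffAt).comp x₀ h1
    refine h2.congr_of_eventuallyEq ?_
    filter_upwards [t.open_baseSet.mem_nhds hx₀] with x hx
    refine ContinuousLinearMap.ext fun v => ?_
    simp [ContinuousLinearMap.inCoordinates, ht]
  rw [Bundle.contMDiffAt_section]
  refine contMDiffAt_of_injective_apply hA (fun v hv => ?_) ?_
  · refine b.ext_elem fun i => ?_
    have h1 := congrFun hv i
    rw [hAi, hη] at h1
    have h2 : b.coord i (t.continuousLinearMapAt ℝ x₀ (t.symmL ℝ x₀ v)) = 0 := h1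
    rw [t.continuousLinearMapAt_symmL hx₀] at h2
    simpa using h2
  · rw [contMDiffAt_pi_space]
    intro i
    refine (h (η i)).congr_of_eventuallyEq ?_
    filter_upwards [t.open_baseSet.mem_nhds hx₀] with x hx
    refine (hAi _ _ _).trans (congrArg (η i x) ?_)
    refine Eq.trans (congrArg (t.symmL ℝ x) ?_) (t.symmL_continuousLinearMapAt (R := ℝ) hx (e x))
    exact (t.continuousLinearMapAt_apply_of_mem ℝ hx _).symm

end DualSmooth

/-! ### The duality of side and core, and the exact sequence from the core to the side. -/

section CoreAndSide

variable {EM : Type*} [NormedAddCommGroup EM] [NormedSpace ℝ EM] [FiniteDimensional ℝ EM]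
  {HM : Type*} [TopologicalSpace HM]
  {I : ModelWithCorners ℝ EM HM} {M : Type*} [TopologicalSpace M] [ChartedSpace HM M]
  [IsManifold I ∞ M]
  {F : Type*} [NormedAddCommGroup F] [NormedSpace ℝ F] [FiniteDimensional ℝ F]
  {V : M → Type*} [TopologicalSpace (TotalSpace F V)] [∀ x, AddCommGroup (V x)]
  [∀ x, Module ℝ (V x)] [∀ x, TopologicalSpace (V x)]
  [∀ x, IsTopologicalAddGroup (V x)] [∀ x, ContinuousSMul ℝ (V x)]
  [FiberBundle F V] [VectorBundle ℝ F V] [ContMDiffVectorBundle ∞ F V I]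

theorem sidePairing_add_left {x : M} (μ ν : Side I V x) (τ : Core I V x) :
    sidePairing (μ + ν) τ = sidePairing μ τ + sidePairing ν τ := by
  have h1 : (μ.2 + ν.2) τ.1 = μ.2 τ.1 + ν.2 τ.1 := rfl
  have h2 : τ.2 (μ.1 + ν.1) = τ.2 μ.1 + τ.2 ν.1 := map_add _ _ _
  refine (congrArg₂ (· + ·) h1 h2).trans ?_
  simp only [sidePairing]; ring

theorem sidePairing_smul_left {x : M} (r : ℝ) (ν : Side I V x) (τ : Core I V x) :
    sidePairing (r • ν) τ = r * sidePairing ν τ := by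
  have h1 : (r • ν.2) τ.1 = r * ν.2 τ.1 := rfl
  have h2 : τ.2 (r • ν.1) = r * τ.2 ν.1 := map_smul _ _ _
  refine (congrArg₂ (· + ·) h1 h2).trans ?_
  simp only [sidePairing]; ring

theorem sidePairing_add_right {x : M} (ν : Side I V x) (σ τ : Core I V x) :
    sidePairing ν (σ + τ) = sidePairing ν σ + sidePairing ν τ := by
  have h1 : ν.2 (σ.1 + τ.1) = ν.2 σ.1 + ν.2 τ.1 := map_add _ _ _
  have h2 : (σ.2 + τ.2) ν.1 = σ.2 ν.1 + τ.2 ν.1 := rfl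
  refine (congrArg₂ (· + ·) h1 h2).trans ?_
  simp only [sidePairing]; ring

theorem sidePairing_smul_right {x : M} (r : ℝ) (ν : Side I V x) (τ : Core I V x) :
    sidePairing ν (r • τ) = r * sidePairing ν τ := by
  have h1 : ν.2 (r • τ.1) = r * ν.2 τ.1 := map_smul _ _ _
  have h2 : (r • τ.2) ν.1 = r * τ.2 ν.1 := rfl
  refine (congrArg₂ (· + ·) h1 h2).trans ?_
  simp only [sidePairing]; ring

theorem sidePairing_neg_left {x : M} (ν : Side I V x) (τ : Core I V x) :
    sidePairing (-ν) τ = -sidePairing ν τ := by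
  rw [← neg_one_smul ℝ, sidePairing_smul_left, neg_one_mul]

theorem sidePairing_sub_left {x : M} (μ ν : Side I V x) (τ : Core I V x) :
    sidePairing (μ - ν) τ = sidePairing μ τ - sidePairing ν τ := by
  rw [sub_eq_add_neg, sidePairing_add_left, sidePairing_neg_left, sub_eq_add_neg]

theorem sidePairing_neg_right {x : M} (ν : Side I V x) (τ : Core I V x) :
    sidePairing ν (-τ) = -sidePairing ν τ := by
  rw [← neg_one_smul ℝ, sidePairing_smul_right, neg_one_mul]

theorem sidePairing_sub_right {x : M} (ν : Side I V x) (σ τ : Core I V x) :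
    sidePairing ν (σ - τ) = sidePairing ν σ - sidePairing ν τ := by
  rw [sub_eq_add_neg, sidePairing_add_right, sidePairing_neg_right, sub_eq_add_neg]

theorem core_ext (F : Type*) [NormedAddCommGroup F] [NormedSpace ℝ F]
    [TopologicalSpace (TotalSpace F V)] [FiberBundle F V] [VectorBundle ℝ F V] {x : M} {σ τ : Core I V x}
    (h : ∀ ν : Side I V x, sidePairing ν σ = sidePairing ν τ) : σ = τ := by
  rw [← sub_eq_zero]
  have h' : ∀ ν : Side I V x, sidePairing ν (σ - τ) = 0 := fun ν => by
    rw [sidePairing_sub_right, h, sub_self]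
  refine Prod.ext (eq_zero_of_forall_dual F fun η => ?_) (ContinuousLinearMap.ext fun v => ?_)
  · have h1 := h' (0, η)
    have h2 : (σ - τ).2 (0 : TangentSpace I x) = 0 := map_zero _
    exact (add_zero _).symm.trans ((congrArg (η (σ - τ).1 + ·) h2.symm).trans h1)
  · exact (zero_add _).symm.trans (h' (v, 0))

theorem side_ext {x : M} {μ ν : Side I V x}
    (h : ∀ τ : Core I V x, sidePairing μ τ = sidePairing ν τ) : μ = ν := by
  rw [← sub_eq_zero]
  have h' : ∀ τ : Core I V x, sidePairing (μ - ν) τ = 0 := fun τ => by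
    rw [sidePairing_sub_left, h, sub_self]
  refine Prod.ext ?_ (ContinuousLinearMap.ext fun v => ?_)
  · refine SeparatingDual.eq_zero_of_forall_dual_eq_zero (R := ℝ) (V := EM) (x := (μ - ν).1)
      fun g => ?_
    have h1 := h' ((0 : V x), g)
    have h2 : (μ - ν).2 (0 : V x) = 0 := map_zero _
    exact (zero_add _).symm.trans ((congrArg (· + (g (μ - ν).1 : ℝ)) h2.symm).trans h1)
  · exact (add_zero _).symm.trans (h' (v, 0))

/-- Every linear functional on a fibre of `TM ⊕ V*` is the pairing with an element of the core. -/
theorem exists_core (F : Type*) [NormedAddCommGroup F] [NormedSpace ℝ F] [FiniteDimensional ℝ F]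
    [TopologicalSpace (TotalSpace F V)] [FiberBundle F V] [VectorBundle ℝ F V] {x : M}
    (φ : Side I V x →ₗ[ℝ] ℝ) : ∃ τ : Core I V x, ∀ ν, sidePairing ν τ = φ ν := by
  set t := trivializationAt F V x
  have hx : x ∈ t.baseSet := FiberBundle.mem_baseSet_trivializationAt' x
  let φ₁ : EM →ₗ[ℝ] ℝ := φ.comp (LinearMap.inl ℝ (TangentSpace I x) (DualFibre V x))
  -- The part of φ on V* becomes an element of the double dual of F, which finite dimension
  -- identifies with F.
  let φ₂ : Module.Dual ℝ (Module.Dual ℝ F) :=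
    { toFun := fun g => φ ((0 : TangentSpace I x),
        (LinearMap.toContinuousLinearMap g).comp (t.continuousLinearMapAt ℝ x))
      map_add' := fun g g' => by
        rw [← map_add]
        refine congrArg φ (Prod.ext (add_zero _).symm (ContinuousLinearMap.ext fun v => ?_))
        rfl
      map_smul' := fun r g => by
        refine Eq.trans (congrArg φ ?_) (map_smul φ r _)
        exact Prod.ext (smul_zero _).symm (ContinuousLinearMap.ext fun v => rfl) }
  obtain ⟨f, hf⟩ := (Module.evalEquiv ℝ F).surjective φ₂
  refine ⟨(t.symmL ℝ x f, (LinearMap.toContinuousLinearMap φ₁ : EM →L[ℝ] ℝ)), fun ν => ?_⟩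
  have h1 : ν.2 (t.symmL ℝ x f) = φ ((0 : TangentSpace I x), ν.2) := by
    have h2 := LinearMap.congr_fun hf (((ν.2).comp (t.symmL ℝ x)) : F →ₗ[ℝ] ℝ)
    refine Eq.trans h2 (congrArg φ (Prod.ext rfl (ContinuousLinearMap.ext fun v => ?_)))
    exact congrArg ν.2 (t.symmL_continuousLinearMapAt (R := ℝ) hx v)
  refine (congrArg₂ (· + ·) h1 (rfl : _ = φ (ν.1, (0 : DualFibre V x)))).trans ?_
  rw [← map_add]
  exact congrArg φ (Prod.ext (zero_add _) (add_zero _))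

theorem contMDiff_sidePairing (ν : SideSection I (F := F) (V := V))
    (τ : Cₛ^∞⟮I; F × (EM →L[ℝ] ℝ), Core I V⟯) :
    ContMDiff I 𝓘(ℝ, ℝ) ∞ (fun x => sidePairing (ν x) (τ x)) := by
  have h1 : ContMDiff I 𝓘(ℝ, ℝ) ∞ (fun x => (ν x).2 (τ x).1) := fun x => by
    have h := ContMDiff.clm_bundle_apply (F₂ := ℝ) (E₂ := fun _ : M => ℝ)
      (sndSection ν).contMDiff (fstSection τ).contMDiff x
    rw [Bundle.contMDiffAt_section] at h
    exact h
  exact h1.add (contMDiff_form_apply (sndSection τ) (fstSection ν))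

variable [T2Space M]

/-- A section of the core is smooth if its pairings with the smooth sections of the side are. -/
theorem contMDiff_core_of_sidePairing (τ : ∀ x, Core I V x)
    (h : ∀ ν : SideSection I (F := F) (V := V), ContMDiff I 𝓘(ℝ, ℝ) ∞
      (fun x => sidePairing (ν x) (τ x))) :
    ContMDiff I (I.prod 𝓘(ℝ, F × (EM →L[ℝ] ℝ))) ∞
      (fun x => TotalSpace.mk' (F × (EM →L[ℝ] ℝ)) (E := Core I V) x (τ x)) := by
  have h1 : ContMDiff I (I.prod 𝓘(ℝ, F)) ∞ (fun x => TotalSpace.mk' F x (τ x).1) := fun x₀ => by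
    refine contMDiffAt_of_dual_apply _ _ fun η => ?_
    refine (h (pairSection (0 : VectorFields I M) η) x₀).congr_of_eventuallyEq
      (Filter.Eventually.of_forall fun x => ?_)
    have h2 : (τ x).2 (0 : TangentSpace I x) = 0 := map_zero _
    exact (add_zero _).symm.trans (congrArg (η x (τ x).1 + ·) h2.symm)
  have h2 : ContMDiff I (I.prod 𝓘(ℝ, EM →L[ℝ] ℝ)) ∞
      (fun x => TotalSpace.mk' (EM →L[ℝ] ℝ) (E := fun x => Cotangent I x) x (τ x).2) := fun x₀ => by
    refine contMDiffAt_hom_of_sections (W₂ := fun _ : M => ℝ) (fun x => (τ x).2) x₀ Set.univ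
      (fun X _ => ?_) fun w => (exists_section I EM w).imp fun s hs => ⟨trivial, hs⟩
    rw [Bundle.contMDiffAt_section]
    refine (h (pairSection X (0 : Cₛ^∞⟮I; F →L[ℝ] ℝ, fun x => DualFibre V x⟯)) x₀).congr_of_eventuallyEq
      (Filter.Eventually.of_forall fun x => ?_)
    exact (zero_add _).symm
  exact (pairSection ⟨_, h1⟩ ⟨_, h2⟩).contMDiff

theorem exists_section_eq_core {x : M} (τ : Core I V x) :
    ∃ s : Cₛ^∞⟮I; F × (EM →L[ℝ] ℝ), Core I V⟯, s x = τ :=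
  exists_section I (F × (EM →L[ℝ] ℝ)) (W := Core I V) τ

theorem exists_section_eq_side {x : M} (ν : Side I V x) :
    ∃ s : SideSection I (F := F) (V := V), s x = ν :=
  exists_section I (EM × (F →L[ℝ] ℝ)) (W := Side I V) ν

theorem sideMap_coreLift (p : TotalSpace F V) (τ : Core I V p.proj) :
    sideMap I p (coreLift I p τ) = 0 := by
  refine Prod.ext (dProj_vertical p τ.1) (ContinuousLinearMap.ext fun w => ?_)
  exact (congrArg τ.2 (dProj_vertical p w)).trans (map_zero τ.2)

theorem sideMap_add (p : TotalSpace F V) (ξ η : GenTangentTotal I F V p) :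
    sideMap I p (ξ + η) = sideMap I p ξ + sideMap I p η :=
  Prod.ext (map_add (dProj I p) ξ.1 η.1) rfl

theorem sideMap_smul (p : TotalSpace F V) (r : ℝ) (ξ : GenTangentTotal I F V p) :
    sideMap I p (r • ξ) = r • sideMap I p ξ :=
  Prod.ext (map_smul (dProj I p) r ξ.1) rfl

theorem sideMap_sub (p : TotalSpace F V) (ξ η : GenTangentTotal I F V p) :
    sideMap I p (ξ - η) = sideMap I p ξ - sideMap I p η :=
  Prod.ext (map_sub (dProj I p) ξ.1 η.1) rfl

theorem coreLift_add (p : TotalSpace F V) (σ τ : Core I V p.proj) :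
    coreLift I p (σ + τ) = coreLift I p σ + coreLift I p τ :=
  Prod.ext (map_add (verticalLift I p) σ.1 τ.1) rfl

theorem coreLift_smul (p : TotalSpace F V) (r : ℝ) (τ : Core I V p.proj) :
    coreLift I p (r • τ) = r • coreLift I p τ :=
  Prod.ext (map_smul (verticalLift I p) r τ.1) rfl

theorem coreLift_neg (p : TotalSpace F V) (τ : Core I V p.proj) :
    coreLift I p (-τ) = -coreLift I p τ :=
  Prod.ext (map_neg (verticalLift I p) τ.1) rfl

/-- A core element therefore sees only the side of ξ. In particular the core is isotropic. -/
theorem genPairing_coreLift (p : TotalSpace F V) (ξ : GenTangentTotal I F V p)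
    (τ : Core I V p.proj) :
    genPairing (I.prod 𝓘(ℝ, F)) ξ (coreLift I p τ) = sidePairing (sideMap I p ξ) τ := rfl

/-- The tangent part is vertical, and a covector vanishing on vertical vectors factors through Tq;
composing it with a right inverse of Tq recovers the factor. -/
theorem exists_coreLift_of_sideMap_eq_zero {p : TotalSpace F V} {ξ : GenTangentTotal I F V p}
    (h : sideMap I p ξ = 0) : ∃ τ, coreLift I p τ = ξ := by
  obtain ⟨c, hc⟩ := exists_vertical_of_dProj_eq_zero (congrArg Prod.fst h : dProj I p ξ.1 = 0)
  refine ⟨(c, ξ.2.comp (dProjSection p)), Prod.ext hc (ContinuousLinearMap.ext fun w => ?_)⟩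
  obtain ⟨d, hd⟩ := exists_vertical_of_dProj_eq_zero (w := w - dProjSection p (dProj I p w)) (by
    rw [map_sub, dProj_dProjSection, sub_self])
  have h1 : ξ.2 (verticalLift I p d) = 0 :=
    congrArg (fun A : DualFibre V p.proj => A d) (congrArg Prod.snd h)
  rw [hd, map_sub, sub_eq_zero] at h1
  exact h1.symm

/-- Every ν is the side of some ξ at p, so the pairing of side and core can be computed in TE ⊕ T*E.
-/
theorem coreLift_injective (p : TotalSpace F V) {σ τ : Core I V p.proj}
    (h : coreLift I p σ = coreLift I p τ) : σ = τ := by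
  refine core_ext F fun ν => ?_
  let θ : EM × F →L[ℝ] ℝ := (ν.2.comp ((trivializationAt F V p.proj).symmL ℝ p.proj)).comp
    (ContinuousLinearMap.snd ℝ EM F)
  let ξ : GenTangentTotal I F V p := (dProjSection p ν.1, θ)
  have hξ : sideMap I p ξ = ν := by
    refine Prod.ext (dProj_dProjSection p ν.1) (ContinuousLinearMap.ext fun w => ?_)
    refine Eq.trans (congrArg θ (vertical_eq I p w)) (congrArg ν.2 ?_)
    exact (trivializationAt F V p.proj).symmL_continuousLinearMapAt (R := ℝ)
      (FiberBundle.mem_baseSet_trivializationAt' p.proj) w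
  rw [← hξ, ← genPairing_coreLift, ← genPairing_coreLift, h]

end CoreAndSide
-- Bilinear brackets on the sections of the side.
section SideSections

variable {EM : Type*} [NormedAddCommGroup EM] [NormedSpace ℝ EM] [FiniteDimensional ℝ EM]
  {HM : Type*} [TopologicalSpace HM]
  {I : ModelWithCorners ℝ EM HM} {M : Type*} [TopologicalSpace M] [ChartedSpace HM M]
  [IsManifold I ∞ M]
  {F : Type*} [NormedAddCommGroup F] [NormedSpace ℝ F] [FiniteDimensional ℝ F]
  {V : M → Type*} [TopologicalSpace (TotalSpace F V)] [∀ x, AddCommGroup (V x)]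
  [∀ x, Module ℝ (V x)] [∀ x, TopologicalSpace (V x)]
  [∀ x, IsTopologicalAddGroup (V x)] [∀ x, ContinuousSMul ℝ (V x)]
  [FiberBundle F V] [VectorBundle ℝ F V] [ContMDiffVectorBundle ∞ F V I]

namespace Shortcuts

scoped instance : VectorBundle ℝ (EM × (F →L[ℝ] ℝ)) (Side I V) := inferInstance
scoped instance : VectorBundle ℝ (F × (EM →L[ℝ] ℝ)) (Core I V) := inferInstance
scoped instance : AddCommGroup (SideSection I (V := V) (F := F)) := inferInstance
scoped instance : AddCommMonoid (SideSection I (V := V) (F := F)) := inferInstance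
scoped instance : Module ℝ (SideSection I (V := V) (F := F)) := inferInstance
scoped instance : MulAction ℝ (SideSection I (V := V) (F := F)) := inferInstance
scoped instance : SMul ℝ (SideSection I (V := V) (F := F)) := inferInstance
scoped instance : AddCommGroup (Cₛ^∞⟮I; F × (EM →L[ℝ] ℝ), Core I V⟯) := inferInstance
scoped instance : AddCommMonoid (Cₛ^∞⟮I; F × (EM →L[ℝ] ℝ), Core I V⟯) := inferInstance
scoped instance : Module ℝ (Cₛ^∞⟮I; F × (EM →L[ℝ] ℝ), Core I V⟯) := inferInstance
scoped instance : MulAction ℝ (Cₛ^∞⟮I; F × (EM →L[ℝ] ℝ), Core I V⟯) := inferInstance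
scoped instance : SMul ℝ (Cₛ^∞⟮I; F × (EM →L[ℝ] ℝ), Core I V⟯) := inferInstance
scoped instance : AddCommMonoid (SideSection I (V := V) (F := F) →ₗ[ℝ] SideSection I (V := V) (F := F)) :=
  inferInstance
scoped instance : Module ℝ (SideSection I (V := V) (F := F) →ₗ[ℝ] SideSection I (V := V) (F := F)) :=
  inferInstance

end Shortcuts


theorem bracket_add_left (D : SideSection I (V := V) (F := F) →ₗ[ℝ]
    SideSection I (V := V) (F := F) →ₗ[ℝ] SideSection I (V := V) (F := F))
    (μ ν κ : SideSection I (V := V) (F := F)) : D (μ + ν) κ = D μ κ + D ν κ :=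
  LinearMap.congr_fun (D.map_add μ ν) κ

theorem bracket_smul_left (D : SideSection I (V := V) (F := F) →ₗ[ℝ]
    SideSection I (V := V) (F := F) →ₗ[ℝ] SideSection I (V := V) (F := F))
    (r : ℝ) (ν κ : SideSection I (V := V) (F := F)) : D (r • ν) κ = r • D ν κ :=
  LinearMap.congr_fun (D.map_smul r ν) κ

end SideSections

/-! ### Prescribed differentials, and the one-sided Leibniz rules of a dull bracket. -/

section DualSmooth

variable {EM : Type*} [NormedAddCommGroup EM] [NormedSpace ℝ EM] [FiniteDimensional ℝ EM]
  {HM : Type*} [TopologicalSpace HM]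
  {I : ModelWithCorners ℝ EM HM} {M : Type*} [TopologicalSpace M] [ChartedSpace HM M]
  [IsManifold I ∞ M]

/-- Every covector is the differential of a smooth function. -/
theorem exists_dReal_eq [T2Space M] {x : M} (φ : Cotangent I x) :
    ∃ f : C^∞⟮I, M; ℝ⟯, dReal I f x = φ := by
  let ψ : SmoothBumpFunction I x := Classical.choice inferInstance
  let φ' : EM →L[ℝ] ℝ := φ
  have hg : ContMDiffOn I 𝓘(ℝ, ℝ) ∞ (fun y => φ' (extChartAt I x y)) (chartAt HM x).source :=
    φ'.contDiff.contMDiff.comp_contMDiffOn (contMDiffOn_extChartAt (x := x))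
  refine ⟨⟨fun y => ψ y • φ' (extChartAt I x y), ψ.contMDiff_smul hg⟩, ?_⟩
  have h1 : (fun y => ψ y • φ' (extChartAt I x y)) =ᶠ[nhds x] fun y => φ' (extChartAt I x y) := by
    filter_upwards [ψ.eventuallyEq_one] with y hy
    rw [hy]
    exact one_smul ℝ _
  refine (h1.mfderiv_eq).trans ?_
  have h2 := mfderiv_comp x (I' := 𝓘(ℝ, EM)) (I'' := 𝓘(ℝ, ℝ)) (g := φ') (f := extChartAt I x)
    φ'.mdifferentiableAt (mdifferentiableAt_extChartAt (mem_chart_source HM x))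
  refine Eq.trans h2 ?_
  refine ContinuousLinearMap.ext fun v => ?_
  have h3 := congrArg (fun A : EM →L[ℝ] EM => A v) (mfderiv_extChartAt_self (I := I) (x := x))
  refine Eq.trans (congrArg (mfderiv 𝓘(ℝ, EM) 𝓘(ℝ, ℝ) φ' (extChartAt I x x) : EM →L[ℝ] ℝ) h3) ?_
  rw [mfderiv_eq_fderiv]
  exact congrArg (fun A : EM →L[ℝ] ℝ => A v) φ'.fderiv

variable
  {G : Type*} [NormedAddCommGroup G] [NormedSpace ℝ G]
  {W : M → Type*} [TopologicalSpace (TotalSpace G W)] [∀ x, AddCommGroup (W x)]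
  [∀ x, Module ℝ (W x)] [∀ x, TopologicalSpace (W x)] [FiberBundle G W] [VectorBundle ℝ G W]
  {ρ : BundleHom I G W EM (fun x : M => TangentSpace I x)}
  {D : Cₛ^∞⟮I; G, W⟯ →ₗ[ℝ] Cₛ^∞⟮I; G, W⟯ →ₗ[ℝ] Cₛ^∞⟮I; G, W⟯}

theorem one_smulSection (s : Cₛ^∞⟮I; G, W⟯) : smulSection (1 : C^∞⟮I, M; ℝ⟯) s = s := by
  ext x
  exact one_smul ℝ (s x)

theorem dReal_one (x : M) (v : TangentSpace I x) : dReal I (1 : C^∞⟮I, M; ℝ⟯) x v = 0 :=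
  dReal_const 1 x v

theorem IsDullBracket.smul_left (hD : IsDullBracket ρ D) (f : C^∞⟮I, M; ℝ⟯) (s t : Cₛ^∞⟮I; G, W⟯)
    (x : M) : D (smulSection f s) t x = f x • D s t x - dReal I f x (ρ x (t x)) • s x := by
  have h := hD.leibniz f 1 s t x
  rw [one_smulSection, dReal_one] at h
  simpa using h

theorem IsDullBracket.smul_right (hD : IsDullBracket ρ D) (f : C^∞⟮I, M; ℝ⟯) (s t : Cₛ^∞⟮I; G, W⟯)
    (x : M) : D s (smulSection f t) x = f x • D s t x + dReal I f x (ρ x (s x)) • t x := by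
  have h := hD.leibniz 1 f s t x
  rw [one_smulSection, dReal_one] at h
  simpa using h

end DualSmooth

/-! ### The Dorfman connection dual to a dull bracket. -/

section Dorfman

variable {EM : Type*} [NormedAddCommGroup EM] [NormedSpace ℝ EM] [FiniteDimensional ℝ EM]
  {HM : Type*} [TopologicalSpace HM]
  {I : ModelWithCorners ℝ EM HM} {M : Type*} [TopologicalSpace M] [ChartedSpace HM M]
  [IsManifold I ∞ M]
  {F : Type*} [NormedAddCommGroup F] [NormedSpace ℝ F] [FiniteDimensional ℝ F]
  {V : M → Type*} [TopologicalSpace (TotalSpace F V)] [∀ x, AddCommGroup (V x)]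
  [∀ x, Module ℝ (V x)] [∀ x, TopologicalSpace (V x)]
  [∀ x, IsTopologicalAddGroup (V x)] [∀ x, ContinuousSMul ℝ (V x)]
  [FiberBundle F V] [VectorBundle ℝ F V] [ContMDiffVectorBundle ∞ F V I]
variable [T2Space M]
  {D : SideSection I (V := V) (F := F) →ₗ[ℝ] SideSection I (V := V) (F := F) →ₗ[ℝ]
    SideSection I (V := V) (F := F)}

/-- The functional dual to a dull bracket. -/
def dorfmanFunctional (D : SideSection I (V := V) (F := F) →ₗ[ℝ]
    SideSection I (V := V) (F := F) →ₗ[ℝ] SideSection I (V := V) (F := F))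
    (ν : SideSection I (V := V) (F := F)) (τ : Cₛ^∞⟮I; F × (EM →L[ℝ] ℝ), Core I V⟯) (x : M) :
    SideSection I (V := V) (F := F) →ₗ[ℝ] ℝ where
  toFun μ := dReal I (fun y => sidePairing (μ y) (τ y)) x (ν x).1 - sidePairing (D ν μ x) (τ x)
  map_add' μ μ' := by
    have h : (fun y => sidePairing ((μ + μ') y) (τ y)) =
        fun y => sidePairing (μ y) (τ y) + sidePairing (μ' y) (τ y) :=
      funext fun y => sidePairing_add_left _ _ _
    rw [h, dReal_add (contMDiff_sidePairing μ τ) (contMDiff_sidePairing μ' τ), map_add]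
    refine Eq.trans (congrArg (_ - ·) (sidePairing_add_left (D ν μ x) (D ν μ' x) (τ x))) ?_
    ring
  map_smul' r μ := by
    have h : (fun y => sidePairing ((r • μ) y) (τ y)) =
        fun y => (fun _ => r) y * sidePairing (μ y) (τ y) :=
      funext fun y => sidePairing_smul_left _ _ _
    rw [h, dReal_mul contMDiff_const (contMDiff_sidePairing μ τ), dReal_const, map_smul]
    refine Eq.trans (congrArg (_ - ·) (sidePairing_smul_left r (D ν μ x) (τ x))) ?_
    simp only [RingHom.id_apply, smul_eq_mul]
    ring

theorem dorfmanFunctional_apply (ν μ : SideSection I (V := V) (F := F))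
    (τ : Cₛ^∞⟮I; F × (EM →L[ℝ] ℝ), Core I V⟯) (x : M) : dorfmanFunctional D ν τ x μ =
      dReal I (fun y => sidePairing (μ y) (τ y)) x (ν x).1 - sidePairing (D ν μ x) (τ x) := rfl

/-- The term X(f)⟨μ, τ⟩ arises both from the derivative of f⟨μ, τ⟩ and from the Leibniz rule of D,
and cancels. Hence the functional is tensorial in μ. -/
theorem dorfmanFunctional_smul (hD : IsDullBracket (prTM I V) D)
    (ν : SideSection I (V := V) (F := F)) (τ : Cₛ^∞⟮I; F × (EM →L[ℝ] ℝ), Core I V⟯) (x : M)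
    (f : C^∞⟮I, M; ℝ⟯) (μ : SideSection I (V := V) (F := F)) :
    dorfmanFunctional D ν τ x (smulSection f μ) = f x • dorfmanFunctional D ν τ x μ := by
  have h : (fun y => sidePairing (smulSection f μ y) (τ y)) =
      fun y => f y * sidePairing (μ y) (τ y) := funext fun y => sidePairing_smul_left _ _ _
  have h2 : sidePairing (D ν (smulSection f μ) x) (τ x) =
      f x * sidePairing (D ν μ x) (τ x) + dReal I f x (ν x).1 * sidePairing (μ x) (τ x) := by
    rw [hD.smul_right, sidePairing_add_left, sidePairing_smul_left, sidePairing_smul_left]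
    rfl
  rw [dorfmanFunctional_apply, dorfmanFunctional_apply, h2, h,
    dReal_mul f.contMDiff (contMDiff_sidePairing μ τ), smul_eq_mul]
  ring

/-- By tensoriality the functional lives on the fibre at each point, where it is represented by a
core element. The resulting section is smooth because its pairings with smooth sections are. -/
theorem exists_dorfman (hD : IsDullBracket (prTM I V) D)
    (ν : SideSection I (V := V) (F := F)) (τ : Cₛ^∞⟮I; F × (EM →L[ℝ] ℝ), Core I V⟯) :
    ∃ δ : Cₛ^∞⟮I; F × (EM →L[ℝ] ℝ), Core I V⟯, ∀ μ x,
      sidePairing (μ x) (δ x) = dorfmanFunctional D ν τ x μ := by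
  choose δ hδ using fun x => exists_core F ((dorfmanFunctional D ν τ x).comp
    (extendSection I (EM × (F →L[ℝ] ℝ)) (W := Side I V) x))
  have h : ∀ (μ : SideSection I (V := V) (F := F)) x,
      sidePairing (μ x) (δ x) = dorfmanFunctional D ν τ x μ := fun μ x =>
    (hδ x (μ x)).trans (tensorial_congr _ (dorfmanFunctional_smul hD ν τ x)
      (extendSection_self (G := EM × (F →L[ℝ] ℝ)) (W := Side I V) x (μ x)))
  refine ⟨⟨δ, contMDiff_core_of_sidePairing δ fun μ => ?_⟩, h⟩
  simp only [h, dorfmanFunctional_apply]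
  exact (contMDiff_dReal_apply (contMDiff_sidePairing μ τ) (fstSection ν)).sub
    (contMDiff_sidePairing (D ν μ) τ)

/-- Equality of core sections is tested by pairing with side sections. -/
theorem core_ext_of_sections {x : M} {σ τ : Core I V x}
    (h : ∀ μ : SideSection I (V := V) (F := F), sidePairing (μ x) σ = sidePairing (μ x) τ) :
    σ = τ := core_ext F fun ν => by
  obtain ⟨μ, rfl⟩ := exists_section_eq_side (F := F) ν
  exact h μ

section DorfmanFunctional

variable (ν ν' μ : SideSection I (V := V) (F := F))
  (τ τ' : Cₛ^∞⟮I; F × (EM →L[ℝ] ℝ), Core I V⟯) (x : M)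

theorem dorfmanFunctional_add_left : dorfmanFunctional D (ν + ν') τ x μ =
    dorfmanFunctional D ν τ x μ + dorfmanFunctional D ν' τ x μ := by
  rw [dorfmanFunctional_apply, dorfmanFunctional_apply, dorfmanFunctional_apply,
    bracket_add_left]
  have h1 : dReal I (fun y => sidePairing (μ y) (τ y)) x ((ν + ν') x).1 =
    dReal I (fun y => sidePairing (μ y) (τ y)) x (ν x).1 +
    dReal I (fun y => sidePairing (μ y) (τ y)) x (ν' x).1 := map_add _ _ _
  refine Eq.trans (congrArg₂ (· - ·) h1 (sidePairing_add_left (D ν μ x) (D ν' μ x) (τ x))) ?_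
  ring

theorem dorfmanFunctional_smul_left (r : ℝ) : dorfmanFunctional D (r • ν) τ x μ =
    r * dorfmanFunctional D ν τ x μ := by
  rw [dorfmanFunctional_apply, dorfmanFunctional_apply, bracket_smul_left]
  have h1 : dReal I (fun y => sidePairing (μ y) (τ y)) x ((r • ν) x).1 =
    r * dReal I (fun y => sidePairing (μ y) (τ y)) x (ν x).1 := map_smul _ _ _
  refine Eq.trans (congrArg₂ (· - ·) h1 (sidePairing_smul_left r (D ν μ x) (τ x))) ?_
  ring

theorem dorfmanFunctional_add_right : dorfmanFunctional D ν (τ + τ') x μ =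
    dorfmanFunctional D ν τ x μ + dorfmanFunctional D ν τ' x μ := by
  rw [dorfmanFunctional_apply, dorfmanFunctional_apply, dorfmanFunctional_apply]
  have h : (fun y => sidePairing (μ y) ((τ + τ') y)) =
      fun y => sidePairing (μ y) (τ y) + sidePairing (μ y) (τ' y) :=
    funext fun y => sidePairing_add_right _ _ _
  rw [h, dReal_add (contMDiff_sidePairing μ τ) (contMDiff_sidePairing μ τ')]
  refine Eq.trans (congrArg (_ - ·) (sidePairing_add_right (D ν μ x) (τ x) (τ' x))) ?_
  ring

theorem dorfmanFunctional_smulSection_right (f : C^∞⟮I, M; ℝ⟯) :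
    dorfmanFunctional D ν (smulSection f τ) x μ =
    f x * dorfmanFunctional D ν τ x μ + dReal I f x (ν x).1 * sidePairing (μ x) (τ x) := by
  rw [dorfmanFunctional_apply, dorfmanFunctional_apply]
  have h : (fun y => sidePairing (μ y) (smulSection f τ y)) =
      fun y => f y * sidePairing (μ y) (τ y) := funext fun y => sidePairing_smul_right _ _ _
  rw [h, dReal_mul f.contMDiff (contMDiff_sidePairing μ τ)]
  refine Eq.trans (congrArg (_ - ·) (sidePairing_smul_right (f x) (D ν μ x) (τ x))) ?_
  ring

theorem dorfmanFunctional_smul_right (r : ℝ) : dorfmanFunctional D ν (r • τ) x μ =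
    r * dorfmanFunctional D ν τ x μ := by
  refine (dorfmanFunctional_smulSection_right ν μ τ x (⟨fun _ => r, contMDiff_const⟩)).trans ?_
  refine (congrArg (fun c => r * dorfmanFunctional D ν τ x μ + c * sidePairing (μ x) (τ x))
    (dReal_const r x _)).trans ?_
  rw [zero_mul, add_zero]

/-- The Leibniz rule in the first argument of D produces the extra term ⟨ν, τ⟩ df of a Dorfman
connection. -/
theorem dorfmanFunctional_smulSection_left (hD : IsDullBracket (prTM I V) D)
    (f : C^∞⟮I, M; ℝ⟯) : dorfmanFunctional D (smulSection f ν) τ x μ =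
    f x * dorfmanFunctional D ν τ x μ + sidePairing (ν x) (τ x) * dReal I f x (μ x).1 := by
  rw [dorfmanFunctional_apply, dorfmanFunctional_apply]
  have h1 : dReal I (fun y => sidePairing (μ y) (τ y)) x (smulSection f ν x).1 =
    f x * dReal I (fun y => sidePairing (μ y) (τ y)) x (ν x).1 := map_smul _ _ _
  have h2 : sidePairing (D (smulSection f ν) μ x) (τ x) =
      f x * sidePairing (D ν μ x) (τ x) - dReal I f x (μ x).1 * sidePairing (ν x) (τ x) := by
    rw [hD.smul_left, sidePairing_sub_left, sidePairing_smul_left, sidePairing_smul_left]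
    rfl
  rw [h1, h2]
  ring

end DorfmanFunctional

theorem sidePairing_dReal (f : M → ℝ) (x : M) (ν : Side I V x) :
    sidePairing ν ((0, dReal I f x) : Core I V x) = dReal I f x ν.1 :=
  (congrArg (· + dReal I f x ν.1) (map_zero ν.2)).trans (zero_add _)

/-- Since D lifts the Lie bracket, this is X(Y f) - [X, Y] f = Y(X f), for X and Y the vector fields
of ν and μ. -/
theorem dorfmanFunctional_exact [I.Boundaryless] (hD : IsDullBracket (prTM I V) D)
    (f : C^∞⟮I, M; ℝ⟯) (ν μ : SideSection I (V := V) (F := F))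
    (τ : Cₛ^∞⟮I; F × (EM →L[ℝ] ℝ), Core I V⟯) (hτ : ∀ x, τ x = (0, dReal I f x)) (x : M) :
    dorfmanFunctional D ν τ x μ = dReal I (fun y => dReal I f y (ν y).1) x (μ x).1 := by
  have : CompleteSpace EM := FiniteDimensional.complete ℝ EM
  rw [dorfmanFunctional_apply]
  simp only [hτ, sidePairing_dReal]
  have h4 : (D ν μ x).1 = mlieBracket I (fstSection ν) (fstSection μ) x :=
    hD.anchor_bracket ν μ x
  have h5 := dReal_bracket f.contMDiff (fstSection ν) (fstSection μ) x
  rw [← h4] at h5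
  refine (congrArg (_ - ·) h5).trans ?_
  exact sub_sub_cancel _ _

/-- The core section is determined by its pairings, so it inherits bilinearity from the functional.
-/
theorem exists_dorfmanMap (hD : IsDullBracket (prTM I V) D) :
    ∃ δ : SideSection I (F := F) (V := V) →ₗ[ℝ] Cₛ^∞⟮I; F × (EM →L[ℝ] ℝ), Core I V⟯ →ₗ[ℝ]
      Cₛ^∞⟮I; F × (EM →L[ℝ] ℝ), Core I V⟯, ∀ ν τ μ x,
      sidePairing (μ x) (δ ν τ x) = dorfmanFunctional D ν τ x μ := by
  choose δ hδ using fun (ν : SideSection I (V := V) (F := F))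
    (τ : Cₛ^∞⟮I; F × (EM →L[ℝ] ℝ), Core I V⟯) => exists_dorfman hD ν τ
  refine ⟨LinearMap.mk₂ ℝ δ (fun ν ν' τ => ?_) (fun r ν τ => ?_) (fun ν τ τ' => ?_)
    (fun r ν τ => ?_), fun ν τ μ x => hδ ν τ μ x⟩
  · refine ContMDiffSection.ext fun x => core_ext_of_sections (F := F) fun μ => ?_
    refine Eq.trans ?_ (sidePairing_add_right (μ x) (δ ν τ x) (δ ν' τ x)).symm
    rw [hδ, hδ, hδ, dorfmanFunctional_add_left]
  · refine ContMDiffSection.ext fun x => core_ext_of_sections (F := F) fun μ => ?_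
    refine Eq.trans ?_ (sidePairing_smul_right r (μ x) (δ ν τ x)).symm
    rw [hδ, hδ, dorfmanFunctional_smul_left]
  · refine ContMDiffSection.ext fun x => core_ext_of_sections (F := F) fun μ => ?_
    refine Eq.trans ?_ (sidePairing_add_right (μ x) (δ ν τ x) (δ ν τ' x)).symm
    rw [hδ, hδ, hδ, dorfmanFunctional_add_right]
  · refine ContMDiffSection.ext fun x => core_ext_of_sections (F := F) fun μ => ?_
    refine Eq.trans ?_ (sidePairing_smul_right r (μ x) (δ ν τ x)).symm
    rw [hδ, hδ, dorfmanFunctional_smul_right]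

/-- Every dull bracket is dual to a Dorfman connection. -/
theorem exists_isDual [I.Boundaryless] (hD : IsDullBracket (prTM I V) D) :
    ∃ Δ : DorfmanConnection I F V, IsDual Δ D := by
  obtain ⟨δ, hδ⟩ := exists_dorfmanMap hD
  refine ⟨⟨δ, fun f ν τ x => ?_, fun f ν τ x => ?_, fun f ν τ hτ x => ?_⟩, fun ν μ τ x => ?_⟩
  · refine core_ext_of_sections (F := F) fun μ => ?_
    rw [sidePairing_add_right, sidePairing_smul_right, sidePairing_smul_right, hδ, hδ,
      dorfmanFunctional_smulSection_right]
  · refine core_ext_of_sections (F := F) fun μ => ?_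
    rw [sidePairing_add_right, sidePairing_smul_right, sidePairing_smul_right, sidePairing_dReal,
      hδ, hδ, dorfmanFunctional_smulSection_left _ _ _ _ hD]
  · refine core_ext_of_sections (F := F) fun μ => ?_
    rw [sidePairing_dReal, hδ, dorfmanFunctional_exact hD f ν μ τ hτ x]
  · refine Eq.trans ?_ (congrArg (sidePairing (D ν μ x) (τ x) + ·) (hδ ν τ μ x)).symm
    rw [dorfmanFunctional_apply]
    ring

end Dorfman

/-! ### Horizontal lifts and core sections as smooth sections of TE ⊕ T*E. -/

section Lifts

variable {EM : Type*} [NormedAddCommGroup EM] [NormedSpace ℝ EM] [FiniteDimensional ℝ EM]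
  {HM : Type*} [TopologicalSpace HM]
  {I : ModelWithCorners ℝ EM HM} {M : Type*} [TopologicalSpace M] [ChartedSpace HM M]
  [IsManifold I ∞ M]
  {F : Type*} [NormedAddCommGroup F] [NormedSpace ℝ F] [FiniteDimensional ℝ F]
  {V : M → Type*} [TopologicalSpace (TotalSpace F V)] [∀ x, AddCommGroup (V x)]
  [∀ x, Module ℝ (V x)] [∀ x, TopologicalSpace (V x)]
  [∀ x, IsTopologicalAddGroup (V x)] [∀ x, ContinuousSMul ℝ (V x)]
  [FiberBundle F V] [VectorBundle ℝ F V] [ContMDiffVectorBundle ∞ F V I]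
variable [T2Space M]
  {D : SideSection I (V := V) (F := F) →ₗ[ℝ] SideSection I (V := V) (F := F) →ₗ[ℝ]
    SideSection I (V := V) (F := F)}

/-- The characterisation of the value at `p` of the horizontal lift of `ν` defined by `D`. -/
def IsLift (D : SideSection I (V := V) (F := F) →ₗ[ℝ] SideSection I (V := V) (F := F) →ₗ[ℝ]
    SideSection I (V := V) (F := F)) (ν : SideSection I (V := V) (F := F)) (p : TotalSpace F V)
    (ξ : GenTangentTotal I F V p) : Prop :=
  dProj I p ξ.1 = (ν p.proj).1 ∧ ∀ (μ : SideSection I (V := V) (F := F)) (w : TangentTotal I F V p),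
    dProj I p w = (μ p.proj).1 → ξ.2 w = dReal (I.prod 𝓘(ℝ, F)) (linFun ν) p w -
      dReal (I.prod 𝓘(ℝ, F)) (linFun μ) p ξ.1 + linFun (D ν μ) p

theorem contMDiff_section_total (e : Cₛ^∞⟮I; F, V⟯) :
    ContMDiff I (I.prod 𝓘(ℝ, F)) ∞ (fun y => (⟨y, e y⟩ : TotalSpace F V)) := e.contMDiff

/-- Evaluating Δ(e, 0) on μ and replacing it by D through duality turns the definition of the lift
into a formula without Δ and e. The lift thus depends on D and the point only. -/
theorem isLift_horizontalLift {Δ : DorfmanConnection I F V} (h : IsDual Δ D)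
    (ν : SideSection I (V := V) (F := F)) (e : Cₛ^∞⟮I; F, V⟯) (x : M) :
    IsLift D ν ⟨x, e x⟩ (horizontalLift Δ ν e x) := by
  set δ := Δ.toFun ν (inlSection e) x with hδ
  set T : TangentTotal I F V ⟨x, e x⟩ :=
    mfderiv I (I.prod 𝓘(ℝ, F)) (fun y => (⟨y, e y⟩ : TotalSpace F V)) x (ν x).1 with hT
  have hT1 : dProj I ⟨x, e x⟩ T = (ν x).1 := dProj_mfderiv_section e x _
  have h1 : (horizontalLift Δ ν e x).1 = T - verticalLift I ⟨x, e x⟩ δ.1 := rfl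
  refine ⟨?_, fun μ w hw => ?_⟩
  · rw [h1, map_sub, dProj_vertical, sub_zero, hT1]
  · have h2 : (horizontalLift Δ ν e x).2 w = dReal (I.prod 𝓘(ℝ, F)) (linFun ν) ⟨x, e x⟩ w -
        δ.2 (dProj I ⟨x, e x⟩ w) := rfl
    have h3 := dReal_mfderiv_section (contMDiff_linFun μ) e x (ν x).1
    have h4 := h ν μ (inlSection e) x
    have h5 : (fun y => sidePairing (μ y) (inlSection (G₂ := EM →L[ℝ] ℝ)
        (W₂ := fun x => Cotangent I x) e y)) = fun y => linFun μ ⟨y, e y⟩ :=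
      funext fun y => add_zero _
    have h6 : sidePairing (D ν μ x) (inlSection (G₂ := EM →L[ℝ] ℝ)
        (W₂ := fun x => Cotangent I x) e x) = linFun (D ν μ) ⟨x, e x⟩ := add_zero _
    have h7 : sidePairing (μ x) δ = (μ x).2 δ.1 + δ.2 (μ x).1 := rfl
    rw [h5, h6, ← hδ, h7] at h4
    rw [h2, h1, map_sub, dReal_linFun_vertical, hw, h3, h4]
    show _ - δ.2 (μ x).1 = _ - (_ - (μ x).2 δ.1) + _
    ring

/-- The case w = 0 of the defining formula: the tangent part of the lift differentiates linear
functions by the bracket with sections of V*. -/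
theorem IsLift.dReal_linFun {ν : SideSection I (V := V) (F := F)} {p : TotalSpace F V}
    {ξ : GenTangentTotal I F V p} (h : IsLift D ν p ξ) (η : SideSection I (V := V) (F := F))
    (hη : (η p.proj).1 = 0) :
    dReal (I.prod 𝓘(ℝ, F)) (linFun η) p ξ.1 = linFun (D ν η) p := by
  have h1 := h.2 η 0 (by rw [map_zero, hη])
  rw [map_zero, map_zero] at h1
  linarith

/-- The section `(0, ε)` for `ν = (X, ε)`. -/
def dualPart (ν : SideSection I (V := V) (F := F)) : SideSection I (V := V) (F := F) :=
  pairSection 0 (sndSection ν)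

theorem linFun_dualPart (ν : SideSection I (V := V) (F := F)) :
    linFun (dualPart ν) = linFun ν := rfl

theorem IsLift.dReal_linFun' {ν : SideSection I (V := V) (F := F)} {p : TotalSpace F V}
    {ξ : GenTangentTotal I F V p} (h : IsLift D ν p ξ) (μ : SideSection I (V := V) (F := F)) :
    dReal (I.prod 𝓘(ℝ, F)) (linFun μ) p ξ.1 = linFun (D ν (dualPart μ)) p := by
  rw [← linFun_dualPart, h.dReal_linFun _ rfl]

theorem exists_sideSection_fst (p : TotalSpace F V) (w : TangentTotal I F V p) :
    ∃ μ : SideSection I (V := V) (F := F), dProj I p w = (μ p.proj).1 := by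
  obtain ⟨μ, hμ⟩ := exists_sideSection (F := F) (V := V) (dProj I p w) 0
  exact ⟨μ, by rw [hμ]⟩

/-- The tangent part is fixed by its projection and its derivatives of linear functions. The form is
then fixed because each w lies over the value of some μ. -/
theorem IsLift.unique {ν : SideSection I (V := V) (F := F)} {p : TotalSpace F V}
    {ξ ξ' : GenTangentTotal I F V p} (h : IsLift D ν p ξ) (h' : IsLift D ν p ξ') : ξ = ξ' := by
  have h1 : ξ.1 = ξ'.1 := tangent_ext (h.1.trans h'.1.symm) fun μ => by
    rw [h.dReal_linFun', h'.dReal_linFun']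
  refine Prod.ext h1 (ContinuousLinearMap.ext fun w => ?_)
  obtain ⟨μ, hμ⟩ := exists_sideSection_fst p w
  rw [h.2 μ w hμ, h'.2 μ w hμ, h1]

theorem linFun_add (μ ν : SideSection I (V := V) (F := F)) :
    linFun (μ + ν) = fun p => linFun μ p + linFun ν p := rfl

theorem linFun_smulSection (f : C^∞⟮I, M; ℝ⟯) (ν : SideSection I (V := V) (F := F)) :
    linFun (smulSection f ν) = fun p => f p.proj * linFun ν p := rfl

theorem dReal_linFun_add (μ ν : SideSection I (V := V) (F := F)) (p : TotalSpace F V)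
    (w : TangentTotal I F V p) : dReal (I.prod 𝓘(ℝ, F)) (linFun (μ + ν)) p w =
      dReal (I.prod 𝓘(ℝ, F)) (linFun μ) p w + dReal (I.prod 𝓘(ℝ, F)) (linFun ν) p w :=
  dReal_add (contMDiff_linFun μ) (contMDiff_linFun ν) p w

theorem dReal_linFun_smulSection (f : C^∞⟮I, M; ℝ⟯) (ν : SideSection I (V := V) (F := F))
    (p : TotalSpace F V) (w : TangentTotal I F V p) :
    dReal (I.prod 𝓘(ℝ, F)) (linFun (smulSection f ν)) p w =
      f p.proj * dReal (I.prod 𝓘(ℝ, F)) (linFun ν) p w + linFun ν p * dReal I f p.proj (dProj I p w) := by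
  rw [linFun_smulSection, dReal_mul (contMDiff_comp_proj f.contMDiff) (contMDiff_linFun ν),
    dReal_comp_proj f.contMDiff]

theorem IsLift.add {μ ν : SideSection I (V := V) (F := F)} {p : TotalSpace F V}
    {ξ η : GenTangentTotal I F V p} (h : IsLift D μ p ξ) (h' : IsLift D ν p η) :
    IsLift D (μ + ν) p (ξ + η) := by
  refine ⟨(map_add (dProj I p) ξ.1 η.1).trans (congrArg₂ (· + ·) h.1 h'.1), fun κ w hw => ?_⟩
  have h1 : (ξ + η).2 w = ξ.2 w + η.2 w := rfl
  have h2 : dReal (I.prod 𝓘(ℝ, F)) (linFun κ) p (ξ + η).1 =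
      dReal (I.prod 𝓘(ℝ, F)) (linFun κ) p ξ.1 + dReal (I.prod 𝓘(ℝ, F)) (linFun κ) p η.1 :=
    map_add _ _ _
  rw [h1, h2, h.2 κ w hw, h'.2 κ w hw, dReal_linFun_add, bracket_add_left, linFun_add]
  ring

/-- D is not tensorial in its first argument, but the defect -Y(f) ν, with Y the vector field of κ,
cancels the derivative of f in d(f ℓ_ν)(w). The lift is therefore a map on the fibres of the side.
-/
theorem IsLift.smulSection (hD : IsDullBracket (prTM I V) D) {ν : SideSection I (V := V) (F := F)}
    {p : TotalSpace F V} {ξ : GenTangentTotal I F V p} (h : IsLift D ν p ξ) (f : C^∞⟮I, M; ℝ⟯) :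
    IsLift D (smulSection f ν) p (f p.proj • ξ) := by
  refine ⟨(map_smul (dProj I p) (f p.proj) ξ.1).trans (congrArg (f p.proj • ·) h.1),
    fun κ w hw => ?_⟩
  have h1 : (f p.proj • ξ).2 w = f p.proj * ξ.2 w := rfl
  have h2 : dReal (I.prod 𝓘(ℝ, F)) (linFun κ) p (f p.proj • ξ).1 =
      f p.proj * dReal (I.prod 𝓘(ℝ, F)) (linFun κ) p ξ.1 := map_smul _ _ _
  have h3 : linFun (D (LinearGC.smulSection f ν) κ) p =
      f p.proj * linFun (D ν κ) p - dReal I f p.proj (κ p.proj).1 * linFun ν p :=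
    congrArg (fun A : Side I V p.proj => A.2 p.snd) (hD.smul_left f ν κ p.proj)
  rw [h1, h2, h3, h.2 κ w hw, dReal_linFun_smulSection, hw]
  ring

theorem IsLift.smul {ν : SideSection I (V := V) (F := F)}
    {p : TotalSpace F V} {ξ : GenTangentTotal I F V p} (h : IsLift D ν p ξ) (r : ℝ) :
    IsLift D (r • ν) p (r • ξ) := by
  refine ⟨(map_smul (dProj I p) r ξ.1).trans (congrArg (r • ·) h.1), fun κ w hw => ?_⟩
  have h1 : (r • ξ).2 w = r * ξ.2 w := rfl
  have h2 : dReal (I.prod 𝓘(ℝ, F)) (linFun κ) p (r • ξ).1 =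
      r * dReal (I.prod 𝓘(ℝ, F)) (linFun κ) p ξ.1 := map_smul _ _ _
  have h3 : linFun (r • D ν κ) p = r * linFun (D ν κ) p := rfl
  have h4 : dReal (I.prod 𝓘(ℝ, F)) (linFun (r • ν)) p w =
      r * dReal (I.prod 𝓘(ℝ, F)) (linFun ν) p w := by
    have h5 : linFun (r • ν) = fun p => (fun _ => r) p * linFun ν p := rfl
    rw [h5, dReal_mul contMDiff_const (contMDiff_linFun ν), dReal_const]
    ring
  rw [h1, h2, bracket_smul_left, h3, h.2 κ w hw, h4]
  ring

theorem IsLift.sideMap_eq {ν : SideSection I (V := V) (F := F)} {p : TotalSpace F V}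
    {ξ : GenTangentTotal I F V p} (h : IsLift D ν p ξ) : sideMap I p ξ = ν p.proj := by
  refine Prod.ext h.1 (ContinuousLinearMap.ext fun c => ?_)
  have h1 := h.2 0 (verticalLift I p c) (dProj_vertical p c)
  have h2 : dReal (I.prod 𝓘(ℝ, F)) (linFun (0 : SideSection I (V := V) (F := F))) p ξ.1 = 0 :=
    dReal_const 0 p _
  have h3 : linFun (D ν 0) p = 0 := by rw [map_zero]; rfl
  rw [h2, h3, dReal_linFun_vertical, sub_zero, add_zero] at h1
  exact h1

variable [I.Boundaryless]

/-- Every point of E lies on the image of a global section, where the Dorfman connection gives the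
lift. -/
theorem exists_isLift (hD : IsDullBracket (prTM I V) D) (ν : SideSection I (V := V) (F := F))
    (p : TotalSpace F V) : ∃ ξ, IsLift D ν p ξ := by
  obtain ⟨Δ, hΔ⟩ := exists_isDual hD
  obtain ⟨x, v⟩ := p
  obtain ⟨e, rfl⟩ := exists_section I F v
  exact ⟨_, isLift_horizontalLift hΔ ν e x⟩

/-- The value at `p` of the horizontal lift defined by a dull bracket. -/
def liftAt (hD : IsDullBracket (prTM I V) D) (p : TotalSpace F V) :
    SideSection I (V := V) (F := F) →ₗ[ℝ] GenTangentTotal I F V p where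
  toFun ν := (exists_isLift hD ν p).choose
  map_add' μ ν := (exists_isLift hD (μ + ν) p).choose_spec.unique
    ((exists_isLift hD μ p).choose_spec.add (exists_isLift hD ν p).choose_spec)
  map_smul' r ν := (exists_isLift hD (r • ν) p).choose_spec.unique
    ((exists_isLift hD ν p).choose_spec.smul r)

theorem isLift_liftAt (hD : IsDullBracket (prTM I V) D) (ν : SideSection I (V := V) (F := F))
    (p : TotalSpace F V) : IsLift D ν p (liftAt hD p ν) := (exists_isLift hD ν p).choose_spec

theorem liftAt_smulSection (hD : IsDullBracket (prTM I V) D) (p : TotalSpace F V)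
    (f : C^∞⟮I, M; ℝ⟯) (ν : SideSection I (V := V) (F := F)) :
    liftAt hD p (smulSection f ν) = f p.proj • liftAt hD p ν :=
  (isLift_liftAt hD _ p).unique ((isLift_liftAt hD ν p).smulSection hD f)

theorem liftAt_congr (hD : IsDullBracket (prTM I V) D) {p : TotalSpace F V}
    {μ ν : SideSection I (V := V) (F := F)} (h : μ p.proj = ν p.proj) :
    liftAt hD p μ = liftAt hD p ν :=
  tensorial_congr (liftAt hD p) (liftAt_smulSection hD p) h

theorem sideMap_liftAt (hD : IsDullBracket (prTM I V) D) (ν : SideSection I (V := V) (F := F))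
    (p : TotalSpace F V) : sideMap I p (liftAt hD p ν) = ν p.proj :=
  (isLift_liftAt hD ν p).sideMap_eq

/-- Every generalised tangent vector is the sum of a horizontal lift and a core element. -/
theorem exists_liftAt_add_coreLift (hD : IsDullBracket (prTM I V) D) {p : TotalSpace F V}
    {ξ : GenTangentTotal I F V p} {ν : SideSection I (V := V) (F := F)}
    (h : sideMap I p ξ = ν p.proj) : ∃ τ, liftAt hD p ν + coreLift I p τ = ξ := by
  obtain ⟨τ, hτ⟩ := exists_coreLift_of_sideMap_eq_zero (ξ := ξ - liftAt hD p ν) (by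
    rw [sideMap_sub, h, sideMap_liftAt, sub_self])
  exact ⟨τ, by rw [hτ, add_sub_cancel]⟩

/-- Basic functions detect the projection and linear functions the vertical part. They serve as the
test functions for smoothness on E. -/
theorem eq_zero_of_dProj_functions {p : TotalSpace F V} {v : TangentTotal I F V p}
    (h : ∀ f : C^∞⟮I, M; ℝ⟯, dReal (I.prod 𝓘(ℝ, F)) (fun q : TotalSpace F V => f q.proj) p v = 0)
    (hl : ∀ ν : SideSection I (F := F) (V := V), dReal (I.prod 𝓘(ℝ, F)) (linFun ν) p v = 0) :
    v = 0 := by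
  refine tangent_ext ?_ fun ν => (hl ν).trans (map_zero _).symm
  refine SeparatingDual.eq_iff_forall_dual_eq (R := ℝ) (V := EM) |>.2 fun g => ?_
  obtain ⟨f, hf⟩ := exists_dReal_eq (I := I) (x := p.proj) g
  have h1 := (dReal_comp_proj f.contMDiff p v).symm.trans (h f)
  rw [hf] at h1
  exact h1.trans (map_zero (g.comp (dProj I p : EM × F →L[ℝ] EM))).symm

/-- A vector field on the total space is smooth if its derivatives of basic and of fibrewise linear
functions are. -/
theorem contMDiff_field_total (X : ∀ p : TotalSpace F V, TangentTotal I F V p)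
    (h : ∀ f : C^∞⟮I, M; ℝ⟯, ContMDiff (I.prod 𝓘(ℝ, F)) 𝓘(ℝ, ℝ) ∞
      fun p : TotalSpace F V => dReal I f p.proj (dProj I p (X p)))
    (hl : ∀ ν : SideSection I (F := F) (V := V), ContMDiff (I.prod 𝓘(ℝ, F)) 𝓘(ℝ, ℝ) ∞
      fun p => dReal (I.prod 𝓘(ℝ, F)) (linFun ν) p (X p)) :
    ContMDiff (I.prod 𝓘(ℝ, F)) ((I.prod 𝓘(ℝ, F)).prod 𝓘(ℝ, EM × F)) ∞
      (fun p => TotalSpace.mk' (EM × F) (E := fun p : TotalSpace F V => TangentTotal I F V p)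
        p (X p)) := fun p => by
  refine contMDiffAt_field_of_dReal (J := I.prod 𝓘(ℝ, F)) X p
    ({g | ∃ f : C^∞⟮I, M; ℝ⟯, g = fun q : TotalSpace F V => f q.proj} ∪
      {g | ∃ ν : SideSection I (F := F) (V := V), g = linFun ν}) ?_ ?_ ?_
  · rintro g (⟨f, rfl⟩ | ⟨ν, rfl⟩)
    · exact contMDiff_comp_proj f.contMDiff
    · exact contMDiff_linFun ν
  · rintro g (⟨f, rfl⟩ | ⟨ν, rfl⟩)
    · simp only [dReal_comp_proj f.contMDiff]
      exact h f p
    · exact hl ν p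
  · intro v hv
    exact eq_zero_of_dProj_functions (fun f => hv _ (Or.inl ⟨f, rfl⟩))
      fun ν => hv _ (Or.inr ⟨ν, rfl⟩)

/-- The vector field underlying the horizontal lift of `ν`. -/
def liftField (hD : IsDullBracket (prTM I V) D) (ν : SideSection I (V := V) (F := F)) :
    VectorFields (I.prod 𝓘(ℝ, F)) (TotalSpace F V) :=
  ⟨fun p => (liftAt hD p ν).1, by
    refine contMDiff_field_total _ (fun f => ?_) fun μ => ?_
    · simp only [(isLift_liftAt hD ν _).1]
      exact contMDiff_comp_proj (contMDiff_dReal_apply f.contMDiff (fstSection ν))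
    · simp only [(isLift_liftAt hD ν _).dReal_linFun']
      exact contMDiff_linFun _⟩

/-- The vertical vector field defined by a section of `V`. -/
def verticalField (e : Cₛ^∞⟮I; F, V⟯) : VectorFields (I.prod 𝓘(ℝ, F)) (TotalSpace F V) :=
  ⟨fun p => verticalLift I p (e p.proj), by
    refine contMDiff_field_total _ (fun f => ?_) fun μ => ?_
    · simp only [dProj_vertical, map_zero]
      exact contMDiff_const
    · simp only [dReal_linFun_vertical]
      refine (contMDiff_comp_proj (contMDiff_sidePairing μ (inlSection e))).congr fun p => ?_
      exact (add_zero _).symm⟩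

/-- A 1-form on the total space is smooth if it is smooth on horizontal lifts and vertical
fields. -/
theorem contMDiff_form_total (hD : IsDullBracket (prTM I V) D)
    (θ : ∀ p : TotalSpace F V, Cotangent (I.prod 𝓘(ℝ, F)) p)
    (h : ∀ (μ : SideSection I (V := V) (F := F)), ContMDiff (I.prod 𝓘(ℝ, F)) 𝓘(ℝ, ℝ) ∞
      fun p => θ p (liftField hD μ p))
    (hv : ∀ e : Cₛ^∞⟮I; F, V⟯, ContMDiff (I.prod 𝓘(ℝ, F)) 𝓘(ℝ, ℝ) ∞
      fun p => θ p (verticalLift I p (e p.proj))) :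
    ContMDiff (I.prod 𝓘(ℝ, F)) ((I.prod 𝓘(ℝ, F)).prod 𝓘(ℝ, EM × F →L[ℝ] ℝ)) ∞
      (fun p => TotalSpace.mk' (EM × F →L[ℝ] ℝ)
        (E := fun p : TotalSpace F V => Cotangent (I.prod 𝓘(ℝ, F)) p) p (θ p)) := fun p => by
  refine contMDiffAt_hom_of_sections (W₂ := fun _ : TotalSpace F V => ℝ) θ p
    {X | ∃ (μ : SideSection I (V := V) (F := F)) (e : Cₛ^∞⟮I; F, V⟯),
      X = liftField hD μ + verticalField e} ?_ fun w => ?_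
  · rintro X ⟨μ, e, rfl⟩
    rw [Bundle.contMDiffAt_section]
    refine ((h μ).add (hv e) p).congr_of_eventuallyEq (Filter.Eventually.of_forall fun q => ?_)
    exact map_add (θ q) _ _
  · obtain ⟨μ, hμ⟩ := exists_sideSection_fst p w
    obtain ⟨c, hc⟩ := exists_vertical_of_dProj_eq_zero (w := w - liftField hD μ p) (by
      rw [map_sub, hμ, sub_eq_zero]; exact (isLift_liftAt hD μ p).1.symm)
    obtain ⟨e, rfl⟩ := exists_section I F c
    refine ⟨_, ⟨μ, e, rfl⟩, ?_⟩
    exact (congrArg (liftField hD μ p + ·) hc).trans (add_sub_cancel _ _)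

/-- The horizontal lift of `ν` defined by a dull bracket. -/
def liftSection (hD : IsDullBracket (prTM I V) D) (ν : SideSection I (V := V) (F := F)) :
    GenSections (I.prod 𝓘(ℝ, F)) (TotalSpace F V) :=
  pairSection (liftField hD ν) ⟨fun p => (liftAt hD p ν).2, by
    refine contMDiff_form_total hD _ (fun μ => ?_) fun e => ?_
    · have h : (fun p => (liftAt hD p ν).2 (liftField hD μ p)) = fun p =>
          dReal (I.prod 𝓘(ℝ, F)) (linFun ν) p (liftField hD μ p) -
          dReal (I.prod 𝓘(ℝ, F)) (linFun μ) p (liftField hD ν p) + linFun (D ν μ) p :=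
        funext fun p => (isLift_liftAt hD ν p).2 μ _ (isLift_liftAt hD μ p).1
      rw [h]
      exact ((contMDiff_dReal_apply (contMDiff_linFun ν) _).sub
        (contMDiff_dReal_apply (contMDiff_linFun μ) _)).add (contMDiff_linFun _)
    · have h : (fun p => (liftAt hD p ν).2 (verticalLift I p (e p.proj))) = fun p : TotalSpace F V =>
          sidePairing (ν p.proj) (inlSection (G₂ := EM →L[ℝ] ℝ)
            (W₂ := fun x => Cotangent I x) e p.proj) := funext fun p =>
        (congrArg (fun A : Side I V p.proj => A.2 (e p.proj)) (sideMap_liftAt hD ν p)).trans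
          (add_zero _).symm
      rw [h]
      exact contMDiff_comp_proj (contMDiff_sidePairing ν (inlSection e))⟩

-- Hausdorffness of E is needed for extending tangent vectors of E to global fields. Points over
-- different base points are separated on M, and points of one fibre in a trivialisation.
omit [I.Boundaryless] [FiniteDimensional ℝ EM] [FiniteDimensional ℝ F] in
theorem t2Space_totalSpace : T2Space (TotalSpace F V) := by
  refine ⟨fun p q hpq => ?_⟩
  by_cases h : p.proj = q.proj
  · set t := trivializationAt F V p.proj
    have hp : p ∈ t.source := t.mem_source.2 (FiberBundle.mem_baseSet_trivializationAt' p.proj)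
    have hq : q ∈ t.source :=
      t.mem_source.2 (h ▸ FiberBundle.mem_baseSet_trivializationAt' p.proj)
    have : T2Space t.source := T2Space.of_injective_continuous (f := fun z : t.source => t z)
      (fun z w hzw => Subtype.ext (t.injOn z.2 w.2 hzw))
      (continuousOn_iff_continuous_domRestrict.1 t.continuousOn)
    exact separated_by_isOpenEmbedding t.open_source.isOpenEmbedding_subtypeVal
      (x := ⟨p, hp⟩) (y := ⟨q, hq⟩) fun h => hpq (congrArg Subtype.val h)
  · exact separated_by_continuous (FiberBundle.continuous_proj F V) h

/-- The pullback of a 1-form to the total space. -/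
def pullbackForm (θ : OneForms I M) : OneForms (I.prod 𝓘(ℝ, F)) (TotalSpace F V) :=
  have : T2Space (TotalSpace F V) := t2Space_totalSpace
  ⟨fun p => (θ p.proj).comp (dProj I p), fun p => by
    refine contMDiffAt_hom_of_sections (W₂ := fun _ : TotalSpace F V => ℝ) (G := EM × F)
      (fun p => (θ p.proj).comp (dProj I p)) p Set.univ (fun X _ => ?_)
      fun w => (exists_section (I.prod 𝓘(ℝ, F)) (EM × F) w).imp fun s hs => ⟨trivial, hs⟩
    rw [Bundle.contMDiffAt_section]
    have h1 : ContMDiff (I.prod 𝓘(ℝ, F)) (I.prod 𝓘(ℝ, EM →L[ℝ] ℝ)) ∞ (fun p : TotalSpace F V =>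
        (⟨p.proj, θ p.proj⟩ : TotalSpace (EM →L[ℝ] ℝ) (fun x => Cotangent I x))) :=
      θ.contMDiff.comp contMDiff_proj_total
    have h2 : ContMDiff (I.prod 𝓘(ℝ, F)) (I.prod 𝓘(ℝ, EM)) ∞ (fun p : TotalSpace F V =>
        (⟨p.proj, dProj I p (X p)⟩ : TotalSpace EM (fun x : M => TangentSpace I x))) := by
      have : IsManifold (I.prod 𝓘(ℝ, F)) 1 (TotalSpace F V) :=
        IsManifold.of_le (n := ∞) (by norm_cast)
      have : IsManifold I 1 M := IsManifold.of_le (n := ∞) (by norm_cast)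
      exact ((contMDiff_proj_total (I := I) (F := F) (V := V)).contMDiff_tangentMap
        (m := ∞) (by simp)).comp X.contMDiff
    have h := ContMDiff.clm_bundle_apply (F₂ := ℝ) (E₂ := fun _ : M => ℝ) h1 h2
    exact (Bundle.contMDiffAt_totalSpace.1 (h p)).2⟩

/-- The section `τ^↑` defined by a section of the core. -/
def coreSection (τ : Cₛ^∞⟮I; F × (EM →L[ℝ] ℝ), Core I V⟯) :
    GenSections (I.prod 𝓘(ℝ, F)) (TotalSpace F V) :=
  pairSection (verticalField (fstSection τ)) (pullbackForm (sndSection τ))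

end Lifts

/-! ### Pairings and Courant brackets of lifts and core sections. -/

section CourantOfLifts

variable {EM : Type*} [NormedAddCommGroup EM] [NormedSpace ℝ EM] [FiniteDimensional ℝ EM]
  {HM : Type*} [TopologicalSpace HM]
  {I : ModelWithCorners ℝ EM HM} {M : Type*} [TopologicalSpace M] [ChartedSpace HM M]
  [IsManifold I ∞ M]
  {F : Type*} [NormedAddCommGroup F] [NormedSpace ℝ F] [FiniteDimensional ℝ F]
  {V : M → Type*} [TopologicalSpace (TotalSpace F V)] [∀ x, AddCommGroup (V x)]
  [∀ x, Module ℝ (V x)] [∀ x, TopologicalSpace (V x)]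
  [∀ x, IsTopologicalAddGroup (V x)] [∀ x, ContinuousSMul ℝ (V x)]
  [FiberBundle F V] [VectorBundle ℝ F V] [ContMDiffVectorBundle ∞ F V I]
variable [T2Space M] [I.Boundaryless]
  {D : SideSection I (V := V) (F := F) →ₗ[ℝ] SideSection I (V := V) (F := F) →ₗ[ℝ]
    SideSection I (V := V) (F := F)}

namespace Shortcuts

scoped instance : CompleteSpace (EM × F) := FiniteDimensional.complete ℝ (EM × F)

end Shortcuts


/-- Brackets of projectable vector fields are projectable. -/
theorem dProj_mlieBracket {X₁ X₂ : VectorFields (I.prod 𝓘(ℝ, F)) (TotalSpace F V)}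
    {Y₁ Y₂ : VectorFields I M} (h₁ : ∀ p, dProj I p (X₁ p) = Y₁ p.proj)
    (h₂ : ∀ p, dProj I p (X₂ p) = Y₂ p.proj) (p : TotalSpace F V) :
    dProj I p (mlieBracket (I.prod 𝓘(ℝ, F)) X₁ X₂ p) = mlieBracket I Y₁ Y₂ p.proj := by
  have : CompleteSpace EM := FiniteDimensional.complete ℝ EM
  refine SeparatingDual.eq_iff_forall_dual_eq (R := ℝ) (V := EM) |>.2 fun g => ?_
  obtain ⟨f, hf⟩ := exists_dReal_eq (I := I) (x := p.proj) g
  have h3 : ∀ (X : VectorFields (I.prod 𝓘(ℝ, F)) (TotalSpace F V)) (Y : VectorFields I M),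
      (∀ p, dProj I p (X p) = Y p.proj) → ∀ g : M → ℝ, ContMDiff I 𝓘(ℝ, ℝ) ∞ g →
      (fun q : TotalSpace F V => dReal (I.prod 𝓘(ℝ, F)) (fun q : TotalSpace F V => g q.proj) q (X q)) =
      fun q => dReal I g q.proj (Y q.proj) := fun X Y h g hg => funext fun q => by
    rw [dReal_comp_proj hg, h]
  have h4 := dReal_bracket (contMDiff_comp_proj f.contMDiff) X₁ X₂ p
  rw [h3 X₁ Y₁ h₁ f f.contMDiff, h3 X₂ Y₂ h₂ f f.contMDiff,
    dReal_comp_proj (contMDiff_dReal_apply f.contMDiff Y₁),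
    dReal_comp_proj (contMDiff_dReal_apply f.contMDiff Y₂), h₁, h₂, dReal_comp_proj f.contMDiff,
    ← dReal_bracket f.contMDiff, hf] at h4
  exact h4

theorem mlieBracket_zero_right' (Y : VectorFields I M) (x : M) :
    mlieBracket I Y (0 : VectorFields I M) x = 0 := by
  have h : ((0 : VectorFields I M) : ∀ x, TangentSpace I x) = 0 := rfl
  rw [h, mlieBracket_zero_right]
  rfl

theorem liftField_dProj (hD : IsDullBracket (prTM I V) D) (ν : SideSection I (V := V) (F := F))
    (p : TotalSpace F V) : dProj I p (liftField hD ν p) = fstSection ν p.proj :=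
  (isLift_liftAt hD ν p).1

/-- The derivative of a function in the direction of a vector field, as a function. -/
def lieDeriv (X : VectorFields (I.prod 𝓘(ℝ, F)) (TotalSpace F V)) (f : TotalSpace F V → ℝ)
    (p : TotalSpace F V) : ℝ := dReal (I.prod 𝓘(ℝ, F)) f p (X p)

theorem contMDiff_lieDeriv (X : VectorFields (I.prod 𝓘(ℝ, F)) (TotalSpace F V))
    {f : TotalSpace F V → ℝ} (hf : ContMDiff (I.prod 𝓘(ℝ, F)) 𝓘(ℝ, ℝ) ∞ f) :
    ContMDiff (I.prod 𝓘(ℝ, F)) 𝓘(ℝ, ℝ) ∞ (lieDeriv X f) := contMDiff_dReal_apply hf X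

theorem liftAt_apply_liftField (hD : IsDullBracket (prTM I V) D)
    (μ ν : SideSection I (V := V) (F := F)) (p : TotalSpace F V) :
    (liftAt hD p ν).2 (liftField hD μ p) = lieDeriv (liftField hD μ) (linFun ν) p -
      lieDeriv (liftField hD ν) (linFun μ) p + linFun (D ν μ) p :=
  (isLift_liftAt hD ν p).2 μ _ (liftField_dProj hD μ p)

theorem dReal_liftAt_apply (hD : IsDullBracket (prTM I V) D)
    (μ ν : SideSection I (V := V) (F := F)) (p : TotalSpace F V) (w : TangentTotal I F V p) :
    dReal (I.prod 𝓘(ℝ, F)) (fun q => (liftAt hD q ν).2 (liftField hD μ q)) p w =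
      dReal (I.prod 𝓘(ℝ, F)) (lieDeriv (liftField hD μ) (linFun ν)) p w -
      dReal (I.prod 𝓘(ℝ, F)) (lieDeriv (liftField hD ν) (linFun μ)) p w +
      dReal (I.prod 𝓘(ℝ, F)) (linFun (D ν μ)) p w := by
  have h1 := contMDiff_lieDeriv (liftField hD μ) (contMDiff_linFun ν)
  have h2 := contMDiff_lieDeriv (liftField hD ν) (contMDiff_linFun μ)
  simp only [liftAt_apply_liftField]
  rw [dReal_add (h1.sub h2) (contMDiff_linFun _), dReal_sub h1 h2]

theorem dProj_mlieBracket_liftField (hD : IsDullBracket (prTM I V) D)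
    (μ ν : SideSection I (V := V) (F := F)) (p : TotalSpace F V) :
    dProj I p (mlieBracket (I.prod 𝓘(ℝ, F)) (liftField hD μ) (liftField hD ν) p) =
      (D μ ν p.proj).1 :=
  (dProj_mlieBracket (liftField_dProj hD μ) (liftField_dProj hD ν) p).trans
    (hD.anchor_bracket μ ν p.proj).symm

/-- The commutator of two lifted fields lies over the vector field of D(μ, ν), so this section can
serve as test section in `IsLift`. -/
theorem liftAt_apply_mlieBracket (hD : IsDullBracket (prTM I V) D)
    (κ μ ν : SideSection I (V := V) (F := F)) (p : TotalSpace F V) :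
    (liftAt hD p κ).2 (mlieBracket (I.prod 𝓘(ℝ, F)) (liftField hD μ) (liftField hD ν) p) =
      dReal (I.prod 𝓘(ℝ, F)) (lieDeriv (liftField hD ν) (linFun κ)) p (liftField hD μ p) -
      dReal (I.prod 𝓘(ℝ, F)) (lieDeriv (liftField hD μ) (linFun κ)) p (liftField hD ν p) -
      dReal (I.prod 𝓘(ℝ, F)) (linFun (D μ ν)) p (liftField hD κ p) +
      linFun (D κ (D μ ν)) p := by
  refine ((isLift_liftAt hD κ p).2 (D μ ν) _ (dProj_mlieBracket_liftField hD μ ν p)).trans ?_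
  rw [dReal_bracket (contMDiff_linFun κ)]
  rfl

/-- The Courant brackets of horizontal lifts, paired with a horizontal lift. -/
theorem genPairing_courantBracket_liftSection (hD : IsDullBracket (prTM I V) D)
    (ν₁ ν₂ ν₃ : SideSection I (V := V) (F := F)) (p : TotalSpace F V) :
    genPairing (I.prod 𝓘(ℝ, F)) (courantBracket (I.prod 𝓘(ℝ, F)) (liftSection hD ν₁)
      (liftSection hD ν₂) p) (liftSection hD ν₃ p) =
      linFun (D ν₁ (D ν₂ ν₃) - D ν₂ (D ν₁ ν₃) + D ν₃ (D ν₁ ν₂)) p := by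
  rw [genPairing_courantBracket]
  refine Eq.trans (b := (liftAt hD p ν₃).2
      (mlieBracket (I.prod 𝓘(ℝ, F)) (liftField hD ν₁) (liftField hD ν₂) p)
    - (liftAt hD p ν₂).2 (mlieBracket (I.prod 𝓘(ℝ, F)) (liftField hD ν₁) (liftField hD ν₃) p)
    + (liftAt hD p ν₁).2 (mlieBracket (I.prod 𝓘(ℝ, F)) (liftField hD ν₂) (liftField hD ν₃) p)
    + dReal (I.prod 𝓘(ℝ, F)) (fun q => (liftAt hD q ν₂).2 (liftField hD ν₃ q)) p (liftField hD ν₁ p)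
    - dReal (I.prod 𝓘(ℝ, F)) (fun q => (liftAt hD q ν₁).2 (liftField hD ν₃ q)) p (liftField hD ν₂ p)
    + dReal (I.prod 𝓘(ℝ, F)) (fun q => (liftAt hD q ν₁).2 (liftField hD ν₂ q)) p
      (liftField hD ν₃ p)) rfl ?_
  -- All terms are now second derivatives of the functions ℓ, derivatives of ℓ of single brackets,
  -- or ℓ of iterated brackets. The first two kinds cancel.
  simp only [liftAt_apply_mlieBracket, dReal_liftAt_apply]
  have h : linFun (D ν₁ (D ν₂ ν₃) - D ν₂ (D ν₁ ν₃) + D ν₃ (D ν₁ ν₂)) p =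
      linFun (D ν₁ (D ν₂ ν₃)) p - linFun (D ν₂ (D ν₁ ν₃)) p + linFun (D ν₃ (D ν₁ ν₂)) p := rfl
  rw [h]
  ring

theorem verticalField_dProj (e : Cₛ^∞⟮I; F, V⟯) (p : TotalSpace F V) :
    dProj I p (verticalField e p) = (0 : VectorFields I M) p.proj := dProj_vertical p _

theorem dProj_mlieBracket_verticalField {X : VectorFields (I.prod 𝓘(ℝ, F)) (TotalSpace F V)}
    {Y : VectorFields I M} (h : ∀ p, dProj I p (X p) = Y p.proj) (e : Cₛ^∞⟮I; F, V⟯)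
    (p : TotalSpace F V) :
    dProj I p (mlieBracket (I.prod 𝓘(ℝ, F)) X (verticalField e) p) = 0 :=
  (dProj_mlieBracket h (verticalField_dProj e) p).trans (mlieBracket_zero_right' Y p.proj)

theorem lieDeriv_verticalField_linFun (e : Cₛ^∞⟮I; F, V⟯) (ν : SideSection I (V := V) (F := F)) :
    lieDeriv (verticalField e) (linFun ν) = fun p : TotalSpace F V => (ν p.proj).2 (e p.proj) :=
  funext fun p => dReal_linFun_vertical ν p _

theorem contMDiff_dual_apply (e : Cₛ^∞⟮I; F, V⟯) (ν : SideSection I (V := V) (F := F)) :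
    ContMDiff I 𝓘(ℝ, ℝ) ∞ fun x => (ν x).2 (e x) :=
  (contMDiff_sidePairing ν (inlSection e)).congr fun _ => (add_zero _).symm

/-- The value of the form of a section of `TE ⊕ T*E` over `ν` on a vertical vector. -/
theorem form_apply_vertical {p : TotalSpace F V} {ξ : GenTangentTotal I F V p} {ν : Side I V p.proj}
    (h : sideMap I p ξ = ν) (w : V p.proj) : ξ.2 (verticalLift I p w) = ν.2 w :=
  congrArg (fun A : Side I V p.proj => A.2 w) h

theorem liftAt_apply_mlieBracket_verticalField (hD : IsDullBracket (prTM I V) D)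
    (μ ν : SideSection I (V := V) (F := F)) (e : Cₛ^∞⟮I; F, V⟯) (p : TotalSpace F V) :
    (liftAt hD p ν).2 (mlieBracket (I.prod 𝓘(ℝ, F)) (liftField hD μ) (verticalField e) p) =
      dReal (I.prod 𝓘(ℝ, F)) (fun p : TotalSpace F V => (ν p.proj).2 (e p.proj)) p
        (liftField hD μ p) -
      dReal (I.prod 𝓘(ℝ, F)) (lieDeriv (liftField hD μ) (linFun ν)) p (verticalField e p) := by
  have h1 := (isLift_liftAt hD ν p).2 0 _
    (dProj_mlieBracket_verticalField (liftField_dProj hD μ) e p)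
  have h2 : dReal (I.prod 𝓘(ℝ, F)) (linFun (0 : SideSection I (V := V) (F := F))) p
    (liftAt hD p ν).1 = 0 := dReal_const 0 p _
  have h3 : linFun (D ν 0) p = 0 := by rw [map_zero]; rfl
  rw [h2, h3, dReal_bracket (contMDiff_linFun ν), sub_zero, add_zero] at h1
  refine h1.trans ?_
  rw [← lieDeriv_verticalField_linFun]
  rfl

/-- The Courant brackets of horizontal lifts, paired with a core section. -/
theorem genPairing_courantBracket_liftSection_coreSection (hD : IsDullBracket (prTM I V) D)
    (ν₁ ν₂ : SideSection I (V := V) (F := F)) (τ : Cₛ^∞⟮I; F × (EM →L[ℝ] ℝ), Core I V⟯)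
    (p : TotalSpace F V) :
    genPairing (I.prod 𝓘(ℝ, F)) (courantBracket (I.prod 𝓘(ℝ, F)) (liftSection hD ν₁)
      (liftSection hD ν₂) p) (coreSection τ p) = sidePairing (D ν₁ ν₂ p.proj) (τ p.proj) := by
  rw [genPairing_courantBracket]
  set e := fstSection τ
  have hν : ∀ ν : SideSection I (V := V) (F := F), (fun q : TotalSpace F V =>
      (liftAt hD q ν).2 (verticalField e q)) = fun q => (ν q.proj).2 (e q.proj) := fun ν =>
    funext fun q => form_apply_vertical (sideMap_liftAt hD ν q) _
  refine Eq.trans (b := (τ p.proj).2 (dProj I p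
      (mlieBracket (I.prod 𝓘(ℝ, F)) (liftField hD ν₁) (liftField hD ν₂) p))
    - (liftAt hD p ν₂).2 (mlieBracket (I.prod 𝓘(ℝ, F)) (liftField hD ν₁) (verticalField e) p)
    + (liftAt hD p ν₁).2 (mlieBracket (I.prod 𝓘(ℝ, F)) (liftField hD ν₂) (verticalField e) p)
    + dReal (I.prod 𝓘(ℝ, F)) (fun q => (liftAt hD q ν₂).2 (verticalField e q)) p (liftField hD ν₁ p)
    - dReal (I.prod 𝓘(ℝ, F)) (fun q => (liftAt hD q ν₁).2 (verticalField e q)) p (liftField hD ν₂ p)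
    + dReal (I.prod 𝓘(ℝ, F)) (fun q => (liftAt hD q ν₁).2 (liftField hD ν₂ q)) p
      (verticalField e p)) rfl ?_
  rw [hν, hν, dReal_liftAt_apply, liftAt_apply_mlieBracket_verticalField,
    liftAt_apply_mlieBracket_verticalField, dProj_mlieBracket_liftField]
  have h : dReal (I.prod 𝓘(ℝ, F)) (linFun (D ν₁ ν₂)) p (verticalField e p) =
    (D ν₁ ν₂ p.proj).2 (τ p.proj).1 := dReal_linFun_vertical _ p _
  rw [h]
  simp only [sidePairing]
  ring

/-- The Courant bracket of a section over a section of the side with a core section is orthogonal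
to the core sections. -/
theorem genPairing_courantBracket_coreSection {g : GenSections (I.prod 𝓘(ℝ, F)) (TotalSpace F V)}
    {ν : SideSection I (V := V) (F := F)} (hg : ∀ p, sideMap I p (g p) = ν p.proj)
    (σ τ : Cₛ^∞⟮I; F × (EM →L[ℝ] ℝ), Core I V⟯) (p : TotalSpace F V) :
    genPairing (I.prod 𝓘(ℝ, F)) (courantBracket (I.prod 𝓘(ℝ, F)) g (coreSection σ) p)
      (coreSection τ p) = 0 := by
  rw [genPairing_courantBracket]
  set c := fstSection σ
  set e := fstSection τ
  have hg1 : ∀ p, dProj I p (g.field p) = fstSection ν p.proj := fun p => congrArg Prod.fst (hg p)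
  have h1 : ∀ (s : Cₛ^∞⟮I; F, V⟯), (fun q : TotalSpace F V => (g q).2 (verticalField s q)) =
    fun q => (ν q.proj).2 (s q.proj) := fun s => funext fun q => form_apply_vertical (hg q) _
  have h2 : (fun q : TotalSpace F V => (σ q.proj).2 (dProj I q (verticalField e q))) =
      fun _ => 0 := funext fun q => by
    rw [verticalField_dProj]; exact map_zero _
  have h3 : ∀ (s t : Cₛ^∞⟮I; F, V⟯) (p : TotalSpace F V), dReal (I.prod 𝓘(ℝ, F))
      (fun q : TotalSpace F V => (ν q.proj).2 (s q.proj)) p (verticalField t p) = 0 :=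
    fun s t p => by
      rw [dReal_comp_proj (contMDiff_dual_apply s ν), verticalField_dProj]; exact map_zero _
  -- Two vertical lifts commute as far as needed: their commutator is vertical and kills `linFun ν`,
  -- since the vertical derivatives of a linear function are basic.
  have h4 : (g p).2 (mlieBracket (I.prod 𝓘(ℝ, F)) (verticalField c) (verticalField e) p) = 0 := by
    obtain ⟨w, hw⟩ := exists_vertical_of_dProj_eq_zero
      (dProj_mlieBracket_verticalField (verticalField_dProj c) e p)
    have h5 := dReal_bracket (contMDiff_linFun ν) (verticalField c) (verticalField e) p
    rw [← hw, dReal_linFun_vertical] at h5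
    rw [← hw, form_apply_vertical (hg p), h5]
    refine Eq.trans (congrArg₂ (· - ·) ?_ ?_) (sub_zero 0)
    · exact (congrArg (fun f => dReal (I.prod 𝓘(ℝ, F)) f p (verticalField c p))
        (lieDeriv_verticalField_linFun e ν)).trans (h3 e c p)
    · exact (congrArg (fun f => dReal (I.prod 𝓘(ℝ, F)) f p (verticalField e p))
        (lieDeriv_verticalField_linFun c ν)).trans (h3 c e p)
  refine Eq.trans (b := (τ p.proj).2 (dProj I p
      (mlieBracket (I.prod 𝓘(ℝ, F)) g.field (verticalField c) p))
    - (σ p.proj).2 (dProj I p (mlieBracket (I.prod 𝓘(ℝ, F)) g.field (verticalField e) p))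
    + (g p).2 (mlieBracket (I.prod 𝓘(ℝ, F)) (verticalField c) (verticalField e) p)
    + dReal (I.prod 𝓘(ℝ, F)) (fun q => (σ q.proj).2 (dProj I q (verticalField e q))) p (g p).1
    - dReal (I.prod 𝓘(ℝ, F)) (fun q => (g q).2 (verticalField e q)) p (verticalField c p)
    + dReal (I.prod 𝓘(ℝ, F)) (fun q => (g q).2 (verticalField c q)) p (verticalField e p)) rfl ?_
  rw [h4, h2, h1, h1, h3, h3, dReal_const, dProj_mlieBracket_verticalField hg1,
    dProj_mlieBracket_verticalField hg1, map_zero, map_zero]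
  ring

/-- The derivatives of ℓ_μ and ℓ_ν enter the two halves of the pairing with opposite signs, so only
the symmetric part of D remains. -/
theorem genPairing_liftAt (hD : IsDullBracket (prTM I V) D)
    (μ ν : SideSection I (V := V) (F := F)) (p : TotalSpace F V) :
    genPairing (I.prod 𝓘(ℝ, F)) (liftAt hD p μ) (liftAt hD p ν) =
      linFun (D μ ν + D ν μ) p := by
  refine Eq.trans (congrArg₂ (· + ·) (liftAt_apply_liftField hD ν μ p)
    (liftAt_apply_liftField hD μ ν p)) ?_
  rw [linFun_add]
  ring

end CourantOfLifts

/-! ### Compatibility of lifts and core elements with the bundle structure over the side. -/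

section SideStructure

variable {EM : Type*} [NormedAddCommGroup EM] [NormedSpace ℝ EM] [FiniteDimensional ℝ EM]
  {HM : Type*} [TopologicalSpace HM]
  {I : ModelWithCorners ℝ EM HM} {M : Type*} [TopologicalSpace M] [ChartedSpace HM M]
  [IsManifold I ∞ M]
  {F : Type*} [NormedAddCommGroup F] [NormedSpace ℝ F] [FiniteDimensional ℝ F]
  {V : M → Type*} [TopologicalSpace (TotalSpace F V)] [∀ x, AddCommGroup (V x)]
  [∀ x, Module ℝ (V x)] [∀ x, TopologicalSpace (V x)]
  [∀ x, IsTopologicalAddGroup (V x)] [∀ x, ContinuousSMul ℝ (V x)]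
  [FiberBundle F V] [VectorBundle ℝ F V] [ContMDiffVectorBundle ∞ F V I]
variable [T2Space M]

theorem add_neg_one_smul {p : TotalSpace F V} (ξ η : GenTangentTotal I F V p) :
    ξ + (-1 : ℝ) • η = ξ - η :=
  Prod.ext ((congrArg (ξ.1 + ·) (neg_one_smul ℝ η.1)).trans (sub_eq_add_neg _ _).symm)
    ((congrArg (ξ.2 + ·) (neg_one_smul ℝ η.2)).trans (sub_eq_add_neg _ _).symm)

section Sum

variable {x : M} {e₁ e₂ : V x} {ξ₁ η₁ : GenTangentTotal I F V ⟨x, e₁⟩}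
  {ξ₂ η₂ : GenTangentTotal I F V ⟨x, e₂⟩} {ξ₃ η₃ : GenTangentTotal I F V ⟨x, e₁ + e₂⟩}

/-- The tangent part is fixed by linear functions, and every tangent vector at the sum is itself a
sum, on which the form is prescribed. -/
theorem IsSideSum.unique (h : IsSideSum I ξ₁ ξ₂ ξ₃) (h' : IsSideSum I ξ₁ ξ₂ η₃) : ξ₃ = η₃ := by
  have h1 := isTangentSum_iff.1 h.1
  have h2 := isTangentSum_iff.1 h'.1
  refine Prod.ext (tangent_ext (h1.1.1.trans h2.1.1.symm) fun ν => (h1.2 ν).trans (h2.2 ν).symm)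
    (ContinuousLinearMap.ext fun v => ?_)
  obtain ⟨v₁, v₂, hv⟩ := exists_isTangentSum_eq (F := F) (e₁ := e₁) (e₂ := e₂) v
  rw [h.2 _ _ _ hv, h'.2 _ _ _ hv]

theorem IsSideSum.add (h : IsSideSum I ξ₁ ξ₂ ξ₃) (h' : IsSideSum I η₁ η₂ η₃) :
    IsSideSum I (ξ₁ + η₁) (ξ₂ + η₂) (ξ₃ + η₃) := by
  refine ⟨IsTangentSum.add h.1 h'.1, fun v₁ v₂ v₃ hv => ?_⟩
  refine (congrArg₂ (· + ·) (h.2 _ _ _ hv) (h'.2 _ _ _ hv)).trans ?_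
  exact add_add_add_comm _ _ _ _

theorem IsSideSum.smul (h : IsSideSum I ξ₁ ξ₂ ξ₃) (r : ℝ) :
    IsSideSum I (r • ξ₁) (r • ξ₂) (r • ξ₃) := by
  refine ⟨IsTangentSum.smul h.1 r, fun v₁ v₂ v₃ hv => ?_⟩
  exact (congrArg (r * ·) (h.2 _ _ _ hv)).trans (mul_add _ _ _)

theorem IsSideSum.sub (h : IsSideSum I ξ₁ ξ₂ ξ₃) (h' : IsSideSum I η₁ η₂ η₃) :
    IsSideSum I (ξ₁ - η₁) (ξ₂ - η₂) (ξ₃ - η₃) := by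
  have h1 := h.add (h'.smul (-1))
  simpa only [add_neg_one_smul] using h1

theorem isSideSum_coreLift (τ₁ τ₂ : Core I V x) :
    IsSideSum I (coreLift I (⟨x, e₁⟩ : TotalSpace F V) τ₁)
      (coreLift I (⟨x, e₂⟩ : TotalSpace F V) τ₂)
      (coreLift I (⟨x, e₁ + e₂⟩ : TotalSpace F V) (τ₁ + τ₂)) := by
  refine ⟨isTangentSum_vertical τ₁.1 τ₂.1, fun v₁ v₂ v₃ hv => ?_⟩
  have h := isTangentSum_iff.1 hv
  exact congrArg₂ (· + ·) (congrArg τ₁.2 h.1.1) (congrArg τ₂.2 h.1.2)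

theorem IsSideSum.sideMap_eq (h : IsSideSum I ξ₁ ξ₂ ξ₃) :
    sideMap I ⟨x, e₁ + e₂⟩ ξ₃ = sideMap I ⟨x, e₁⟩ ξ₁ ∧ sideMap I ⟨x, e₁ + e₂⟩ ξ₃ = sideMap I ⟨x, e₂⟩ ξ₂ := by
  have h1 := isTangentSum_iff.1 h.1
  refine ⟨Prod.ext h1.1.1 (ContinuousLinearMap.ext fun c => ?_),
    Prod.ext h1.1.2 (ContinuousLinearMap.ext fun c => ?_)⟩
  · have h2 := h.2 _ _ _ (isTangentSum_vertical c 0)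
    rw [add_zero, map_zero (verticalLift I (⟨x, e₂⟩ : TotalSpace F V)), map_zero ξ₂.2,
      add_zero] at h2
    exact h2
  · have h2 := h.2 _ _ _ (isTangentSum_vertical 0 c)
    rw [zero_add, map_zero (verticalLift I (⟨x, e₁⟩ : TotalSpace F V)), map_zero ξ₁.2,
      zero_add] at h2
    exact h2

theorem isSideSum_coreLift_iff {τ₁ τ₂ τ₃ : Core I V x} :
    IsSideSum I (coreLift I (⟨x, e₁⟩ : TotalSpace F V) τ₁)
      (coreLift I (⟨x, e₂⟩ : TotalSpace F V) τ₂)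
      (coreLift I (⟨x, e₁ + e₂⟩ : TotalSpace F V) τ₃) ↔ τ₃ = τ₁ + τ₂ :=
  ⟨fun h => coreLift_injective (⟨x, e₁ + e₂⟩ : TotalSpace F V) (h.unique (isSideSum_coreLift τ₁ τ₂)),
    fun h => h ▸ isSideSum_coreLift τ₁ τ₂⟩

end Sum

section Scale

variable {c : ℝ} {x : M} {e : V x} {ξ η : GenTangentTotal I F V ⟨x, e⟩}
  {ξ' η' : GenTangentTotal I F V ⟨x, c • e⟩}

/-- For c = 0 the derivative of the scaling misses vertical directions. Its image and the vertical
vectors always span together, and on the latter the form is fixed by the condition on the side. -/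
theorem IsSideSMul.unique (h : IsSideSMul I c ξ ξ') (h' : IsSideSMul I c ξ η') : ξ' = η' := by
  refine Prod.ext (h.1.trans h'.1.symm) (ContinuousLinearMap.ext fun w => ?_)
  obtain ⟨v, hv⟩ : ∃ v : TangentTotal I F V ⟨x, e⟩, dProj I ⟨x, e⟩ v = dProj I ⟨x, c • e⟩ w :=
    ⟨_, dProj_dProjSection (I := I) (⟨x, e⟩ : TotalSpace F V) _⟩
  obtain ⟨d, hd⟩ := exists_vertical_of_dProj_eq_zero (w := w - dScale I c e v) (by
    rw [map_sub, dProj_dScale, hv, sub_self])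
  have h1 : w = verticalLift I ⟨x, c • e⟩ d + dScale I c e v := by rw [hd, sub_add_cancel]
  have h2 : ξ'.2 (verticalLift I ⟨x, c • e⟩ d) = η'.2 (verticalLift I ⟨x, c • e⟩ d) :=
    congrArg (fun A : DualFibre V x => A d) (h.2.2.trans h'.2.2.symm)
  rw [h1, map_add, map_add, h.2.1, h'.2.1, h2]

theorem IsSideSMul.add (h : IsSideSMul I c ξ ξ') (h' : IsSideSMul I c η η') :
    IsSideSMul I c (ξ + η) (ξ' + η') := by
  refine ⟨(congrArg₂ (· + ·) h.1 h'.1).trans (map_add (dScale I c e) ξ.1 η.1).symm, fun v => ?_, ?_⟩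
  · exact (congrArg₂ (· + ·) (h.2.1 v) (h'.2.1 v)).trans (mul_add _ _ _).symm
  · rw [sideMap_add, sideMap_add]
    exact congrArg₂ (· + ·) h.2.2 h'.2.2

theorem IsSideSMul.smul (h : IsSideSMul I c ξ ξ') (r : ℝ) : IsSideSMul I c (r • ξ) (r • ξ') := by
  refine ⟨(congrArg (r • ·) h.1).trans (map_smul (dScale I c e) r ξ.1).symm, fun v => ?_, ?_⟩
  · exact (congrArg (r * ·) (h.2.1 v)).trans (mul_left_comm _ _ _)
  · rw [sideMap_smul, sideMap_smul]
    exact congrArg (r • ·) h.2.2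

theorem IsSideSMul.sub (h : IsSideSMul I c ξ ξ') (h' : IsSideSMul I c η η') :
    IsSideSMul I c (ξ - η) (ξ' - η') := by
  have h1 := h.add (h'.smul (-1))
  simpa only [add_neg_one_smul] using h1

theorem dScale_verticalLift (c : ℝ) (e w : V x) :
    dScale I c e (verticalLift I (⟨x, e⟩ : TotalSpace F V) w) =
      verticalLift I (⟨x, c • e⟩ : TotalSpace F V) (c • w) := by
  refine tangent_ext ?_ fun ν => ?_
  · rw [dProj_dScale, dProj_vertical, dProj_vertical]
  · rw [dReal_linFun_dScale, dReal_linFun_vertical, dReal_linFun_vertical]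
    exact (map_smul (ν x).2 c w).symm

theorem isSideSMul_coreLift (c : ℝ) (e : V x) (τ : Core I V x) :
    IsSideSMul I c (coreLift I (⟨x, e⟩ : TotalSpace F V) τ)
      (coreLift I (⟨x, c • e⟩ : TotalSpace F V) (c • τ)) := by
  refine ⟨(dScale_verticalLift c e τ.1).symm, fun v => ?_, ?_⟩
  · exact congrArg (c * τ.2 ·) (dProj_dScale c e v)
  · rw [sideMap_coreLift, sideMap_coreLift]

theorem IsSideSMul.sideMap_eq (h : IsSideSMul I c ξ ξ') :
    sideMap I ⟨x, c • e⟩ ξ' = sideMap I ⟨x, e⟩ ξ :=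
  Prod.ext ((congrArg (dProj I ⟨x, c • e⟩) h.1).trans (dProj_dScale c e ξ.1)) h.2.2

theorem isSideSMul_coreLift_iff {τ τ' : Core I V x} :
    IsSideSMul I c (coreLift I (⟨x, e⟩ : TotalSpace F V) τ)
      (coreLift I (⟨x, c • e⟩ : TotalSpace F V) τ') ↔ τ' = c • τ :=
  ⟨fun h => coreLift_injective (⟨x, c • e⟩ : TotalSpace F V) (h.unique (isSideSMul_coreLift c e τ)),
    fun h => h ▸ isSideSMul_coreLift c e τ⟩

end Scale

section Lift

variable {D : SideSection I (V := V) (F := F) →ₗ[ℝ] SideSection I (V := V) (F := F) →ₗ[ℝ]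
    SideSection I (V := V) (F := F)} [I.Boundaryless]

/-- All functions ℓ in the defining formula of the lift are additive along the fibre, hence so is
the lift. -/
theorem isSideSum_liftAt (hD : IsDullBracket (prTM I V) D) (ν : SideSection I (V := V) (F := F))
    {x : M} (e₁ e₂ : V x) : IsSideSum I (liftAt hD ⟨x, e₁⟩ ν) (liftAt hD ⟨x, e₂⟩ ν)
      (liftAt hD ⟨x, e₁ + e₂⟩ ν) := by
  have h₁ := isLift_liftAt hD ν ⟨x, e₁⟩
  have h₂ := isLift_liftAt hD ν ⟨x, e₂⟩
  have h₃ := isLift_liftAt hD ν ⟨x, e₁ + e₂⟩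
  have hlin : ∀ μ : SideSection I (V := V) (F := F), linFun μ ⟨x, e₁ + e₂⟩ =
    linFun μ ⟨x, e₁⟩ + linFun μ ⟨x, e₂⟩ := fun μ => map_add (μ x).2 e₁ e₂
  have hs : IsTangentSum I (liftAt hD ⟨x, e₁⟩ ν).1 (liftAt hD ⟨x, e₂⟩ ν).1
      (liftAt hD ⟨x, e₁ + e₂⟩ ν).1 := by
    rw [isTangentSum_iff]
    refine ⟨⟨h₃.1.trans h₁.1.symm, h₃.1.trans h₂.1.symm⟩, fun μ => ?_⟩
    rw [h₁.dReal_linFun', h₂.dReal_linFun', h₃.dReal_linFun', hlin]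
  refine ⟨hs, fun v₁ v₂ v₃ hv => ?_⟩
  rw [isTangentSum_iff] at hv hs
  obtain ⟨μ, hμ⟩ := exists_sideSection_fst (⟨x, e₁ + e₂⟩ : TotalSpace F V) v₃
  rw [h₁.2 μ v₁ (hv.1.1.symm.trans hμ), h₂.2 μ v₂ (hv.1.2.symm.trans hμ), h₃.2 μ v₃ hμ,
    hlin, hs.2, hv.2]
  ring

theorem isSideSMul_liftAt (hD : IsDullBracket (prTM I V) D) (ν : SideSection I (V := V) (F := F))
    (c : ℝ) {x : M} (e : V x) : IsSideSMul I c (liftAt hD ⟨x, e⟩ ν) (liftAt hD ⟨x, c • e⟩ ν) := by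
  have h₁ := isLift_liftAt hD ν ⟨x, e⟩
  have h₂ := isLift_liftAt hD ν ⟨x, c • e⟩
  have hlin : ∀ μ : SideSection I (V := V) (F := F), linFun μ ⟨x, c • e⟩ =
    c * linFun μ ⟨x, e⟩ := fun μ => map_smul (μ x).2 c e
  refine ⟨tangent_ext ?_ fun μ => ?_, fun v => ?_, ?_⟩
  · rw [dProj_dScale]
    exact h₂.1.trans h₁.1.symm
  · rw [dReal_linFun_dScale, h₁.dReal_linFun', h₂.dReal_linFun', hlin]
  · obtain ⟨μ, hμ⟩ := exists_sideSection_fst (⟨x, e⟩ : TotalSpace F V) v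
    rw [h₁.2 μ v hμ, h₂.2 μ _ ((dProj_dScale c e v).trans hμ), hlin, dReal_linFun_dScale,
      h₁.dReal_linFun', h₂.dReal_linFun', hlin]
    ring
  · rw [sideMap_liftAt, sideMap_liftAt]

end Lift

end SideStructure

/-! ### The complex Lie algebroid induced by a dull bracket. -/

section Algebroids

variable {EM : Type*} [NormedAddCommGroup EM] [NormedSpace ℝ EM] [FiniteDimensional ℝ EM] {HM : Type*} [TopologicalSpace HM]
  {I : ModelWithCorners ℝ EM HM} {M : Type*} [TopologicalSpace M] [ChartedSpace HM M]
  [IsManifold I ∞ M]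
  {G : Type*} [NormedAddCommGroup G] [NormedSpace ℝ G]
  {W : M → Type*} [TopologicalSpace (TotalSpace G W)] [∀ x, AddCommGroup (W x)]
  [∀ x, Module ℝ (W x)] [∀ x, TopologicalSpace (W x)] [FiberBundle G W] [VectorBundle ℝ G W]
  [∀ x, IsTopologicalAddGroup (W x)] [∀ x, ContinuousSMul ℝ (W x)]
  {j : BundleHom I G W G W}
  {D A : Cₛ^∞⟮I; G, W⟯ →ₗ[ℝ] Cₛ^∞⟮I; G, W⟯ →ₗ[ℝ] Cₛ^∞⟮I; G, W⟯}

/-- The action of an endomorphism of a vector bundle on its sections, as a linear map. -/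
def endSection (j : BundleHom I G W G W) : Cₛ^∞⟮I; G, W⟯ →ₗ[ℝ] Cₛ^∞⟮I; G, W⟯ where
  toFun := j.mapSection
  map_add' s t := ContMDiffSection.ext fun x => map_add (j x) (s x) (t x)
  map_smul' r s := ContMDiffSection.ext fun x => map_smul (j x) r (s x)

theorem endSection_apply (j : BundleHom I G W G W) (s : Cₛ^∞⟮I; G, W⟯) :
    endSection j s = j.mapSection s := rfl

theorem mapSection_mapSection (hj : ∀ x (w : W x), j x (j x w) = -w) (s : Cₛ^∞⟮I; G, W⟯) :
    j.mapSection (j.mapSection s) = -s := ContMDiffSection.ext fun x => hj x (s x)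

theorem toHolomorphic_injective {s t : Cₛ^∞⟮I; G, W⟯}
    (h : toHolomorphic j s = toHolomorphic j t) : s = t := by
  have h1 : (1 / 2 : ℝ) • s = (1 / 2 : ℝ) • t := congrArg Prod.fst h
  simpa using congrArg ((2 : ℝ) • ·) h1

/-- A bracket realises at most one complex bracket. -/
theorem Realises.unique {A' : Cₛ^∞⟮I; G, W⟯ →ₗ[ℝ] Cₛ^∞⟮I; G, W⟯ →ₗ[ℝ] Cₛ^∞⟮I; G, W⟯}
    (h : Realises j D A) (h' : Realises j D A') : A = A' :=
  LinearMap.ext fun s => LinearMap.ext fun t => toHolomorphic_injective ((h s t).symm.trans (h' s t))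

/-- These are the real and imaginary parts of the realisation condition; each side carries a product
of factors ½, which explains the 2. -/
theorem realises_iff : Realises j D A ↔ ∀ s t,
    D s t - D (j.mapSection s) (j.mapSection t) = (2 : ℝ) • A s t ∧
    D (j.mapSection s) t + D s (j.mapSection t) = (2 : ℝ) • j.mapSection (A s t) := by
  refine forall₂_congr fun s t => ?_
  have h1 : complexifiedBracket D (toHolomorphic j s) (toHolomorphic j t) =
      ((1 / 4 : ℝ) • (D s t - D (j.mapSection s) (j.mapSection t)),
        -((1 / 4 : ℝ) • (D (j.mapSection s) t + D s (j.mapSection t)))) := by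
    simp only [complexifiedBracket, toHolomorphic, map_smul, map_neg, LinearMap.smul_apply,
      LinearMap.neg_apply]
    refine Prod.ext ?_ ?_
    · module
    · module
  rw [h1, toHolomorphic, Prod.mk.injEq]
  refine and_congr ⟨fun h => ?_, fun h => ?_⟩ ⟨fun h => ?_, fun h => ?_⟩
  · have := congrArg ((4 : ℝ) • ·) h
    simp only [smul_smul] at this
    norm_num at this
    exact this
  · rw [h]; module
  · have := congrArg ((-4 : ℝ) • ·) h
    simp only [smul_smul, smul_neg] at this
    norm_num at this
    rw [add_comm]
    exact this
  · rw [h]; module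

/-- The complex bracket defined by a real bracket. -/
def complexBracket (j : BundleHom I G W G W)
    (D : Cₛ^∞⟮I; G, W⟯ →ₗ[ℝ] Cₛ^∞⟮I; G, W⟯ →ₗ[ℝ] Cₛ^∞⟮I; G, W⟯) :
    Cₛ^∞⟮I; G, W⟯ →ₗ[ℝ] Cₛ^∞⟮I; G, W⟯ →ₗ[ℝ] Cₛ^∞⟮I; G, W⟯ :=
  (1 / 2 : ℝ) • (D - D.compl₁₂ (endSection j) (endSection j))

theorem complexBracket_apply (s t : Cₛ^∞⟮I; G, W⟯) : complexBracket j D s t =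
    (1 / 2 : ℝ) • (D s t - D (j.mapSection s) (j.mapSection t)) := rfl

/-- The hypothesis expresses D(s,t) - D(js,jt) as -j of the mixed brackets; applying j removes this
j because j² = -1. -/
theorem mapSection_complexBracket (hj : ∀ x (w : W x), j x (j x w) = -w)
    (h : ∀ s t, D s t - D (j.mapSection s) (j.mapSection t) +
      j.mapSection (D (j.mapSection s) t + D s (j.mapSection t)) = 0) (s t : Cₛ^∞⟮I; G, W⟯) :
    j.mapSection (complexBracket j D s t) =
      (1 / 2 : ℝ) • (D (j.mapSection s) t + D s (j.mapSection t)) := by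
  have h1 := h s t
  rw [complexBracket_apply, eq_neg_of_add_eq_zero_left h1, ← endSection_apply, map_smul, map_neg]
  rw [endSection_apply, mapSection_mapSection hj, neg_neg]

/-- The vanishing of the Nijenhuis expression of j is what makes the complexified bracket of
sections of the i-eigenbundle stay in it. -/
theorem realises_complexBracket (hj : ∀ x (w : W x), j x (j x w) = -w)
    (h : ∀ s t, D s t - D (j.mapSection s) (j.mapSection t) +
      j.mapSection (D (j.mapSection s) t + D s (j.mapSection t)) = 0) :
    Realises j D (complexBracket j D) := by
  rw [realises_iff]
  intro s t
  rw [mapSection_complexBracket hj h, complexBracket_apply, smul_smul, smul_smul]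
  norm_num

/-- The complex anchor, as a bundle morphism. -/
theorem exists_complexAnchor [FiniteDimensional ℝ G] [T2Space M]
    [ContMDiffVectorBundle ∞ G W I] (j : BundleHom I G W G W)
    (ρ : BundleHom I G W EM (fun x : M => TangentSpace I x)) :
    ∃ a : BundleHom I G W (EM × EM) (ComplexTangent I M), ∀ x w, a x w = complexAnchor j ρ x w := by
  let a : ∀ x, W x →L[ℝ] ComplexTangent I M x := fun x =>
    ((1 / 2 : ℝ) • ρ x).prod (-((1 / 2 : ℝ) • (ρ x).comp (j x)))
  refine ⟨⟨a, fun x => ?_⟩, fun x w => rfl⟩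
  refine contMDiffAt_hom_of_sections (W₂ := ComplexTangent I M) a x Set.univ (fun s _ => ?_)
    fun w => (exists_section I G w).imp fun s hs => ⟨trivial, hs⟩
  exact (pairSection ((1 / 2 : ℝ) • ρ.mapSection s)
    (-((1 / 2 : ℝ) • ρ.mapSection (j.mapSection s)))).contMDiff x

theorem dComplex_apply {f : M → ℂ} (hf : ContMDiff I 𝓘(ℝ, ℂ) ∞ f) (x : M) (v : TangentSpace I x) :
    dComplex I f x v = dReal I (fun y => (f y).re) x v + dReal I (fun y => (f y).im) x v * Complex.I := by
  have h1 := mfderiv_comp x (Complex.reCLM.contMDiff (n := ∞) |>.mdifferentiable (by simp) (f x))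
    (hf.mdifferentiable (by simp) x)
  have h2 := mfderiv_comp x (Complex.imCLM.contMDiff (n := ∞) |>.mdifferentiable (by simp) (f x))
    (hf.mdifferentiable (by simp) x)
  have h3 : dReal I (fun y => (f y).re) x v = (dComplex I f x v).re := by
    refine (congrArg (fun A : EM →L[ℝ] ℝ => A v) h1).trans ?_
    have h5 : (mfderiv 𝓘(ℝ, ℂ) 𝓘(ℝ, ℝ) Complex.reCLM (f x) : ℂ →L[ℝ] ℝ) = Complex.reCLM :=
      mfderiv_eq_fderiv.trans Complex.reCLM.fderiv
    exact congrArg (fun A : ℂ →L[ℝ] ℝ => A (dComplex I f x v)) h5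
  have h4 : dReal I (fun y => (f y).im) x v = (dComplex I f x v).im := by
    refine (congrArg (fun A : EM →L[ℝ] ℝ => A v) h2).trans ?_
    have h5 : (mfderiv 𝓘(ℝ, ℂ) 𝓘(ℝ, ℝ) Complex.imCLM (f x) : ℂ →L[ℝ] ℝ) = Complex.imCLM :=
      mfderiv_eq_fderiv.trans Complex.imCLM.fderiv
    exact congrArg (fun A : ℂ →L[ℝ] ℝ => A (dComplex I f x v)) h5
  rw [h3, h4, Complex.re_add_im]

/-- With f = a + ib, the real Leibniz rule of D applies to four terms. The derivatives of a and b
along ρ(s) and ρ(js) assemble to the derivative of f along ½(ρ(s) - iρ(js)). -/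
theorem complexBracket_leibniz {ρ : BundleHom I G W EM (fun x : M => TangentSpace I x)}
    (hD : IsDullBracket ρ D) (hj : ∀ x (w : W x), j x (j x w) = -w)
    (h : ∀ s t, D s t - D (j.mapSection s) (j.mapSection t) +
      j.mapSection (D (j.mapSection s) t + D s (j.mapSection t)) = 0)
    (f : C^∞⟮I, M; 𝓘(ℝ, ℂ), ℂ⟯) (s t : Cₛ^∞⟮I; G, W⟯) (x : M) :
    complexBracket j D s (complexSMulSection j f t) x =
      complexSMul j (complexLieDeriv (complexAnchor j ρ x (s x)) f) (t x) +
        complexSMul j (f x) (complexBracket j D s t x) := by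
  set a : C^∞⟮I, M; ℝ⟯ := ⟨fun x => (f x).re, Complex.reCLM.contMDiff.comp f.contMDiff⟩ with ha
  set b : C^∞⟮I, M; ℝ⟯ := ⟨fun x => (f x).im, Complex.imCLM.contMDiff.comp f.contMDiff⟩ with hb
  have h0 : complexSMulSection j f t = smulSection a t + smulSection b (j.mapSection t) := rfl
  have h1 : j.mapSection (complexSMulSection j f t) =
      smulSection a (j.mapSection t) - smulSection b t := by
    refine ContMDiffSection.ext fun y => ?_
    refine (map_add (j y) _ _).trans ?_
    refine (congrArg₂ (· + ·) (map_smul (j y) (a y) (t y)) (map_smul (j y) (b y) (j y (t y)))).trans ?_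
    rw [hj, smul_neg, ← sub_eq_add_neg]
    rfl
  have h2 : complexBracket j D s (complexSMulSection j f t) x = (1 / 2 : ℝ) •
      ((D s (smulSection a t) x + D s (smulSection b (j.mapSection t)) x) -
      (D (j.mapSection s) (smulSection a (j.mapSection t)) x - D (j.mapSection s) (smulSection b t) x)) := by
    rw [complexBracket_apply, h1, h0, map_add, map_sub]
    rfl
  have h3 := congrArg (fun u : Cₛ^∞⟮I; G, W⟯ => u x) (mapSection_complexBracket hj h s t)
  have h4 : j x (complexBracket j D s t x) =
    (1 / 2 : ℝ) • (D (j.mapSection s) t x + D s (j.mapSection t) x) := h3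
  have h5 : complexBracket j D s t x =
    (1 / 2 : ℝ) • (D s t x - D (j.mapSection s) (j.mapSection t) x) := rfl
  have h6 : complexLieDeriv (complexAnchor j ρ x (s x)) f = ((1 / 2 : ℝ) * (dReal I a x (ρ x (s x)) +
      dReal I b x (ρ x (j x (s x)))) : ℝ) + ((1 / 2 : ℝ) * (dReal I b x (ρ x (s x)) -
      dReal I a x (ρ x (j x (s x)))) : ℝ) * Complex.I := by
    have h7 : complexLieDeriv (complexAnchor j ρ x (s x)) f =
      dComplex I f x ((1 / 2 : ℝ) • ρ x (s x)) +
        Complex.I * dComplex I f x (-((1 / 2 : ℝ) • ρ x (j x (s x)))) := rfl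
    rw [h7, map_neg, map_smul, map_smul, dComplex_apply f.contMDiff, dComplex_apply f.contMDiff]
    have h8 : ∀ v, dReal I (fun y => (f y).re) x v = dReal I a x v := fun _ => rfl
    have h9 : ∀ v, dReal I (fun y => (f y).im) x v = dReal I b x v := fun _ => rfl
    simp only [h8, h9]
    refine Complex.ext ?_ ?_ <;> simp <;> ring
  have h10 : (j.mapSection t) x = j x (t x) := rfl
  have h11 : (j.mapSection s) x = j x (s x) := rfl
  have ha' : a x = (f x).re := rfl
  have hb' : b x = (f x).im := rfl
  rw [h2, hD.smul_right, hD.smul_right, hD.smul_right, hD.smul_right, complexSMul, complexSMul, h4, h5,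
    h6, h10, h11, ← ha', ← hb']
  simp only [Complex.add_re, Complex.add_im, Complex.ofReal_re, Complex.ofReal_im, Complex.mul_re,
    Complex.mul_im, Complex.I_re, Complex.I_im, mul_zero, mul_one, zero_add, add_zero, sub_zero]
  module

/-- The complex Lie algebroid realised by a dull bracket. -/
theorem exists_complexLieAlgebroid [FiniteDimensional ℝ G] [T2Space M]
    [ContMDiffVectorBundle ∞ G W I] {ρ : BundleHom I G W EM (fun x : M => TangentSpace I x)}
    (hD : IsDullBracket ρ D) (hj : ∀ x (w : W x), j x (j x w) = -w)
    (h : ∀ s t, D s t - D (j.mapSection s) (j.mapSection t) +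
      j.mapSection (D (j.mapSection s) t + D s (j.mapSection t)) = 0)
    (hself : ∀ s, complexBracket j D s s = 0)
    (hjac : ∀ s t u, complexBracket j D s (complexBracket j D t u) +
      complexBracket j D t (complexBracket j D u s) +
      complexBracket j D u (complexBracket j D s t) = 0) :
    ∃ A : ComplexLieAlgebroid j, A.bracket = complexBracket j D ∧
      ∀ x w, A.anchor x w = complexAnchor j ρ x w := by
  obtain ⟨a, ha⟩ := exists_complexAnchor j ρ
  have hneg : ∀ s t, D (-s) t = -D s t := fun s t => by rw [map_neg, LinearMap.neg_apply]
  refine ⟨⟨hj, complexBracket j D, fun s t => ?_, fun s t => ?_, hself, hjac, a, fun x w => ?_,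
    fun f s t x => ?_⟩, rfl, ha⟩
  · rw [mapSection_complexBracket hj h, complexBracket_apply, mapSection_mapSection hj, hneg,
      sub_neg_eq_add]
  · rw [mapSection_complexBracket hj h, complexBracket_apply, mapSection_mapSection hj, map_neg,
      sub_neg_eq_add, add_comm]
  · rw [ha, ha]
    refine Prod.ext (neg_neg _).symm ?_
    have h1 : ρ x (j x (j x w)) = -ρ x w := by rw [hj, map_neg]
    exact (congrArg (fun v => -((1 / 2 : ℝ) • v)) h1).trans (by rw [smul_neg, neg_neg]; rfl)
  · rw [ha]
    exact complexBracket_leibniz hD hj h f s t x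

end Algebroids

/-! ### The induced endomorphism of the core, and the Nijenhuis tensor in the splitting. -/

section CoreEnd

variable {EM : Type*} [NormedAddCommGroup EM] [NormedSpace ℝ EM] [FiniteDimensional ℝ EM]
  {HM : Type*} [TopologicalSpace HM]
  {I : ModelWithCorners ℝ EM HM} {M : Type*} [TopologicalSpace M] [ChartedSpace HM M]
  [IsManifold I ∞ M]
  {F : Type*} [NormedAddCommGroup F] [NormedSpace ℝ F] [FiniteDimensional ℝ F]
  {V : M → Type*} [TopologicalSpace (TotalSpace F V)] [∀ x, AddCommGroup (V x)]
  [∀ x, Module ℝ (V x)] [∀ x, TopologicalSpace (V x)]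
  [∀ x, IsTopologicalAddGroup (V x)] [∀ x, ContinuousSMul ℝ (V x)]
  [FiberBundle F V] [VectorBundle ℝ F V] [ContMDiffVectorBundle ∞ F V I]

theorem sideHom_add {x : M} (A : Side I V x →L[ℝ] Side I V x) (μ ν : Side I V x) :
    A (μ + ν) = A μ + A ν := A.map_add' μ ν

theorem sideHom_smul {x : M} (A : Side I V x →L[ℝ] Side I V x) (r : ℝ) (ν : Side I V x) :
    A (r • ν) = r • A ν := A.map_smul' r ν

theorem exists_coreEnd (F : Type*) [NormedAddCommGroup F] [NormedSpace ℝ F] [FiniteDimensional ℝ F]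
    [TopologicalSpace (TotalSpace F V)] [FiberBundle F V] [VectorBundle ℝ F V] {x : M}
    (A : Side I V x →L[ℝ] Side I V x) (τ : Core I V x) :
    ∃ κ : Core I V x, ∀ ν, sidePairing ν κ = -sidePairing (A ν) τ :=
  exists_core F
    { toFun := fun ν => -sidePairing (A ν) τ
      map_add' := fun μ ν => by rw [sideHom_add, sidePairing_add_left, neg_add]
      map_smul' := fun r ν => by
        rw [sideHom_smul, sidePairing_smul_left, RingHom.id_apply, smul_eq_mul, mul_neg] }

/-- The negative of the transpose of an endomorphism of the side, as an endomorphism of the core. -/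
def coreEnd (j : SideEnd I V (F := F)) (x : M) : Core I V x →ₗ[ℝ] Core I V x where
  toFun τ := (exists_coreEnd F (j x) τ).choose
  map_add' σ τ := core_ext F fun ν => by
    rw [(exists_coreEnd F (j x) (σ + τ)).choose_spec, sidePairing_add_right, sidePairing_add_right,
      (exists_coreEnd F (j x) σ).choose_spec, (exists_coreEnd F (j x) τ).choose_spec, neg_add]
  map_smul' r τ := core_ext F fun ν => by
    rw [(exists_coreEnd F (j x) (r • τ)).choose_spec, RingHom.id_apply, sidePairing_smul_right,
      sidePairing_smul_right, (exists_coreEnd F (j x) τ).choose_spec, mul_neg]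

theorem sidePairing_coreEnd (j : SideEnd I V (F := F)) {x : M} (ν : Side I V x) (τ : Core I V x) :
    sidePairing ν (coreEnd j x τ) = -sidePairing (j x ν) τ :=
  (exists_coreEnd F (j x) τ).choose_spec ν

theorem coreEnd_coreEnd {j : SideEnd I V (F := F)} (hj : ∀ x (ν : Side I V x), j x (j x ν) = -ν)
    {x : M} (τ : Core I V x) : coreEnd j x (coreEnd j x τ) = -τ := core_ext F fun ν => by
  rw [sidePairing_coreEnd, sidePairing_coreEnd, hj, sidePairing_neg_left, sidePairing_neg_right,
    neg_neg]

variable [T2Space M]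

/-- The action of `coreEnd j` on sections. -/
def coreEndSection (j : SideEnd I V (F := F)) (τ : Cₛ^∞⟮I; F × (EM →L[ℝ] ℝ), Core I V⟯) :
    Cₛ^∞⟮I; F × (EM →L[ℝ] ℝ), Core I V⟯ :=
  ⟨fun x => coreEnd j x (τ x), contMDiff_core_of_sidePairing _ fun ν => by
    simp only [sidePairing_coreEnd]
    exact (contMDiff_sidePairing (j.mapSection ν) τ).neg⟩

variable [I.Boundaryless]
  {D : SideSection I (V := V) (F := F) →ₗ[ℝ] SideSection I (V := V) (F := F) →ₗ[ℝ]
    SideSection I (V := V) (F := F)} {j : SideEnd I V (F := F)}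
  {𝒥 : GenEnd (I.prod 𝓘(ℝ, F)) (TotalSpace F V)}

/-- `𝒥` intertwines the horizontal lifts of `ν` and `j ν`. -/
def LiftsTo (hD : IsDullBracket (prTM I V) D) (j : SideEnd I V (F := F))
    (𝒥 : GenEnd (I.prod 𝓘(ℝ, F)) (TotalSpace F V)) : Prop :=
  ∀ (ν : SideSection I (V := V) (F := F)) p, 𝒥 p (liftAt hD p ν) = liftAt hD p (j.mapSection ν)

/-- `𝒥` acts on the core by `coreEnd j`. -/
def ActsOnCore (j : SideEnd I V (F := F)) (𝒥 : GenEnd (I.prod 𝓘(ℝ, F)) (TotalSpace F V)) : Prop :=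
  ∀ (p : TotalSpace F V) τ, 𝒥 p (coreLift I p τ) = coreLift I p (coreEnd j p.proj τ)

theorem LiftsTo.mapSection {hD : IsDullBracket (prTM I V) D} (h : LiftsTo hD j 𝒥)
    (ν : SideSection I (V := V) (F := F)) :
    𝒥.mapSection (liftSection hD ν) = liftSection hD (j.mapSection ν) :=
  ContMDiffSection.ext fun p => h ν p

theorem ActsOnCore.mapSection (h : ActsOnCore j 𝒥)
    (τ : Cₛ^∞⟮I; F × (EM →L[ℝ] ℝ), Core I V⟯) :
    𝒥.mapSection (coreSection τ) = coreSection (coreEndSection j τ) :=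
  ContMDiffSection.ext fun p => h p _

/-- The curvature-like expression that computes Courant brackets of lifts. -/
def dullCurvature (D : SideSection I (V := V) (F := F) →ₗ[ℝ] SideSection I (V := V) (F := F) →ₗ[ℝ]
    SideSection I (V := V) (F := F)) (ν₁ ν₂ ν₃ : SideSection I (V := V) (F := F)) :
    SideSection I (V := V) (F := F) := D ν₁ (D ν₂ ν₃) - D ν₂ (D ν₁ ν₃) + D ν₃ (D ν₁ ν₂)

theorem nijenhuisForm_liftSection {hD : IsDullBracket (prTM I V) D} (h : LiftsTo hD j 𝒥)
    (ν₁ ν₂ ν₃ : SideSection I (V := V) (F := F)) (p : TotalSpace F V) :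
    nijenhuisForm 𝒥 (liftSection hD ν₁) (liftSection hD ν₂) (liftSection hD ν₃) p =
      linFun (dullCurvature D ν₁ ν₂ ν₃ - dullCurvature D (j.mapSection ν₁) (j.mapSection ν₂) ν₃ -
        dullCurvature D (j.mapSection ν₁) ν₂ (j.mapSection ν₃) -
        dullCurvature D ν₁ (j.mapSection ν₂) (j.mapSection ν₃)) p := by
  simp only [nijenhuisForm, h.mapSection, genPairing_courantBracket_liftSection]
  rfl

/-- Two of the four terms contain 𝒥τ^↑; transposing j back to the side turns them into j applied to
the mixed brackets of D. -/
theorem nijenhuisForm_liftSection_coreSection {hD : IsDullBracket (prTM I V) D} (h : LiftsTo hD j 𝒥)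
    (hc : ActsOnCore j 𝒥) (ν₁ ν₂ : SideSection I (V := V) (F := F))
    (τ : Cₛ^∞⟮I; F × (EM →L[ℝ] ℝ), Core I V⟯) (p : TotalSpace F V) :
    nijenhuisForm 𝒥 (liftSection hD ν₁) (liftSection hD ν₂) (coreSection τ) p =
      sidePairing ((D ν₁ ν₂ - D (j.mapSection ν₁) (j.mapSection ν₂) +
        j.mapSection (D (j.mapSection ν₁) ν₂ + D ν₁ (j.mapSection ν₂))) p.proj) (τ p.proj) := by
  simp only [nijenhuisForm, h.mapSection, hc.mapSection,
    genPairing_courantBracket_liftSection_coreSection]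
  have h1 : ∀ ν : Side I V p.proj, sidePairing ν (coreEndSection j τ p.proj) =
    -sidePairing (j p.proj ν) (τ p.proj) := fun ν => sidePairing_coreEnd j ν _
  rw [h1, h1]
  have h2 : (D ν₁ ν₂ - D (j.mapSection ν₁) (j.mapSection ν₂) +
        j.mapSection (D (j.mapSection ν₁) ν₂ + D ν₁ (j.mapSection ν₂))) p.proj =
      D ν₁ ν₂ p.proj - D (j.mapSection ν₁) (j.mapSection ν₂) p.proj +
        j p.proj (D (j.mapSection ν₁) ν₂ p.proj + D ν₁ (j.mapSection ν₂) p.proj) := rfl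
  rw [h2, sideHom_add, sidePairing_add_left, sidePairing_add_left, sidePairing_sub_left]
  ring

/-- As 𝒥 preserves the core, each of the four terms is a bracket with a core section paired with a
core section, and vanishes separately. -/
theorem nijenhuisForm_coreSection_coreSection (hc : ActsOnCore j 𝒥)
    {g : GenSections (I.prod 𝓘(ℝ, F)) (TotalSpace F V)}
    {ν ν' : SideSection I (V := V) (F := F)} (hg : ∀ p, sideMap I p (g p) = ν p.proj)
    (hg' : ∀ p, sideMap I p (𝒥.mapSection g p) = ν' p.proj)
    (σ τ : Cₛ^∞⟮I; F × (EM →L[ℝ] ℝ), Core I V⟯) (p : TotalSpace F V) :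
    nijenhuisForm 𝒥 g (coreSection σ) (coreSection τ) p = 0 := by
  simp only [nijenhuisForm, hc.mapSection, genPairing_courantBracket_coreSection hg,
    genPairing_courantBracket_coreSection hg', sub_zero]

variable {A : SideSection I (V := V) (F := F) →ₗ[ℝ] SideSection I (V := V) (F := F) →ₗ[ℝ]
    SideSection I (V := V) (F := F)}

/-- The Jacobiator of the complex bracket in terms of a bracket realising it. -/
theorem dullCurvature_eq_jacobiator (h : Realises j D A) (hA : ∀ s t, A s t = -A t s)
    (ν₁ ν₂ ν₃ : SideSection I (V := V) (F := F)) :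
    dullCurvature D ν₁ ν₂ ν₃ - dullCurvature D (j.mapSection ν₁) (j.mapSection ν₂) ν₃ -
        dullCurvature D (j.mapSection ν₁) ν₂ (j.mapSection ν₃) -
        dullCurvature D ν₁ (j.mapSection ν₂) (j.mapSection ν₃) =
      (4 : ℝ) • (A ν₁ (A ν₂ ν₃) + A ν₂ (A ν₃ ν₁) + A ν₃ (A ν₁ ν₂)) := by
  rw [realises_iff] at h
  -- The realisation identities are used twice, for the inner and for the outer bracket, which gives
  -- 4 = 2 · 2. The twelve iterated brackets of the left-hand side form three groups of this shape.
  have key : ∀ s t u, D s (D t u) - D s (D (j.mapSection t) (j.mapSection u)) -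
      (D (j.mapSection s) (D (j.mapSection t) u) + D (j.mapSection s) (D t (j.mapSection u))) =
      (4 : ℝ) • A s (A t u) := fun s t u => by
    rw [← map_sub, ← map_add, (h t u).1, (h t u).2, map_smul, map_smul, ← smul_sub, (h _ _).1,
      smul_smul]
    norm_num
  have h1 := key ν₁ ν₂ ν₃
  have h2 := key ν₂ ν₁ ν₃
  have h3 := key ν₃ ν₁ ν₂
  rw [hA ν₃ ν₁, map_neg, smul_add, smul_add, smul_neg, ← h1, ← h2, ← h3]
  simp only [dullCurvature]
  abel

end CoreEnd

/-! ### Dependence of the lifts and of the realised bracket on the dull bracket. -/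

section Comparison

variable {EM : Type*} [NormedAddCommGroup EM] [NormedSpace ℝ EM] [FiniteDimensional ℝ EM]
  {HM : Type*} [TopologicalSpace HM]
  {I : ModelWithCorners ℝ EM HM} {M : Type*} [TopologicalSpace M] [ChartedSpace HM M]
  [IsManifold I ∞ M]
  {F : Type*} [NormedAddCommGroup F] [NormedSpace ℝ F] [FiniteDimensional ℝ F]
  {V : M → Type*} [TopologicalSpace (TotalSpace F V)] [∀ x, AddCommGroup (V x)]
  [∀ x, Module ℝ (V x)] [∀ x, TopologicalSpace (V x)]
  [∀ x, IsTopologicalAddGroup (V x)] [∀ x, ContinuousSMul ℝ (V x)]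
  [FiberBundle F V] [VectorBundle ℝ F V] [ContMDiffVectorBundle ∞ F V I]
variable [T2Space M]
  {D D' : SideSection I (V := V) (F := F) →ₗ[ℝ] SideSection I (V := V) (F := F) →ₗ[ℝ]
    SideSection I (V := V) (F := F)}

theorem add_coreLift_form {p : TotalSpace F V} (ξ : GenTangentTotal I F V p) (δ : Core I V p.proj)
    (w : TangentTotal I F V p) : (ξ + coreLift I p δ).2 w = ξ.2 w + δ.2 (dProj I p w) := rfl

theorem dReal_linFun_add_coreLift {p : TotalSpace F V} (ξ : GenTangentTotal I F V p)
    (δ : Core I V p.proj) (μ : SideSection I (V := V) (F := F)) :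
    dReal (I.prod 𝓘(ℝ, F)) (linFun μ) p (ξ + coreLift I p δ).1 =
      dReal (I.prod 𝓘(ℝ, F)) (linFun μ) p ξ.1 + (μ p.proj).2 δ.1 :=
  (map_add (dReal (I.prod 𝓘(ℝ, F)) (linFun μ) p) ξ.1 (verticalLift I p δ.1)).trans
    (congrArg _ (dReal_linFun_vertical μ p δ.1))

/-- The change of the horizontal lift under a change of the bracket. -/
theorem IsLift.add_coreLift {ν : SideSection I (V := V) (F := F)} {p : TotalSpace F V}
    {ξ : GenTangentTotal I F V p} {δ : Core I V p.proj} (h : IsLift D ν p ξ)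
    (hδ : ∀ μ, linFun (D' ν μ) p = linFun (D ν μ) p + sidePairing (μ p.proj) δ) :
    IsLift D' ν p (ξ + coreLift I p δ) := by
  refine ⟨?_, fun μ w hw => ?_⟩
  · refine (map_add (dProj I p) ξ.1 (verticalLift I p δ.1)).trans ?_
    rw [dProj_vertical, add_zero, h.1]
  · rw [add_coreLift_form, dReal_linFun_add_coreLift, h.2 μ w hw, hδ, hw, sidePairing]
    ring

theorem IsLift.linFun_eq_of_add_coreLift {ν : SideSection I (V := V) (F := F)}
    {p : TotalSpace F V} {ξ : GenTangentTotal I F V p} {δ : Core I V p.proj} (h : IsLift D ν p ξ)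
    (h' : IsLift D' ν p (ξ + coreLift I p δ)) (μ : SideSection I (V := V) (F := F)) :
    linFun (D' ν μ) p = linFun (D ν μ) p + sidePairing (μ p.proj) δ := by
  have hw : dProj I p (dProjSection p (μ p.proj).1) = (μ p.proj).1 := dProj_dProjSection p _
  have h1 := h'.2 μ _ hw
  rw [add_coreLift_form, dReal_linFun_add_coreLift, h.2 μ _ hw, hw] at h1
  rw [sidePairing]
  linarith

/-- The function ℓ sees only the V*-component, so the vector fields must be compared separately. -/
theorem sideSection_ext_of_linFun {μ ν : SideSection I (V := V) (F := F)}
    (h : ∀ x, (μ x).1 = (ν x).1) (hl : ∀ p, linFun μ p = linFun ν p) : μ = ν :=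
  ContMDiffSection.ext fun x => Prod.ext (h x) (ContinuousLinearMap.ext fun v => hl ⟨x, v⟩)

variable [I.Boundaryless] {j : SideEnd I V (F := F)}
  {𝒥 : GenComplexStructure (I.prod 𝓘(ℝ, F)) (TotalSpace F V)}

/-- `IsLift` determines the lift, so neither the dual connection nor the section e through a point
matters. -/
theorem isAdapted_iff (hD : IsDullBracket (prTM I V) D) :
    IsAdapted 𝒥 j D ↔ LiftsTo hD j 𝒥.toHom := by
  constructor
  · rintro ⟨Δ, hΔ, h⟩ ν ⟨x, v⟩
    obtain ⟨e, rfl⟩ := exists_section I F v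
    rw [(isLift_liftAt hD ν ⟨x, e x⟩).unique (isLift_horizontalLift hΔ ν e x),
      (isLift_liftAt hD (j.mapSection ν) ⟨x, e x⟩).unique
        (isLift_horizontalLift hΔ (j.mapSection ν) e x)]
    exact h ν e x
  · intro h
    obtain ⟨Δ, hΔ⟩ := exists_isDual hD
    refine ⟨Δ, hΔ, fun ν e x => ?_⟩
    rw [← (isLift_liftAt hD ν ⟨x, e x⟩).unique (isLift_horizontalLift hΔ ν e x),
      ← (isLift_liftAt hD (j.mapSection ν) ⟨x, e x⟩).unique
        (isLift_horizontalLift hΔ (j.mapSection ν) e x)]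
    exact h ν _

/-- The difference of two dull brackets determines the difference of their lifts. -/
theorem exists_liftAt_eq_add_coreLift (hD : IsDullBracket (prTM I V) D)
    (hD' : IsDullBracket (prTM I V) D') (ν : SideSection I (V := V) (F := F))
    (p : TotalSpace F V) : ∃ δ : Core I V p.proj, liftAt hD' p ν = liftAt hD p ν + coreLift I p δ ∧
      ∀ μ, sidePairing (μ p.proj) δ = linFun (D' ν μ - D ν μ) p := by
  obtain ⟨δ, hδ⟩ := exists_liftAt_add_coreLift hD (sideMap_liftAt hD' ν p)
  refine ⟨δ, hδ.symm, fun μ => ?_⟩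
  have h := (isLift_liftAt hD ν p).linFun_eq_of_add_coreLift
    (hδ.symm ▸ isLift_liftAt hD' ν p : IsLift D' ν p (liftAt hD p ν + coreLift I p δ)) μ
  have h1 : linFun (D' ν μ - D ν μ) p = linFun (D' ν μ) p - linFun (D ν μ) p := rfl
  rw [h1, h]
  ring

/-- For brackets of which one is adapted, being adapted is a condition on the difference. -/
theorem liftsTo_iff {𝒥 : GenEnd (I.prod 𝓘(ℝ, F)) (TotalSpace F V)}
    (hc : ActsOnCore j 𝒥) {hD : IsDullBracket (prTM I V) D} (h : LiftsTo hD j 𝒥)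
    (hD' : IsDullBracket (prTM I V) D') :
    LiftsTo hD' j 𝒥 ↔ ∀ ν μ, D' (j.mapSection ν) μ - D (j.mapSection ν) μ =
      -(D' ν (j.mapSection μ) - D ν (j.mapSection μ)) := by
  -- The changes of σ(ν) and σ(jν) are core elements δ and κ. As D is adapted and 𝒥 acts on the core
  -- by the negative transpose of j, the condition is that this transpose maps δ to κ.
  have key : ∀ (ν : SideSection I (V := V) (F := F)) p,
      𝒥 p (liftAt hD' p ν) = liftAt hD' p (j.mapSection ν) ↔
      ∀ μ, linFun (D' (j.mapSection ν) μ - D (j.mapSection ν) μ) p =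
        -linFun (D' ν (j.mapSection μ) - D ν (j.mapSection μ)) p := by
    intro ν p
    obtain ⟨δ, hδ, hδ'⟩ := exists_liftAt_eq_add_coreLift hD hD' ν p
    obtain ⟨κ, hκ, hκ'⟩ := exists_liftAt_eq_add_coreLift hD hD' (j.mapSection ν) p
    have h1 : 𝒥 p (liftAt hD' p ν) = liftAt hD p (j.mapSection ν) +
        coreLift I p (coreEnd j p.proj δ) := by
      rw [hδ, ← h ν p, ← hc p δ]
      exact (𝒥 p).map_add' _ _
    have h2 : ∀ μ : SideSection I (V := V) (F := F), sidePairing (μ p.proj) (coreEnd j p.proj δ) =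
        -linFun (D' ν (j.mapSection μ) - D ν (j.mapSection μ)) p := fun μ => by
      rw [sidePairing_coreEnd, ← hδ']
      rfl
    rw [h1, hκ, add_right_inj]
    refine ⟨fun h3 μ => ?_, fun h3 => congrArg _ ?_⟩
    · rw [← hκ', ← h2, coreLift_injective p h3]
    · refine core_ext_of_sections (F := F) fun μ => ?_
      rw [h2, hκ', h3]
  refine ⟨fun h1 ν μ => sideSection_ext_of_linFun (fun x => ?_) fun p => (key ν p).1 (h1 ν p) μ,
    fun h1 ν p => (key ν p).2 fun μ => congrArg (fun κ => linFun κ p) (h1 ν μ)⟩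
  have h2 : ∀ κ μ, (D' κ μ x).1 - (D κ μ x).1 = 0 := fun κ μ =>
    sub_eq_zero.2 ((hD'.anchor_bracket κ μ x).trans (hD.anchor_bracket κ μ x).symm)
  exact (h2 _ _).trans (neg_zero.symm.trans (congrArg Neg.neg (h2 _ _).symm))

/-- For brackets of which one realises a complex bracket, realising it is a condition on the
difference. -/
theorem Realises.realises_iff_sub (hj : ∀ x (ν : Side I V x), j x (j x ν) = -ν)
    {A : SideSection I (V := V) (F := F) →ₗ[ℝ] SideSection I (V := V) (F := F) →ₗ[ℝ]
      SideSection I (V := V) (F := F)} (h : Realises j D A) :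
    Realises j D' A ↔ ∀ ν μ, D' (j.mapSection ν) μ - D (j.mapSection ν) μ =
      -(D' ν (j.mapSection μ) - D ν (j.mapSection μ)) := by
  rw [realises_iff] at h ⊢
  constructor
  · intro h' ν μ
    have h1 := (h' ν μ).2.trans (h ν μ).2.symm
    rw [neg_sub, sub_eq_sub_iff_add_eq_add, h1, add_comm]
  · intro h' s t
    have hj' := mapSection_mapSection (j := j) hj t
    -- For the difference B of the brackets, replacing t by jt in B(js,t) = -B(s,jt) gives B(js,jt)
    -- = B(s,t), which is the real part of the condition.
    have h1 := h' s (j.mapSection t)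
    rw [hj', map_neg, map_neg] at h1
    have h2 := h' s t
    constructor
    · rw [← (h s t).1]
      refine sub_eq_sub_iff_sub_eq_sub.2 ?_
      rw [h1]
      abel
    · rw [← (h s t).2, ← sub_eq_zero, add_sub_add_comm, h2, neg_add_cancel]

/-- A dull bracket realises the complex bracket realised by an adapted bracket if and only if it is
adapted. -/
theorem realises_iff_liftsTo (hj : ∀ x (ν : Side I V x), j x (j x ν) = -ν)
    {𝒥 : GenEnd (I.prod 𝓘(ℝ, F)) (TotalSpace F V)}
    (hc : ActsOnCore j 𝒥) {hD : IsDullBracket (prTM I V) D} (h : LiftsTo hD j 𝒥)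
    {A : SideSection I (V := V) (F := F) →ₗ[ℝ] SideSection I (V := V) (F := F) →ₗ[ℝ]
      SideSection I (V := V) (F := F)} (hA : Realises j D A) (hD' : IsDullBracket (prTM I V) D') :
    Realises j D' A ↔ LiftsTo hD' j 𝒥 :=
  (hA.realises_iff_sub hj).trans (liftsTo_iff hc h hD').symm

theorem sideMap_neg (p : TotalSpace F V) (ξ : GenTangentTotal I F V p) :
    sideMap I p (-ξ) = -sideMap I p ξ :=
  Prod.ext (map_neg (dProj I p) ξ.1) rfl

/-- The identity 𝒥² = -1 descends along the side projection, every element of the side being the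
image of a lift. The point p is arbitrary and is taken on the zero section. -/
theorem side_j_sq (h : IsLinearOver 𝒥 j) (hD : IsDullBracket (prTM I V) D) (x : M)
    (ν : Side I V x) : j x (j x ν) = -ν := by
  obtain ⟨μ, rfl⟩ := exists_section_eq_side (F := F) ν
  let p : TotalSpace F V := ⟨x, 0⟩
  have h1 := h.side p (𝒥.toHom p (liftAt hD p μ))
  rw [𝒥.sq, h.side, sideMap_liftAt] at h1
  exact h1.symm.trans ((sideMap_neg p _).trans (congrArg Neg.neg (sideMap_liftAt hD μ p)))

/-- 𝒥 covers j, hence preserves the kernel of the side projection. Skewness then gives ⟨ξ, 𝒥τ^↑⟩ =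
-⟨𝒥ξ, τ^↑⟩, and the right-hand side depends only on j applied to the side of ξ. -/
theorem actsOnCore (h : IsLinearOver 𝒥 j) (hD : IsDullBracket (prTM I V) D) :
    ActsOnCore j 𝒥.toHom := by
  intro p τ
  obtain ⟨κ, hκ⟩ := exists_coreLift_of_sideMap_eq_zero (ξ := 𝒥.toHom p (coreLift I p τ)) (by
    rw [h.side, sideMap_coreLift]; exact (j p.proj).map_zero)
  rw [← hκ]
  refine congrArg _ (core_ext_of_sections (F := F) fun μ => ?_)
  rw [sidePairing_coreEnd, ← sideMap_liftAt hD μ p, ← h.side, ← genPairing_coreLift,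
    ← genPairing_coreLift, hκ, genPairing_apply_left 𝒥.sq 𝒥.orthogonal, neg_neg]

/-- Two linear generalised complex structures with the same side and a common adapted bracket are
equal. -/
theorem GenComplexStructure.eq_of_liftsTo
    {𝒥' : GenComplexStructure (I.prod 𝓘(ℝ, F)) (TotalSpace F V)} (h : IsLinearOver 𝒥 j)
    (h' : IsLinearOver 𝒥' j) {hD : IsDullBracket (prTM I V) D} (hl : LiftsTo hD j 𝒥.toHom)
    (hl' : LiftsTo hD j 𝒥'.toHom) : 𝒥 = 𝒥' := by
  refine GenComplexStructure.ext (DFunLike.ext _ _ fun p => ContinuousLinearMap.ext fun ξ => ?_)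
  obtain ⟨ν, hν⟩ := exists_section_eq_side (F := F) (sideMap I p ξ)
  obtain ⟨τ, rfl⟩ := exists_liftAt_add_coreLift hD hν.symm
  refine ((𝒥.toHom p).map_add' _ _).trans (Eq.trans ?_ ((𝒥'.toHom p).map_add' _ _).symm)
  exact congrArg₂ (· + ·) ((hl ν p).trans (hl' ν p).symm)
    ((actsOnCore h hD p τ).trans (actsOnCore h' hD p τ).symm)

end Comparison

/-! ### Bundle morphisms determined on sections. -/

section OfSections

variable {EM : Type*} [NormedAddCommGroup EM] [NormedSpace ℝ EM] {HM : Type*} [TopologicalSpace HM]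
  {I : ModelWithCorners ℝ EM HM} {M : Type*} [TopologicalSpace M] [ChartedSpace HM M]
  {G₁ : Type*} [NormedAddCommGroup G₁] [NormedSpace ℝ G₁] [FiniteDimensional ℝ G₁]
  {W₁ : M → Type*} [TopologicalSpace (TotalSpace G₁ W₁)] [∀ x, AddCommGroup (W₁ x)]
  [∀ x, Module ℝ (W₁ x)] [∀ x, TopologicalSpace (W₁ x)] [FiberBundle G₁ W₁] [VectorBundle ℝ G₁ W₁]
  {G₂ : Type*} [NormedAddCommGroup G₂] [NormedSpace ℝ G₂]
  {W₂ : M → Type*} [TopologicalSpace (TotalSpace G₂ W₂)] [∀ x, AddCommGroup (W₂ x)]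
  [∀ x, Module ℝ (W₂ x)] [∀ x, TopologicalSpace (W₂ x)] [FiberBundle G₂ W₂] [VectorBundle ℝ G₂ W₂]
  [∀ x, IsTopologicalAddGroup (W₂ x)] [∀ x, ContinuousSMul ℝ (W₂ x)]

/-- The bundle morphism defined by a family of linear maps that maps a spanning set of smooth
sections to smooth sections. -/
def BundleHom.ofSections (φ : ∀ x, W₁ x →L[ℝ] W₂ x) (S : Set Cₛ^∞⟮I; G₁, W₁⟯)
    (hφ : ∀ s ∈ S, ∃ t : Cₛ^∞⟮I; G₂, W₂⟯, ∀ x, φ x (s x) = t x)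
    (hS : ∀ x (w : W₁ x), ∃ s ∈ S, s x = w) : BundleHom I G₁ W₁ G₂ W₂ :=
  ⟨φ, fun x => contMDiffAt_hom_of_sections φ x S (fun s hs => by
    obtain ⟨t, ht⟩ := hφ s hs
    simp only [ht]
    exact t.contMDiff x) (hS x)⟩

end OfSections

/-! ### The generalised complex structure built from a realising dull bracket. -/

section FromAlgebroid

variable {EM : Type*} [NormedAddCommGroup EM] [NormedSpace ℝ EM] [FiniteDimensional ℝ EM]
  {HM : Type*} [TopologicalSpace HM]
  {I : ModelWithCorners ℝ EM HM} {M : Type*} [TopologicalSpace M] [ChartedSpace HM M]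
  [IsManifold I ∞ M]
  {F : Type*} [NormedAddCommGroup F] [NormedSpace ℝ F] [FiniteDimensional ℝ F]
  {V : M → Type*} [TopologicalSpace (TotalSpace F V)] [∀ x, AddCommGroup (V x)]
  [∀ x, Module ℝ (V x)] [∀ x, TopologicalSpace (V x)]
  [∀ x, IsTopologicalAddGroup (V x)] [∀ x, ContinuousSMul ℝ (V x)]
  [FiberBundle F V] [VectorBundle ℝ F V] [ContMDiffVectorBundle ∞ F V I]
variable [T2Space M] [I.Boundaryless]
  {D : SideSection I (V := V) (F := F) →ₗ[ℝ] SideSection I (V := V) (F := F) →ₗ[ℝ]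
    SideSection I (V := V) (F := F)}

theorem exists_eq_liftAt_add_coreLift (hD : IsDullBracket (prTM I V) D) {p : TotalSpace F V}
    (ξ : GenTangentTotal I F V p) : ∃ (ν : SideSection I (V := V) (F := F)) (τ : Core I V p.proj),
      liftAt hD p ν + coreLift I p τ = ξ := by
  obtain ⟨ν, hν⟩ := exists_section_eq_side (F := F) (sideMap I p ξ)
  exact ⟨ν, exists_liftAt_add_coreLift hD hν.symm⟩

theorem sideMap_liftAt_add_coreLift (hD : IsDullBracket (prTM I V) D) {p : TotalSpace F V}
    (ν : SideSection I (V := V) (F := F)) (τ : Core I V p.proj) :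
    sideMap I p (liftAt hD p ν + coreLift I p τ) = ν p.proj := by
  rw [sideMap_add, sideMap_liftAt, sideMap_coreLift, add_zero]

/-- The value at `ξ` of the endomorphism that acts on lifts by `j` and on the core by
`coreEnd j`. -/
theorem exists_liftEnd_apply (hD : IsDullBracket (prTM I V) D) (j : SideEnd I V (F := F))
    {p : TotalSpace F V} (ξ : GenTangentTotal I F V p) :
    ∃ η : GenTangentTotal I F V p, ∀ (ν : SideSection I (V := V) (F := F)) τ,
      liftAt hD p ν + coreLift I p τ = ξ →
        η = liftAt hD p (j.mapSection ν) + coreLift I p (coreEnd j p.proj τ) := by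
  obtain ⟨ν, τ, rfl⟩ := exists_eq_liftAt_add_coreLift hD ξ
  refine ⟨_, fun ν' τ' h => (rfl : liftAt hD p (j.mapSection ν) +
    coreLift I p (coreEnd j p.proj τ) = _).trans ?_⟩
  -- A decomposition determines the value of ν at the base point and hence τ, so the result is
  -- independent of the choice.
  have h1 : ν' p.proj = ν p.proj := by
    rw [← sideMap_liftAt_add_coreLift hD ν' τ', h, sideMap_liftAt_add_coreLift]
  rw [liftAt_congr hD h1, add_right_inj] at h
  rw [coreLift_injective p h, liftAt_congr hD (μ := j.mapSection ν') (ν := j.mapSection ν)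
    (congrArg (j p.proj) h1)]

/-- The endomorphism of `TE ⊕ T*E` at `p` that acts on lifts by `j` and on the core by
`coreEnd j`. -/
def liftEndLinear (hD : IsDullBracket (prTM I V) D) (j : SideEnd I V (F := F))
    (p : TotalSpace F V) : GenTangentTotal I F V p →ₗ[ℝ] GenTangentTotal I F V p where
  toFun ξ := (exists_liftEnd_apply hD j ξ).choose
  map_add' ξ η := by
    obtain ⟨ν, τ, hξ⟩ := exists_eq_liftAt_add_coreLift hD ξ
    obtain ⟨ν', τ', hη⟩ := exists_eq_liftAt_add_coreLift hD η
    rw [(exists_liftEnd_apply hD j ξ).choose_spec ν τ hξ,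
      (exists_liftEnd_apply hD j η).choose_spec ν' τ' hη,
      (exists_liftEnd_apply hD j (ξ + η)).choose_spec (ν + ν') (τ + τ') (by
        rw [map_add, coreLift_add, ← hξ, ← hη]; abel)]
    have h1 : j.mapSection (ν + ν') = j.mapSection ν + j.mapSection ν' :=
      (endSection j).map_add ν ν'
    rw [h1, map_add, map_add, coreLift_add]
    abel
  map_smul' r ξ := by
    obtain ⟨ν, τ, hξ⟩ := exists_eq_liftAt_add_coreLift hD ξ
    rw [(exists_liftEnd_apply hD j ξ).choose_spec ν τ hξ,
      (exists_liftEnd_apply hD j (r • ξ)).choose_spec (r • ν) (r • τ) (by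
        rw [map_smul, coreLift_smul, ← hξ, smul_add])]
    have h1 : j.mapSection (r • ν) = r • j.mapSection ν := (endSection j).map_smul r ν
    rw [h1, map_smul, map_smul, coreLift_smul, RingHom.id_apply, smul_add]

theorem liftEndLinear_apply (hD : IsDullBracket (prTM I V) D) (j : SideEnd I V (F := F))
    (p : TotalSpace F V) (ν : SideSection I (V := V) (F := F)) (τ : Core I V p.proj) :
    liftEndLinear hD j p (liftAt hD p ν + coreLift I p τ) =
      liftAt hD p (j.mapSection ν) + coreLift I p (coreEnd j p.proj τ) :=
  (exists_liftEnd_apply hD j _).choose_spec ν τ rfl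

theorem continuous_endomorphism_model
    (f : ((EM × F) × (EM × F →L[ℝ] ℝ)) →ₗ[ℝ] ((EM × F) × (EM × F →L[ℝ] ℝ))) : Continuous f :=
  f.continuous_of_finiteDimensional

/-- `liftEndLinear` as a continuous linear map. -/
def liftEndAt (hD : IsDullBracket (prTM I V) D) (j : SideEnd I V (F := F))
    (p : TotalSpace F V) : GenTangentTotal I F V p →L[ℝ] GenTangentTotal I F V p where
  toLinearMap := liftEndLinear hD j p
  cont := continuous_endomorphism_model (liftEndLinear hD j p)

/-- The endomorphism of `TE ⊕ T*E` that acts on lifts by `j` and on the core by `coreEnd j`. -/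
def liftEnd (hD : IsDullBracket (prTM I V) D) (j : SideEnd I V (F := F)) :
    GenEnd (I.prod 𝓘(ℝ, F)) (TotalSpace F V) :=
  BundleHom.ofSections (W₁ := GenTangent (I.prod 𝓘(ℝ, F)) (TotalSpace F V))
    (W₂ := GenTangent (I.prod 𝓘(ℝ, F)) (TotalSpace F V)) (liftEndAt hD j)
    {g | ∃ (ν : SideSection I (V := V) (F := F)) (τ : Cₛ^∞⟮I; F × (EM →L[ℝ] ℝ), Core I V⟯),
        g = liftSection hD ν + coreSection τ}
    (by
      rintro g ⟨ν, τ, rfl⟩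
      exact ⟨liftSection hD (j.mapSection ν) + coreSection (coreEndSection j τ),
        fun q => liftEndLinear_apply hD j q ν (τ q.proj)⟩)
    (fun p ξ => by
      obtain ⟨ν, τ, rfl⟩ := exists_eq_liftAt_add_coreLift hD ξ
      obtain ⟨τ, rfl⟩ := exists_section_eq_core (F := F) τ
      exact ⟨_, ⟨ν, τ, rfl⟩, rfl⟩)

theorem liftEnd_apply (hD : IsDullBracket (prTM I V) D) (j : SideEnd I V (F := F))
    (p : TotalSpace F V) (ν : SideSection I (V := V) (F := F)) (τ : Core I V p.proj) :
    liftEnd hD j p (liftAt hD p ν + coreLift I p τ) =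
      liftAt hD p (j.mapSection ν) + coreLift I p (coreEnd j p.proj τ) :=
  liftEndLinear_apply hD j p ν τ

theorem coreLift_zero (p : TotalSpace F V) : coreLift I p (0 : Core I V p.proj) = 0 :=
  Prod.ext (map_zero (verticalLift I p)) rfl

theorem liftsTo_liftEnd (hD : IsDullBracket (prTM I V) D) (j : SideEnd I V (F := F)) :
    LiftsTo hD j (liftEnd hD j) := fun ν p => by
  have h := liftEnd_apply hD j p ν 0
  rwa [map_zero, coreLift_zero, add_zero, add_zero] at h

theorem actsOnCore_liftEnd (hD : IsDullBracket (prTM I V) D) (j : SideEnd I V (F := F)) :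
    ActsOnCore j (liftEnd hD j) := fun p τ => by
  have h := liftEnd_apply hD j p 0 τ
  have h1 : j.mapSection (0 : SideSection I (V := V) (F := F)) = 0 := (endSection j).map_zero
  rwa [h1, map_zero, zero_add, zero_add] at h

theorem sideMap_liftEnd (hD : IsDullBracket (prTM I V) D) (j : SideEnd I V (F := F))
    (p : TotalSpace F V) (ξ : GenTangentTotal I F V p) :
    sideMap I p (liftEnd hD j p ξ) = j p.proj (sideMap I p ξ) := by
  obtain ⟨ν, τ, rfl⟩ := exists_eq_liftAt_add_coreLift hD ξ
  rw [liftEnd_apply, sideMap_liftAt_add_coreLift, sideMap_liftAt_add_coreLift]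
  rfl

theorem liftEnd_liftEnd (hD : IsDullBracket (prTM I V) D) {j : SideEnd I V (F := F)}
    (hj : ∀ x (ν : Side I V x), j x (j x ν) = -ν) (p : TotalSpace F V)
    (ξ : GenTangentTotal I F V p) : liftEnd hD j p (liftEnd hD j p ξ) = -ξ := by
  obtain ⟨ν, τ, rfl⟩ := exists_eq_liftAt_add_coreLift hD ξ
  rw [liftEnd_apply, liftEnd_apply, mapSection_mapSection hj, coreEnd_coreEnd hj, map_neg,
    coreLift_neg, neg_add]

theorem genPairing_liftAt_add_coreLift (hD : IsDullBracket (prTM I V) D) {p : TotalSpace F V}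
    (μ ν : SideSection I (V := V) (F := F)) (σ τ : Core I V p.proj) :
    genPairing (I.prod 𝓘(ℝ, F)) (liftAt hD p μ + coreLift I p σ) (liftAt hD p ν + coreLift I p τ) =
      linFun (D μ ν + D ν μ) p + sidePairing (μ p.proj) τ + sidePairing (ν p.proj) σ := by
  rw [genPairing_add_right, genPairing_coreLift, sideMap_liftAt_add_coreLift, genPairing_add_left,
    genPairing_liftAt, genPairing_comm, genPairing_coreLift, sideMap_liftAt]
  ring

/-- The pairing of lifts sees only the symmetric part of D, which is assumed invariant under j.
Between side and core, j and its negative transpose cancel by j² = -1. -/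
theorem genPairing_liftEnd (hD : IsDullBracket (prTM I V) D) {j : SideEnd I V (F := F)}
    (hj : ∀ x (ν : Side I V x), j x (j x ν) = -ν)
    (h : ∀ μ ν, D (j.mapSection μ) (j.mapSection ν) + D (j.mapSection ν) (j.mapSection μ) =
      D μ ν + D ν μ) (p : TotalSpace F V) (ξ η : GenTangentTotal I F V p) :
    genPairing (I.prod 𝓘(ℝ, F)) (liftEnd hD j p ξ) (liftEnd hD j p η) =
      genPairing (I.prod 𝓘(ℝ, F)) ξ η := by
  obtain ⟨μ, σ, rfl⟩ := exists_eq_liftAt_add_coreLift hD ξ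
  obtain ⟨ν, τ, rfl⟩ := exists_eq_liftAt_add_coreLift hD η
  have h1 : ∀ (μ : SideSection I (V := V) (F := F)) (τ : Core I V p.proj),
      sidePairing (j.mapSection μ p.proj) (coreEnd j p.proj τ) = sidePairing (μ p.proj) τ :=
    fun μ τ => by
      refine (sidePairing_coreEnd j _ τ).trans ?_
      refine (congrArg (fun κ => -sidePairing κ τ) (hj _ (μ p.proj))).trans ?_
      rw [sidePairing_neg_left, neg_neg]
  rw [liftEnd_apply, liftEnd_apply, genPairing_liftAt_add_coreLift, genPairing_liftAt_add_coreLift,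
    h, h1, h1]

/-- The generalised complex structure defined by a dull bracket realising a complex bracket. -/
theorem exists_genComplexStructure (hD : IsDullBracket (prTM I V) D) {j : SideEnd I V (F := F)}
    (A : ComplexLieAlgebroid j) (hA : Realises j D A.bracket) :
    ∃ 𝒥 : GenComplexStructure (I.prod 𝓘(ℝ, F)) (TotalSpace F V), 𝒥.toHom = liftEnd hD j := by
  have hskew : ∀ s t, A.bracket s t = -A.bracket t s := fun s t => by
    have h := A.bracket_self (s + t)
    rw [map_add, bracket_add_left, bracket_add_left, A.bracket_self, A.bracket_self, zero_add,
      add_zero] at h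
    exact eq_neg_of_add_eq_zero_right h
  have hr := realises_iff.1 hA
  have hl := liftsTo_liftEnd hD j
  have hc := actsOnCore_liftEnd hD j
  have hsq := liftEnd_liftEnd hD A.j_sq
  -- Skew-symmetry of A makes D(μ,ν) - D(jμ,jν) skew, so the symmetric part of D is invariant under
  -- j.
  have hor := genPairing_liftEnd hD A.j_sq fun μ ν => by
    have h1 := (hr μ ν).1
    have h2 := (hr ν μ).1
    rw [hskew, smul_neg, ← h2] at h1
    have h3 : D μ ν + D ν μ - (D (j.mapSection μ) (j.mapSection ν) +
      D (j.mapSection ν) (j.mapSection μ)) = 0 := by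
      rw [add_sub_add_comm, h1, neg_add_cancel]
    exact (sub_eq_zero.1 h3).symm
  have hN : ∀ s t, D s t - D (j.mapSection s) (j.mapSection t) +
      j.mapSection (D (j.mapSection s) t + D s (j.mapSection t)) = 0 := fun s t => by
    rw [(hr s t).1, (hr s t).2, ← endSection_apply, map_smul, endSection_apply,
      mapSection_mapSection A.j_sq, smul_neg, add_neg_cancel]
  have hσσσ : ∀ (ν₁ ν₂ ν₃ : SideSection I (V := V) (F := F)) p, nijenhuisForm (liftEnd hD j)
      (liftSection hD ν₁) (liftSection hD ν₂) (liftSection hD ν₃) p = 0 := fun ν₁ ν₂ ν₃ p => by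
    rw [nijenhuisForm_liftSection hl, dullCurvature_eq_jacobiator hA hskew, A.jacobi, smul_zero]
    rfl
  have hσστ : ∀ (ν₁ ν₂ : SideSection I (V := V) (F := F))
      (τ : Cₛ^∞⟮I; F × (EM →L[ℝ] ℝ), Core I V⟯) p, nijenhuisForm (liftEnd hD j)
      (liftSection hD ν₁) (liftSection hD ν₂) (coreSection τ) p = 0 := fun ν₁ ν₂ τ p => by
    rw [nijenhuisForm_liftSection_coreSection hl hc, hN]
    have h1 := sidePairing_smul_left (0 : ℝ) (0 : Side I V p.proj) (τ p.proj)
    rw [zero_smul, zero_mul] at h1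
    exact h1
  have hgττ : ∀ (g : GenSections (I.prod 𝓘(ℝ, F)) (TotalSpace F V))
      (ν : SideSection I (V := V) (F := F)), (∀ p, sideMap I p (g p) = ν p.proj) →
      ∀ (σ τ : Cₛ^∞⟮I; F × (EM →L[ℝ] ℝ), Core I V⟯) p,
        nijenhuisForm (liftEnd hD j) g (coreSection σ) (coreSection τ) p = 0 := fun g ν hg σ τ p =>
    nijenhuisForm_coreSection_coreSection hc hg (ν' := j.mapSection ν)
      (fun q => (sideMap_liftEnd hD j q (g q)).trans (congrArg (j q.proj) (hg q))) σ τ p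
  have hswap := nijenhuisForm_swap_left hsq hor
  have hswap' := nijenhuisForm_swap_right hsq hor
  refine ⟨⟨liftEnd hD j, hsq, hor, fun e₁ e₂ x => ?_⟩, rfl⟩
  -- Lifts and core sections are the generators. Alternation reduces the eight combinations to three
  -- lifts (the Jacobi identity), two lifts and a core section (`hN`), and at least two core
  -- sections.
  refine nijenhuis_eq_zero_of_generators hsq hor
    ({g | ∃ ν, g = liftSection hD ν} ∪ {g | ∃ τ, g = coreSection τ}) (fun p ξ => ?_) ?_ e₁ e₂ x
  · obtain ⟨ν, τ, rfl⟩ := exists_eq_liftAt_add_coreLift hD ξ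
    obtain ⟨τ, rfl⟩ := exists_section_eq_core (F := F) τ
    exact ⟨_, Or.inl ⟨ν, rfl⟩, _, Or.inr ⟨τ, rfl⟩, rfl⟩
  · have hσ : ∀ (ν : SideSection I (V := V) (F := F)) p,
      sideMap I p (liftSection hD ν p) = ν p.proj := fun ν p => sideMap_liftAt hD ν p
    have hτ : ∀ (τ : Cₛ^∞⟮I; F × (EM →L[ℝ] ℝ), Core I V⟯) (p : TotalSpace F V),
      sideMap I p (coreSection τ p) = (0 : SideSection I (V := V) (F := F)) p.proj :=
        fun τ p => sideMap_coreLift p _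
    rintro g₁ (⟨ν₁, rfl⟩ | ⟨τ₁, rfl⟩) g₂ (⟨ν₂, rfl⟩ | ⟨τ₂, rfl⟩) g₃ (⟨ν₃, rfl⟩ | ⟨τ₃, rfl⟩) p
    · exact hσσσ ν₁ ν₂ ν₃ p
    · exact hσστ ν₁ ν₂ τ₃ p
    · rw [hswap', hσστ, neg_zero]
    · exact hgττ _ ν₁ (hσ ν₁) τ₂ τ₃ p
    · rw [hswap, hswap', hσστ, neg_zero, neg_zero]
    · rw [hswap, hgττ _ ν₂ (hσ ν₂), neg_zero]
    · rw [hswap', hswap, hgττ _ ν₃ (hσ ν₃), neg_zero, neg_zero]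
    · exact hgττ _ 0 (hτ τ₁) τ₂ τ₃ p

/-- Elements in a sum or a multiple have a common side, hence can be written with lifts of the same
ν. Their core parts then add or scale linearly, and both kinds of summand are respected by
`liftEnd`. -/
theorem isLinearOver_of_liftEnd (hD : IsDullBracket (prTM I V) D) {j : SideEnd I V (F := F)}
    {𝒥 : GenComplexStructure (I.prod 𝓘(ℝ, F)) (TotalSpace F V)} (h : 𝒥.toHom = liftEnd hD j) :
    IsLinearOver 𝒥 j := by
  refine ⟨fun p ξ => ?_, fun x e₁ e₂ ξ₁ ξ₂ ξ₃ hξ => ?_, fun c x e ξ ξ' hξ => ?_⟩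
  · rw [h, sideMap_liftEnd]
  · obtain ⟨ν, hν⟩ := exists_section_eq_side (F := F) (sideMap I ⟨x, e₁ + e₂⟩ ξ₃)
    have hs := hξ.sideMap_eq
    obtain ⟨τ₁, rfl⟩ := exists_liftAt_add_coreLift hD (p := ⟨x, e₁⟩) (ν := ν) (hs.1.symm.trans hν.symm)
    obtain ⟨τ₂, rfl⟩ := exists_liftAt_add_coreLift hD (p := ⟨x, e₂⟩) (ν := ν) (hs.2.symm.trans hν.symm)
    obtain ⟨τ₃, rfl⟩ := exists_liftAt_add_coreLift hD (p := ⟨x, e₁ + e₂⟩) (ν := ν) hν.symm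
    have h1 := hξ.sub (isSideSum_liftAt hD ν e₁ e₂)
    rw [add_sub_cancel_left, add_sub_cancel_left, add_sub_cancel_left] at h1
    rw [h, liftEnd_apply, liftEnd_apply, liftEnd_apply, isSideSum_coreLift_iff.1 h1]
    refine (isSideSum_liftAt hD (j.mapSection ν) e₁ e₂).add (isSideSum_coreLift_iff.2 ?_)
    exact map_add (coreEnd j x) τ₁ τ₂
  · obtain ⟨ν, hν⟩ := exists_section_eq_side (F := F) (sideMap I ⟨x, e⟩ ξ)
    obtain ⟨τ, rfl⟩ := exists_liftAt_add_coreLift hD (p := ⟨x, e⟩) (ν := ν) hν.symm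
    obtain ⟨τ', rfl⟩ := exists_liftAt_add_coreLift hD (p := ⟨x, c • e⟩) (ν := ν)
      (hξ.sideMap_eq.trans hν.symm)
    have h1 := hξ.sub (isSideSMul_liftAt hD ν c e)
    rw [add_sub_cancel_left, add_sub_cancel_left] at h1
    rw [h, liftEnd_apply, liftEnd_apply, isSideSMul_coreLift_iff.1 h1]
    refine (isSideSMul_liftAt hD (j.mapSection ν) c e).add (isSideSMul_coreLift_iff.2 ?_)
    exact map_smul (coreEnd j x) c τ

end FromAlgebroid

/-! ### Existence of dull brackets. -/

section Existence


variable {EM : Type*} [NormedAddCommGroup EM] [NormedSpace ℝ EM] [FiniteDimensional ℝ EM]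
  {HM : Type*} [TopologicalSpace HM]
  {I : ModelWithCorners ℝ EM HM} {M : Type*} [TopologicalSpace M] [ChartedSpace HM M]
  [IsManifold I ∞ M]
  {F : Type*} [NormedAddCommGroup F] [NormedSpace ℝ F] [FiniteDimensional ℝ F]
  {V : M → Type*} [TopologicalSpace (TotalSpace F V)] [∀ x, AddCommGroup (V x)]
  [∀ x, Module ℝ (V x)] [∀ x, TopologicalSpace (V x)]
  [∀ x, IsTopologicalAddGroup (V x)] [∀ x, ContinuousSMul ℝ (V x)]
  [FiberBundle F V] [VectorBundle ℝ F V] [ContMDiffVectorBundle ∞ F V I]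
variable [T2Space M] [I.Boundaryless]

theorem tangent_ext_of_functions {x : M} {v w : TangentSpace I x}
    (h : ∀ f : C^∞⟮I, M; ℝ⟯, dReal I f x v = dReal I f x w) : v = w := by
  refine SeparatingDual.eq_iff_forall_dual_eq (R := ℝ) (V := EM) |>.2 fun g => ?_
  obtain ⟨f, hf⟩ := exists_dReal_eq (I := I) (x := x) g
  have h1 := h f
  rw [hf] at h1
  exact h1

/-- The Lie bracket of smooth vector fields. -/
def bracketField (X Y : VectorFields I M) : VectorFields I M :=
  have : CompleteSpace EM := FiniteDimensional.complete ℝ EM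
  ⟨mlieBracket I X Y, fun x => by
    refine contMDiffAt_field_of_dReal _ x {f | ContMDiff I 𝓘(ℝ, ℝ) ∞ f} (fun f hf => hf)
      (fun f hf => ?_) fun v hv => ?_
    · simp only [dReal_bracket hf]
      exact ((contMDiff_dReal_apply (contMDiff_dReal_apply hf Y) X).sub
        (contMDiff_dReal_apply (contMDiff_dReal_apply hf X) Y)) x
    · exact tangent_ext_of_functions fun f => (hv f f.contMDiff).trans (map_zero _).symm⟩

theorem dReal_bracketField (f : C^∞⟮I, M; ℝ⟯) (X Y : VectorFields I M) (x : M) :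
    dReal I f x (bracketField X Y x) =
      dReal I (fun y => dReal I f y (Y y)) x (X x) - dReal I (fun y => dReal I f y (X y)) x (Y x) :=
  have : CompleteSpace EM := FiniteDimensional.complete ℝ EM
  dReal_bracket f.contMDiff X Y x

theorem bracketField_swap (X Y : VectorFields I M) : bracketField X Y = -bracketField Y X :=
  ContMDiffSection.ext fun x => tangent_ext_of_functions fun f => by
    have h : dReal I f x ((-bracketField Y X) x) = -dReal I f x (bracketField Y X x) :=
      map_neg _ _
    rw [h, dReal_bracketField, dReal_bracketField, neg_sub]

theorem bracketField_add_right (X Y Z : VectorFields I M) :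
    bracketField X (Y + Z) = bracketField X Y + bracketField X Z :=
  ContMDiffSection.ext fun x => tangent_ext_of_functions fun f => by
    have h : dReal I f x ((bracketField X Y + bracketField X Z) x) =
      dReal I f x (bracketField X Y x) + dReal I f x (bracketField X Z x) := map_add _ _ _
    have h1 : (fun y => dReal I f y ((Y + Z) y)) = fun y => dReal I f y (Y y) + dReal I f y (Z y) :=
      funext fun y => map_add _ _ _
    have h2 : ∀ φ : Cotangent I x, φ ((Y + Z) x) = φ (Y x) + φ (Z x) := fun φ => map_add _ _ _
    rw [h, dReal_bracketField, dReal_bracketField, dReal_bracketField, h1, h2,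
      dReal_add (contMDiff_dReal_apply f.contMDiff Y) (contMDiff_dReal_apply f.contMDiff Z)]
    ring

theorem bracketField_smulSection_right (X Y : VectorFields I M) (g : C^∞⟮I, M; ℝ⟯) (x : M) :
    bracketField X (smulSection g Y) x = g x • bracketField X Y x + dReal I g x (X x) • Y x :=
  tangent_ext_of_functions fun f => by
    have h1 : (fun y => dReal I f y (smulSection g Y y)) = fun y => g y * dReal I f y (Y y) :=
      funext fun y => map_smul _ _ _
    have h2 : ∀ φ : Cotangent I x, φ (smulSection g Y x) = g x * φ (Y x) := fun φ => map_smul _ _ _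
    rw [map_add, map_smul, map_smul, dReal_bracketField, dReal_bracketField, h1, h2,
      dReal_mul g.contMDiff (contMDiff_dReal_apply f.contMDiff Y), smul_eq_mul, smul_eq_mul]
    ring

theorem bracketField_smul_right (X Y : VectorFields I M) (r : ℝ) :
    bracketField X (r • Y) = r • bracketField X Y :=
  ContMDiffSection.ext fun x => by
    refine (bracketField_smulSection_right X Y ⟨fun _ => r, contMDiff_const⟩ x).trans ?_
    refine (congrArg (fun c => r • bracketField X Y x + c • Y x) (dReal_const r x _)).trans ?_
    rw [zero_smul, add_zero]
    rfl

/-- Applied to a function, each double bracket expands into third-order iterated derivatives, which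
cancel. -/
theorem bracketField_jacobi (X Y Z : VectorFields I M) :
    bracketField X (bracketField Y Z) - bracketField Y (bracketField X Z) +
      bracketField Z (bracketField X Y) = 0 :=
  ContMDiffSection.ext fun x => tangent_ext_of_functions fun f => by
    have h : dReal I f x ((bracketField X (bracketField Y Z) - bracketField Y (bracketField X Z) +
      bracketField Z (bracketField X Y)) x) = dReal I f x (bracketField X (bracketField Y Z) x) -
      dReal I f x (bracketField Y (bracketField X Z) x) +
      dReal I f x (bracketField Z (bracketField X Y) x) :=
        (map_add _ _ _).trans (congrArg (· + _) (map_sub _ _ _))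
    have h0 : dReal I f x ((0 : VectorFields I M) x) = 0 := map_zero _
    have h1 : ∀ (X Y Z : VectorFields I M), dReal I f x (bracketField X (bracketField Y Z) x) =
        dReal I (fun y => dReal I (fun y => dReal I f y (Z y)) y (Y y)) x (X x) -
        dReal I (fun y => dReal I (fun y => dReal I f y (Y y)) y (Z y)) x (X x) -
        dReal I (fun y => dReal I f y (X y)) x (bracketField Y Z x) := fun X Y Z => by
      rw [dReal_bracketField]
      simp only [dReal_bracketField]
      rw [dReal_sub (contMDiff_dReal_apply (contMDiff_dReal_apply f.contMDiff Z) Y)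
        (contMDiff_dReal_apply (contMDiff_dReal_apply f.contMDiff Y) Z)]
    have h2 : ∀ X Y Z : VectorFields I M,
        dReal I (fun y => dReal I f y (X y)) x (bracketField Y Z x) =
        dReal I (fun y => dReal I (fun y => dReal I f y (X y)) y (Z y)) x (Y x) -
        dReal I (fun y => dReal I (fun y => dReal I f y (X y)) y (Y y)) x (Z x) := fun X Y Z =>
      dReal_bracketField ⟨_, contMDiff_dReal_apply f.contMDiff X⟩ Y Z x
    rw [h, h0, h1, h1, h1, h2, h2, h2]
    ring

variable (I M) in
/-- The Lie bracket of smooth vector fields, as a bilinear map. -/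
def bracketFieldLinear : VectorFields I M →ₗ[ℝ] VectorFields I M →ₗ[ℝ] VectorFields I M :=
  LinearMap.mk₂ ℝ bracketField
    (fun X Y Z => by
      rw [bracketField_swap, bracketField_add_right, neg_add, ← bracketField_swap,
        ← bracketField_swap])
    (fun r X Y => by rw [bracketField_swap, bracketField_smul_right, ← smul_neg,
      ← bracketField_swap])
    bracketField_add_right (fun r X Y => bracketField_smul_right X Y r)

/-- The projection to vector fields, as a linear map. -/
def fieldPart : SideSection I (V := V) (F := F) →ₗ[ℝ] VectorFields I M where
  toFun ν := fstSection ν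
  map_add' _ _ := rfl
  map_smul' _ _ := rfl

/-- The projection to sections of the dual bundle, as a linear map. -/
def formPart : SideSection I (V := V) (F := F) →ₗ[ℝ] Cₛ^∞⟮I; F →L[ℝ] ℝ, fun x => DualFibre V x⟯ where
  toFun ν := sndSection ν
  map_add' _ _ := rfl
  map_smul' _ _ := rfl

/-- The inclusion of vector fields, as a linear map. -/
def fieldInclusion : VectorFields I M →ₗ[ℝ] SideSection I (V := V) (F := F) where
  toFun X := pairSection X 0
  map_add' _ _ := ContMDiffSection.ext fun _ => Prod.ext rfl (add_zero _).symm
  map_smul' r _ := ContMDiffSection.ext fun _ => Prod.ext rfl (smul_zero r).symm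

/-- The inclusion of the sections of the dual bundle, as a linear map. -/
def formInclusion : Cₛ^∞⟮I; F →L[ℝ] ℝ, fun x => DualFibre V x⟯ →ₗ[ℝ]
    SideSection I (V := V) (F := F) where
  toFun η := pairSection 0 η
  map_add' _ _ := ContMDiffSection.ext fun _ => Prod.ext (add_zero _).symm rfl
  map_smul' r _ := ContMDiffSection.ext fun _ => Prod.ext (smul_zero r).symm rfl

variable (I F V) in
/-- Dull brackets exist. -/
theorem exists_isDullBracket [SigmaCompactSpace M] :
    ∃ D : SideSection I (V := V) (F := F) →ₗ[ℝ] SideSection I (V := V) (F := F) →ₗ[ℝ]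
      SideSection I (V := V) (F := F), IsDullBracket (prTM I V) D := by
  obtain ⟨C, hC, hC'⟩ := exists_connection I (F →L[ℝ] ℝ) (fun x : M => DualFibre V x)
  -- For a connection ∇ on V*, D((X,ε),(Y,η)) = ([X,Y], ∇_X η - ∇_Y ε).
  let D : SideSection I (V := V) (F := F) →ₗ[ℝ] SideSection I (V := V) (F := F) →ₗ[ℝ]
      SideSection I (V := V) (F := F) :=
    ((bracketFieldLinear I M).compl₁₂ fieldPart fieldPart).compr₂ fieldInclusion +
      (C.compl₁₂ fieldPart formPart - (C.flip.compl₁₂ formPart fieldPart)).compr₂ formInclusion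
  have hD : ∀ s t x, D s t x = (bracketField (fstSection s) (fstSection t) x,
      C (fstSection s) (sndSection t) x - C (fstSection t) (sndSection s) x) := fun s t x =>
    Prod.ext (add_zero _) (zero_add _)
  refine ⟨D, fun s t x => congrArg Prod.fst (hD s t x), fun f g s t x => ?_⟩
  have h1 : bracketField (smulSection f (fstSection s)) (smulSection g (fstSection t)) x =
      (f x * g x) • bracketField (fstSection s) (fstSection t) x +
        (f x * dReal I g x (s x).1) • (t x).1 - (g x * dReal I f x (t x).1) • (s x).1 := by
    have h2 : ∀ (X Y : VectorFields I M), bracketField X Y x = -bracketField Y X x := fun X Y =>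
      congrArg (fun Z : VectorFields I M => Z x) (bracketField_swap X Y)
    have h3 : dReal I g x (smulSection f (fstSection s) x) = f x * dReal I g x (s x).1 :=
      map_smul _ _ _
    rw [bracketField_smulSection_right, h2, bracketField_smulSection_right, h3,
      h2 (fstSection t)]
    have h4 : fstSection t x = (t x).1 := rfl
    have h5 : fstSection s x = (s x).1 := rfl
    rw [h4, h5]
    module
  have h2 : ∀ (f g : C^∞⟮I, M; ℝ⟯) (s t : SideSection I (V := V) (F := F)),
      C (smulSection f (fstSection s)) (smulSection g (sndSection t)) x =
      (f x * g x) • C (fstSection s) (sndSection t) x +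
        (f x * dReal I g x (s x).1) • (t x).2 := fun f g s t => by
    rw [hC, hC', smul_add, smul_smul, smul_smul]
    rfl
  rw [hD, hD]
  refine Prod.ext h1 ?_
  refine (congrArg₂ (· - ·) (h2 f g s t) (h2 g f t s)).trans ?_
  have h3 : ∀ (a b c : ℝ) (u v w z : DualFibre V x), a • u + b • v - (a • w + c • z) =
    a • (u - w) + b • v - c • z := fun a b c u v w z => by
      rw [smul_sub]; abel
  rw [mul_comm (g x) (f x)]
  exact h3 _ _ _ _ _ _ _

end Existence

/-! ### Averaging a dull bracket to an adapted one. -/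

section Adapted


variable {EM : Type*} [NormedAddCommGroup EM] [NormedSpace ℝ EM] [FiniteDimensional ℝ EM]
  {HM : Type*} [TopologicalSpace HM]
  {I : ModelWithCorners ℝ EM HM} {M : Type*} [TopologicalSpace M] [ChartedSpace HM M]
  [IsManifold I ∞ M]
  {F : Type*} [NormedAddCommGroup F] [NormedSpace ℝ F] [FiniteDimensional ℝ F]
  {V : M → Type*} [TopologicalSpace (TotalSpace F V)] [∀ x, AddCommGroup (V x)]
  [∀ x, Module ℝ (V x)] [∀ x, TopologicalSpace (V x)]
  [∀ x, IsTopologicalAddGroup (V x)] [∀ x, ContinuousSMul ℝ (V x)]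
  [FiberBundle F V] [VectorBundle ℝ F V] [ContMDiffVectorBundle ∞ F V I]
variable [T2Space M] [I.Boundaryless]
  {D : SideSection I (V := V) (F := F) →ₗ[ℝ] SideSection I (V := V) (F := F) →ₗ[ℝ]
    SideSection I (V := V) (F := F)} {j : SideEnd I V (F := F)}
  {𝒥 : GenComplexStructure (I.prod 𝓘(ℝ, F)) (TotalSpace F V)}

theorem exists_continuousLinearMap_eq (F : Type*) [NormedAddCommGroup F] [NormedSpace ℝ F]
    [FiniteDimensional ℝ F] [TopologicalSpace (TotalSpace F V)] [FiberBundle F V]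
    [VectorBundle ℝ F V] {x : M} (φ : V x →ₗ[ℝ] ℝ) : ∃ ψ : V x →L[ℝ] ℝ, ∀ v, ψ v = φ v := by
  set t := trivializationAt F V x
  have hx : x ∈ t.baseSet := FiberBundle.mem_baseSet_trivializationAt' x
  refine ⟨(LinearMap.toContinuousLinearMap (φ.comp (t.symmL ℝ x : F →ₗ[ℝ] V x))).comp
    (t.continuousLinearMapAt ℝ x), fun v => ?_⟩
  exact congrArg φ (t.symmL_continuousLinearMapAt (R := ℝ) hx v)

/-- The difference at `p` between the projection `½ (σ(ν) - 𝒥 σ(j ν))` of the horizontal lift of `ν`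
and the horizontal lift of `ν`. -/
def liftChange (hD : IsDullBracket (prTM I V) D) (j : SideEnd I V (F := F))
    (𝒥 : GenEnd (I.prod 𝓘(ℝ, F)) (TotalSpace F V)) (p : TotalSpace F V) :
    SideSection I (V := V) (F := F) →ₗ[ℝ] GenTangentTotal I F V p where
  toFun ν := (-(1 / 2) : ℝ) • (liftAt hD p ν + 𝒥 p (liftAt hD p (j.mapSection ν)))
  map_add' μ ν := by
    have h1 : j.mapSection (μ + ν) = j.mapSection μ + j.mapSection ν := (endSection j).map_add μ ν
    have h2 : ∀ ξ η, 𝒥 p (ξ + η) = 𝒥 p ξ + 𝒥 p η := (𝒥 p).map_add'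
    rw [h1, map_add, map_add, h2, ← smul_add]
    congr 1
    abel
  map_smul' r ν := by
    have h1 : j.mapSection (r • ν) = r • j.mapSection ν := (endSection j).map_smul r ν
    have h2 : ∀ ξ, 𝒥 p (r • ξ) = r • 𝒥 p ξ := (𝒥 p).map_smul' r
    rw [h1, map_smul, map_smul, h2, ← smul_add, RingHom.id_apply, smul_comm]

theorem liftChange_apply (hD : IsDullBracket (prTM I V) D) (j : SideEnd I V (F := F))
    (𝒥 : GenEnd (I.prod 𝓘(ℝ, F)) (TotalSpace F V)) (p : TotalSpace F V)
    (ν : SideSection I (V := V) (F := F)) : liftChange hD j 𝒥 p ν =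
      (-(1 / 2) : ℝ) • (liftAt hD p ν + 𝒥 p (liftAt hD p (j.mapSection ν))) := rfl

theorem liftChange_smulSection (hD : IsDullBracket (prTM I V) D) (j : SideEnd I V (F := F))
    (𝒥 : GenEnd (I.prod 𝓘(ℝ, F)) (TotalSpace F V)) (p : TotalSpace F V) (f : C^∞⟮I, M; ℝ⟯)
    (ν : SideSection I (V := V) (F := F)) :
    liftChange hD j 𝒥 p (smulSection f ν) = f p.proj • liftChange hD j 𝒥 p ν := by
  have h1 : j.mapSection (smulSection f ν) = smulSection f (j.mapSection ν) :=
    ContMDiffSection.ext fun x => sideHom_smul (j x) (f x) (ν x)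
  have h2 : ∀ ξ, 𝒥 p (f p.proj • ξ) = f p.proj • 𝒥 p ξ := (𝒥 p).map_smul' (f p.proj)
  rw [liftChange_apply, liftChange_apply, h1, liftAt_smulSection, liftAt_smulSection, h2,
    ← smul_add, smul_comm]

/-- The two summands have sides ν and j²ν = -ν, so the change lies in the core. -/
theorem exists_coreLift_eq_liftChange (h : IsLinearOver 𝒥 j) (hD : IsDullBracket (prTM I V) D)
    (p : TotalSpace F V) (ν : SideSection I (V := V) (F := F)) :
    ∃ δ, coreLift I p δ = liftChange hD j 𝒥.toHom p ν := by
  refine exists_coreLift_of_sideMap_eq_zero ?_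
  have h1 : j p.proj (j.mapSection ν p.proj) = -ν p.proj := side_j_sq h hD p.proj (ν p.proj)
  rw [liftChange_apply, sideMap_smul, sideMap_add, h.side, sideMap_liftAt, sideMap_liftAt, h1,
    add_neg_cancel, smul_zero]

/-- Here the linearity of 𝒥 over the side enters: it makes the change of the lift fibrewise linear,
so that it can come from a change of D. -/
theorem isSideSum_liftChange (h : IsLinearOver 𝒥 j) (hD : IsDullBracket (prTM I V) D)
    (ν : SideSection I (V := V) (F := F)) {x : M} (e₁ e₂ : V x) :
    IsSideSum I (liftChange hD j 𝒥.toHom ⟨x, e₁⟩ ν) (liftChange hD j 𝒥.toHom ⟨x, e₂⟩ ν)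
      (liftChange hD j 𝒥.toHom ⟨x, e₁ + e₂⟩ ν) :=
  ((isSideSum_liftAt hD ν e₁ e₂).add (h.add x e₁ e₂ _ _ _
    (isSideSum_liftAt hD (j.mapSection ν) e₁ e₂))).smul _

theorem isSideSMul_liftChange (h : IsLinearOver 𝒥 j) (hD : IsDullBracket (prTM I V) D)
    (ν : SideSection I (V := V) (F := F)) (c : ℝ) {x : M} (e : V x) :
    IsSideSMul I c (liftChange hD j 𝒥.toHom ⟨x, e⟩ ν) (liftChange hD j 𝒥.toHom ⟨x, c • e⟩ ν) :=
  ((isSideSMul_liftAt hD ν c e).add (h.smul c x e _ _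
    (isSideSMul_liftAt hD (j.mapSection ν) c e))).smul _

/-- The function `⟨σ(μ), liftChange ν⟩` is linear in the fibres. -/
theorem exists_pairing_liftChange (h : IsLinearOver 𝒥 j) (hD : IsDullBracket (prTM I V) D)
    (μ ν : SideSection I (V := V) (F := F)) (x : M) : ∃ ψ : V x →L[ℝ] ℝ, ∀ e, ψ e =
      genPairing (I.prod 𝓘(ℝ, F)) (liftAt hD ⟨x, e⟩ μ) (liftChange hD j 𝒥.toHom ⟨x, e⟩ ν) := by
  have hδ : ∀ e : V x, ∃ δ : Core I V x,
      coreLift I (⟨x, e⟩ : TotalSpace F V) δ = liftChange hD j 𝒥.toHom ⟨x, e⟩ ν :=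
    fun e => exists_coreLift_eq_liftChange h hD ⟨x, e⟩ ν
  choose δ hδ using hδ
  obtain ⟨ψ, hψ⟩ := exists_continuousLinearMap_eq F (x := x) (V := V)
    { toFun := fun e => sidePairing (μ x) (δ e)
      map_add' := fun e₁ e₂ => by
        have h1 := isSideSum_liftChange h hD ν e₁ e₂
        rw [← hδ, ← hδ, ← hδ] at h1
        rw [isSideSum_coreLift_iff.1 h1, sidePairing_add_right]
      map_smul' := fun c e => by
        have h1 := isSideSMul_liftChange h hD ν c e
        rw [← hδ, ← hδ] at h1
        rw [isSideSMul_coreLift_iff.1 h1, sidePairing_smul_right]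
        rfl }
  refine ⟨ψ, fun e => (hψ e).trans ?_⟩
  rw [← hδ, genPairing_coreLift, sideMap_liftAt]
  rfl

/-- The functions `⟨σ(μ), liftChange ν⟩` define a bilinear map. -/
theorem exists_changeForm (h : IsLinearOver 𝒥 j) (hD : IsDullBracket (prTM I V) D) :
    ∃ Ψ : SideSection I (V := V) (F := F) →ₗ[ℝ] SideSection I (V := V) (F := F) →ₗ[ℝ]
      Cₛ^∞⟮I; F →L[ℝ] ℝ, fun x => DualFibre V x⟯, ∀ ν μ x (e : V x), Ψ ν μ x e =
      genPairing (I.prod 𝓘(ℝ, F)) (liftAt hD ⟨x, e⟩ μ) (liftChange hD j 𝒥.toHom ⟨x, e⟩ ν) := by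
  choose ψ hψ using exists_pairing_liftChange h hD
  let Ψ : SideSection I (V := V) (F := F) → SideSection I (V := V) (F := F) →
      Cₛ^∞⟮I; F →L[ℝ] ℝ, fun x => DualFibre V x⟯ := fun ν μ => ⟨fun x => ψ μ ν x, fun x => by
    refine contMDiffAt_hom_of_sections (W₂ := fun _ : M => ℝ) (fun x => ψ μ ν x) x Set.univ
      (fun e _ => ?_) fun w => (exists_section I F w).imp fun s hs => ⟨trivial, hs⟩
    rw [Bundle.contMDiffAt_section]
    refine (((contMDiff_genPairing (liftSection hD μ) ((-(1 / 2) : ℝ) • (liftSection hD ν +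
      𝒥.toHom.mapSection (liftSection hD (j.mapSection ν))))).comp
      (contMDiff_section_total e)) x).congr_of_eventuallyEq (Filter.Eventually.of_forall fun y => ?_)
    exact hψ μ ν y (e y)⟩
  have hΨ : ∀ ν μ x (e : V x), Ψ ν μ x e =
      genPairing (I.prod 𝓘(ℝ, F)) (liftAt hD ⟨x, e⟩ μ) (liftChange hD j 𝒥.toHom ⟨x, e⟩ ν) :=
    fun ν μ => hψ μ ν
  refine ⟨LinearMap.mk₂ ℝ Ψ (fun ν ν' μ => ?_) (fun r ν μ => ?_) (fun ν μ μ' => ?_)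
    (fun r ν μ => ?_), hΨ⟩ <;>
    refine ContMDiffSection.ext fun x => ContinuousLinearMap.ext fun e => ?_
  · refine Eq.trans ?_ (congrArg₂ (· + ·) (hΨ ν μ x e) (hΨ ν' μ x e)).symm
    rw [hΨ, map_add, genPairing_add_right]
  · refine Eq.trans ?_ (congrArg (r * ·) (hΨ ν μ x e)).symm
    rw [hΨ, map_smul, genPairing_smul_right]
  · refine Eq.trans ?_ (congrArg₂ (· + ·) (hΨ ν μ x e) (hΨ ν μ' x e)).symm
    rw [hΨ, map_add, genPairing_add_left]
  · refine Eq.trans ?_ (congrArg (r * ·) (hΨ ν μ x e)).symm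
    rw [hΨ, map_smul, genPairing_smul_left]

/-- Adding a tensor with values in the dual bundle to a dull bracket. -/
theorem IsDullBracket.add_form (hD : IsDullBracket (prTM I V) D)
    {Ψ : SideSection I (V := V) (F := F) →ₗ[ℝ] SideSection I (V := V) (F := F) →ₗ[ℝ]
      Cₛ^∞⟮I; F →L[ℝ] ℝ, fun x => DualFibre V x⟯}
    (hΨ : ∀ (f g : C^∞⟮I, M; ℝ⟯) ν μ x (e : V x), Ψ (smulSection f ν) (smulSection g μ) x e =
      f x * g x * Ψ ν μ x e) :
    IsDullBracket (prTM I V) (D + Ψ.compr₂ formInclusion) := by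
  refine ⟨fun s t x => (add_zero (D s t x).1).trans (hD.anchor_bracket s t x), fun f g s t x => ?_⟩
  have h1 : ∀ s t, (D + Ψ.compr₂ formInclusion) s t x = D s t x + ((0, Ψ s t x) : Side I V x) :=
    fun _ _ => rfl
  have h2 : ((0, Ψ (smulSection f s) (smulSection g t) x) : Side I V x) =
      (f x * g x) • ((0, Ψ s t x) : Side I V x) :=
    Prod.ext (smul_zero (f x * g x)).symm (ContinuousLinearMap.ext fun e => hΨ f g s t x e)
  rw [h1, h1, h2, hD.leibniz, smul_add]
  abel

/-- Every linear generalised complex structure has an adapted dull bracket. -/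
theorem exists_liftsTo [SigmaCompactSpace M] (h : IsLinearOver 𝒥 j) :
    ∃ (D : SideSection I (V := V) (F := F) →ₗ[ℝ] SideSection I (V := V) (F := F) →ₗ[ℝ]
      SideSection I (V := V) (F := F)) (hD : IsDullBracket (prTM I V) D), LiftsTo hD j 𝒥.toHom := by
  obtain ⟨D, hD⟩ := exists_isDullBracket I F V
  obtain ⟨Ψ, hΨ⟩ := exists_changeForm h hD
  -- Adding Ψ changes the lift of ν by the core element representing μ ↦ Ψ(ν, μ), which is
  -- `liftChange`. Hence the new lift is ½(σ(ν) - 𝒥σ(jν)).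
  have hD' : IsDullBracket (prTM I V) (D + Ψ.compr₂ formInclusion) :=
    hD.add_form fun f g ν μ x e => by
      rw [hΨ, hΨ, liftChange_smulSection, liftAt_smulSection, genPairing_smul_left,
        genPairing_smul_right, ← mul_assoc, mul_comm (f x)]
  refine ⟨_, hD', fun ν p => ?_⟩
  have h1 : ∀ ν, liftAt hD' p ν = liftAt hD p ν + liftChange hD j 𝒥.toHom p ν := fun ν => by
    obtain ⟨δ, hδ⟩ := exists_coreLift_eq_liftChange h hD p ν
    rw [← hδ]
    refine (isLift_liftAt hD' ν p).unique ((isLift_liftAt hD ν p).add_coreLift fun μ => ?_)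
    refine congrArg (linFun (D ν μ) p + ·) ((hΨ ν μ p.proj p.snd).trans ?_)
    have h2 := genPairing_coreLift p (liftAt hD p μ) δ
    rw [hδ, sideMap_liftAt] at h2
    exact h2
  have h2 : ∀ ξ η, 𝒥.toHom p (ξ + η) = 𝒥.toHom p ξ + 𝒥.toHom p η := (𝒥.toHom p).map_add'
  have h3 : ∀ (r : ℝ) ξ, 𝒥.toHom p (r • ξ) = r • 𝒥.toHom p ξ := (𝒥.toHom p).map_smul'
  have h4 : ∀ ξ, 𝒥.toHom p (-ξ) = -𝒥.toHom p ξ := fun ξ => by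
    rw [← 𝒥.sq p ξ, 𝒥.sq]
  -- With a = 𝒥σ(ν) and b = σ(jν), both sides are ½(a + b), by 𝒥² = -1 on the left and j² = -1 on
  -- the right.
  rw [h1, h1, liftChange_apply, liftChange_apply, h2, h3, h2, 𝒥.sq,
    mapSection_mapSection (side_j_sq h hD), map_neg, h4]
  set a := 𝒥.toHom p (liftAt hD p ν)
  set b := liftAt hD p (j.mapSection ν)
  have h5 : ∀ a b : GenTangentTotal I F V p,
      a + (-(1 / 2) : ℝ) • (a + -b) = b + (-(1 / 2) : ℝ) • (b + -a) := fun a b => by module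
  exact h5 a b

end Adapted

/-! ### The correspondence and its uniqueness. -/

section Correspondence


variable {EM : Type*} [NormedAddCommGroup EM] [NormedSpace ℝ EM] [FiniteDimensional ℝ EM]
  {HM : Type*} [TopologicalSpace HM]
  {I : ModelWithCorners ℝ EM HM} {M : Type*} [TopologicalSpace M] [ChartedSpace HM M]
  [IsManifold I ∞ M]
  {F : Type*} [NormedAddCommGroup F] [NormedSpace ℝ F] [FiniteDimensional ℝ F]
  {V : M → Type*} [TopologicalSpace (TotalSpace F V)] [∀ x, AddCommGroup (V x)]
  [∀ x, Module ℝ (V x)] [∀ x, TopologicalSpace (V x)]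
  [∀ x, IsTopologicalAddGroup (V x)] [∀ x, ContinuousSMul ℝ (V x)]
  [FiberBundle F V] [VectorBundle ℝ F V] [ContMDiffVectorBundle ∞ F V I]
variable [T2Space M] [I.Boundaryless]
  {D : SideSection I (V := V) (F := F) →ₗ[ℝ] SideSection I (V := V) (F := F) →ₗ[ℝ]
    SideSection I (V := V) (F := F)} {j : SideEnd I V (F := F)}
  {𝒥 : GenComplexStructure (I.prod 𝓘(ℝ, F)) (TotalSpace F V)}

theorem fstSection_bracket (hD : IsDullBracket (prTM I V) D)
    (s t : SideSection I (V := V) (F := F)) :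
    fstSection (D s t) = bracketField (fstSection s) (fstSection t) :=
  ContMDiffSection.ext fun x => hD.anchor_bracket s t x

/-- The TM-component is invisible to `linFun`; here it is [X, X] = 0. -/
theorem fstSection_bracket_self (hD : IsDullBracket (prTM I V) D)
    (s : SideSection I (V := V) (F := F)) : fstSection (D s s) = 0 := by
  rw [fstSection_bracket hD]
  have h := eq_neg_iff_add_eq_zero.1 (bracketField_swap (fstSection s) (fstSection s))
  rw [← two_smul ℝ] at h
  exact (smul_eq_zero.1 h).resolve_left two_ne_zero

/-- The TM-component is the Jacobi expression of vector fields. Together with `linFun` this allows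
the Jacobiator to be tested on E. -/
theorem fstSection_dullCurvature (hD : IsDullBracket (prTM I V) D)
    (s t u : SideSection I (V := V) (F := F)) : fstSection (dullCurvature D s t u) = 0 := by
  have h : fstSection (dullCurvature D s t u) = fstSection (D s (D t u)) -
    fstSection (D t (D s u)) + fstSection (D u (D s t)) := rfl
  rw [h]
  simp only [fstSection_bracket hD]
  exact bracketField_jacobi _ _ _

theorem GenComplexStructure.nijenhuisForm_eq_zero
    (e₁ e₂ e₃ : GenSections (I.prod 𝓘(ℝ, F)) (TotalSpace F V)) (p : TotalSpace F V) :
    nijenhuisForm 𝒥.toHom e₁ e₂ e₃ p = 0 := by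
  rw [nijenhuisForm_eq 𝒥.sq 𝒥.orthogonal]
  refine (congrArg (fun ξ => genPairing (I.prod 𝓘(ℝ, F)) ξ (e₃ p)) (𝒥.nijenhuis e₁ e₂ p)).trans ?_
  have h := genPairing_smul_left (0 : ℝ) (0 : GenTangentTotal I F V p) (e₃ p)
  rwa [zero_smul, zero_mul] at h

/-- An adapted dull bracket realises a complex Lie algebroid. -/
theorem exists_realises (h : IsLinearOver 𝒥 j) {hD : IsDullBracket (prTM I V) D}
    (hl : LiftsTo hD j 𝒥.toHom) : ∃ A : ComplexLieAlgebroid j, Realises j D A.bracket ∧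
      ∀ x ν, A.anchor x ν = complexAnchor j (prTM I V) x ν := by
  have hj := side_j_sq h hD
  have hN : ∀ s t, D s t - D (j.mapSection s) (j.mapSection t) +
      j.mapSection (D (j.mapSection s) t + D s (j.mapSection t)) = 0 := fun s t =>
    ContMDiffSection.ext fun x => side_ext fun τ => by
      obtain ⟨τ, rfl⟩ := exists_section_eq_core (F := F) τ
      -- This component of the Nijenhuis tensor is a function on M, so it may be read off along the
      -- zero section.
      have h1 := nijenhuisForm_liftSection_coreSection hl (actsOnCore h hD) s t τ ⟨x, 0⟩
      rw [GenComplexStructure.nijenhuisForm_eq_zero] at h1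
      refine h1.symm.trans ?_
      have h2 := sidePairing_smul_left (0 : ℝ) (0 : Side I V x) (τ x)
      rw [zero_smul, zero_mul] at h2
      exact h2.symm
  have hr := realises_complexBracket hj hN
  have hself : (complexBracket j D).IsAlt := fun s => by
    have h1 : D s s = D (j.mapSection s) (j.mapSection s) := by
      refine sideSection_ext_of_linFun (fun x => ?_) fun p => ?_
      · exact congrArg (fun X : VectorFields I M => X x)
          ((fstSection_bracket_self hD s).trans (fstSection_bracket_self hD (j.mapSection s)).symm)
      -- Since ⟨σ(s), σ(s)⟩ is twice ℓ of D(s,s), orthogonality and 𝒥σ(s) = σ(js) compare D(s,s)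
      -- with D(js,js).
      · have h2 := 𝒥.orthogonal p (liftAt hD p s) (liftAt hD p s)
        rw [hl, genPairing_liftAt, genPairing_liftAt, linFun_add, linFun_add] at h2
        have h3 : linFun (D (j.mapSection s) (j.mapSection s)) p +
          linFun (D (j.mapSection s) (j.mapSection s)) p =
            linFun (D s s) p + linFun (D s s) p := h2
        linarith
    rw [complexBracket_apply, ← h1, sub_self, smul_zero]
  have hjac : ∀ s t u, complexBracket j D s (complexBracket j D t u) +
      complexBracket j D t (complexBracket j D u s) +
      complexBracket j D u (complexBracket j D s t) = 0 := fun s t u => by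
    have key : (4 : ℝ) • (complexBracket j D s (complexBracket j D t u) +
        complexBracket j D t (complexBracket j D u s) +
        complexBracket j D u (complexBracket j D s t)) = 0 := by
      rw [← dullCurvature_eq_jacobiator hr fun s t => (hself.neg t s).symm]
      refine sideSection_ext_of_linFun (fun x => ?_) fun p => ?_
      · have h1 : ∀ s t u : SideSection I (V := V) (F := F), (dullCurvature D s t u x).1 = 0 :=
          fun s t u => congrArg (fun X : VectorFields I M => X x) (fstSection_dullCurvature hD s t u)
        refine (congrArg₂ (· - ·) (congrArg₂ (· - ·) (congrArg₂ (· - ·) (h1 s t u)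
          (h1 (j.mapSection s) (j.mapSection t) u)) (h1 (j.mapSection s) t (j.mapSection u)))
          (h1 s (j.mapSection t) (j.mapSection u))).trans ?_
        rw [sub_zero, sub_zero, sub_zero]
        rfl
      · rw [← nijenhuisForm_liftSection hl, GenComplexStructure.nijenhuisForm_eq_zero]
        rfl
    exact (smul_eq_zero.1 key).resolve_left four_ne_zero
  obtain ⟨A, hA, hA'⟩ := exists_complexLieAlgebroid hD hj hN hself hjac
  exact ⟨A, hA ▸ hr, hA'⟩

/-- Quasi-reality provides some real anchor ρ; the real part ½ρ of the complex anchor forces it to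
be pr_TM. -/
theorem QuasiRealStructure.exists_isDullBracket (A : QuasiRealStructure j) :
    ∃ D, IsDullBracket (prTM I V) D ∧ Realises j D A.1.bracket := by
  obtain ⟨A, hA, ρ, hρ, D, hD, hr⟩ := A
  have h1 : ρ = prTM I V := DFunLike.ext _ _ fun x => ContinuousLinearMap.ext fun ν => by
    have h2 : (1 / 2 : ℝ) • ρ x ν = (1 / 2 : ℝ) • prTM I V x ν :=
      congrArg Prod.fst ((hρ x ν).symm.trans (hA x ν))
    exact smul_right_injective (TangentSpace I x) (one_div_ne_zero (two_ne_zero (α := ℝ))) h2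
  exact ⟨D, h1 ▸ hD, hr⟩

/-- `𝒥` and the complex Lie algebroid `A` correspond to each other: they have a common adapted and
realising dull bracket. -/
def Corresponds (𝒥 : LinearGenComplexStructure j) (A : QuasiRealStructure j) : Prop :=
  ∃ (D : SideSection I (V := V) (F := F) →ₗ[ℝ] SideSection I (V := V) (F := F) →ₗ[ℝ]
      SideSection I (V := V) (F := F)) (hD : IsDullBracket (prTM I V) D),
    Realises j D A.1.bracket ∧ LiftsTo hD j 𝒥.1.toHom

/-- One common bracket suffices for all dull brackets, because adapting and realising impose the
same condition on the difference to it. -/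
theorem Corresponds.realises_iff {𝒥 : LinearGenComplexStructure j} {A : QuasiRealStructure j}
    (h : Corresponds 𝒥 A) (hD : IsDullBracket (prTM I V) D) :
    Realises j D A.1.bracket ↔ LiftsTo hD j 𝒥.1.toHom := by
  obtain ⟨D', hD', hr, hl⟩ := h
  exact realises_iff_liftsTo A.1.j_sq (actsOnCore 𝒥.2 hD') hl hr hD

/-- A bracket adapted to `𝒥'` and realising A is also adapted to 𝒥, and j with an adapted bracket
determines the structure. -/
theorem Corresponds.left_unique {𝒥 𝒥' : LinearGenComplexStructure j} {A : QuasiRealStructure j}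
    (h : Corresponds 𝒥 A) (h' : Corresponds 𝒥' A) : 𝒥 = 𝒥' := by
  obtain ⟨D, hD, hr, hl⟩ := h'
  exact Subtype.ext (GenComplexStructure.eq_of_liftsTo 𝒥.2 𝒥'.2 ((h.realises_iff hD).1 hr) hl)

/-- A bracket adapted to 𝒥 realises both complex brackets, and a bracket realises at most one. The
anchors agree by definition. -/
theorem Corresponds.right_unique {𝒥 : LinearGenComplexStructure j} {A A' : QuasiRealStructure j}
    (h : Corresponds 𝒥 A) (h' : Corresponds 𝒥 A') : A = A' := by
  obtain ⟨D, hD, hr, hl⟩ := h'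
  refine Subtype.ext (ComplexLieAlgebroid.ext (((h.realises_iff hD).2 hl).unique hr) ?_)
  exact DFunLike.ext _ _ fun x => ContinuousLinearMap.ext fun ν =>
    (A.2.1 x ν).trans (A'.2.1 x ν).symm

theorem exists_corresponds_left (A : QuasiRealStructure j) :
    ∃ 𝒥 : LinearGenComplexStructure j, Corresponds 𝒥 A := by
  obtain ⟨D, hD, hr⟩ := A.exists_isDullBracket
  obtain ⟨𝒥, h𝒥⟩ := exists_genComplexStructure hD A.1 hr
  refine ⟨⟨𝒥, isLinearOver_of_liftEnd hD h𝒥⟩, D, hD, hr, ?_⟩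
  have h : LiftsTo hD j 𝒥.toHom := by
    rw [h𝒥]
    exact liftsTo_liftEnd hD j
  exact h

theorem exists_corresponds_right [SigmaCompactSpace M] (𝒥 : LinearGenComplexStructure j) :
    ∃ A : QuasiRealStructure j, Corresponds 𝒥 A := by
  obtain ⟨D, hD, hl⟩ := exists_liftsTo 𝒥.2
  obtain ⟨A, hA, hA'⟩ := exists_realises 𝒥.2 hl
  exact ⟨⟨A, hA', prTM I V, hA', D, hD, hA⟩, D, hD, hA, hl⟩

end Correspondence

end LinearGC

end

theorem mainTheorem2
    {EM : Type*} [NormedAddCommGroup EM] [NormedSpace ℝ EM] [FiniteDimensional ℝ EM]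
    {HM : Type*} [TopologicalSpace HM] (I : ModelWithCorners ℝ EM HM) [I.Boundaryless]
    {M : Type*} [TopologicalSpace M] [ChartedSpace HM M] [IsManifold I ∞ M]
    [T2Space M] [SigmaCompactSpace M]
    (F : Type*) [NormedAddCommGroup F] [NormedSpace ℝ F] [FiniteDimensional ℝ F]
    (V : M → Type*) [TopologicalSpace (TotalSpace F V)] [∀ x, AddCommGroup (V x)]
    [∀ x, Module ℝ (V x)] [∀ x, TopologicalSpace (V x)]
    [∀ x, IsTopologicalAddGroup (V x)] [∀ x, ContinuousSMul ℝ (V x)]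
    [FiberBundle F V] [VectorBundle ℝ F V] [ContMDiffVectorBundle ∞ F V I]
    (j : SideEnd I V (F := F)) :
    ∃ Φ : LinearGenComplexStructure j ≃ QuasiRealStructure j,
      ∀ (𝒥 : LinearGenComplexStructure j)
        (D : SideSection I (F := F) (V := V) →ₗ[ℝ] SideSection I (F := F) (V := V) →ₗ[ℝ]
          SideSection I (F := F) (V := V)),
        IsDullBracket (prTM I V) D →
          (Realises j D (Φ 𝒥).1.bracket ↔ IsAdapted 𝒥.1 j D) := by
  choose Φ hΦ using exists_corresponds_right (j := j)
  refine ⟨Equiv.ofBijective Φ ⟨fun 𝒥 𝒥' h => ?_, fun A => ?_⟩, fun 𝒥 D hD => ?_⟩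
  · exact (hΦ 𝒥).left_unique (h ▸ hΦ 𝒥')
  · obtain ⟨𝒥, h𝒥⟩ := exists_corresponds_left A
    exact ⟨𝒥, (hΦ 𝒥).right_unique h𝒥⟩
  · exact ((hΦ 𝒥).realises_iff hD).trans (isAdapted_iff hD).symm
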